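/- Let $(V,d)$ be a finite metric space with $n\ge 1$ points, partitioned into $m$ color classes $V_1,\dots,V_m$, and let $k\le m$ and $\ell_i,u_i$ ($1\le i\le m$) be nonnegative integers. A set $S\subseteq V$ is *feasible* if $|S|=k$ and $\ell_i\le |S\cap V_i|\le u_i$ for all $i$; its diversity is $\mathrm{div}(S)=\min_{u\ne v\in S}d(u,v)$ ($+\infty$ if $|S|\le 1$). Let $\log$ be the natural logarithm and put $\alpha=\sqrt{\log m}/m$, $\Delta_1=\max(\lfloor 1/(4\alpha)\rfloor,1)$, $\Delta_2=\lfloor 1/(2\alpha)\rfloor$ (for $m=1$, where $\alpha=0$, put $\Delta_1=\Delta_2=1$). For parameters $\gamma_1,\gamma_2>0$, a budget $b$ and $T\in\mathbb N$, the *main algorithm* does the following. 1. Pruning. For each color $i$ start with $U_i=\emptyset$ and all points of $V_i$ unmarked; while $V_i$ has an unmarked point and $|U_i|\le b$, pick any unmarked $v\in V_i$, mark all $u\in V_i$ with $d(u,v)<\gamma_1$, and add $v$ to $U_i$. Let $U=\bigcup_i U_i$. 2. Start with $S=\emptyset$ and repeat steps (a), (b) $T\cdot m$ times or until $S$ is feasible;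 then return $S$. (a) Let $G$ be the graph on $U$ with an edge between distinct $u,v$ whenever $d(u,v)<\gamma_2\alpha$, let $d_G$ be its shortest path distance, and $B_G(u,R)=\{v\in U: d_G(u,v)\le R\}$. Draw a uniformly random enumeration $\pi$ of $U$ and, independently, a uniformly random $R\in\{\Delta_1,\dots,\Delta_2\}$. For $1\le j\le |U|$ let $C_j=B_G(\pi(j),R)\setminus\bigcup_{i<j}B_G(\pi(i),R)$ and $D_j=\{u\in C_j: d_G(\pi(j),u)<R\}$. (b) Compute an integral maximum $s$-$t$ flow in the network with nodes $s$, $D_1,\dots,D_{|U|}$, $c_1,\dots,c_m$, $z$, $t$ and edges $s\to D_i$ of capacity $1$, $D_i\to c_j$ of capacity $1$ for each point of color $j$ in $D_i$, $c_j\to t$ of capacity $\ell_j$, $c_j\to z$ of capacity $u_j-\ell_j$, and $z\to t$ of capacity $k-\sum_j\ell_j$. Let $S$ consist of one arbitrary point of color $j$ from $D_i$ for each pair $(i,j)$ such that $D_i\to c_j$ carries flow. Let $\tau>0$, and run the main algorithm with $\gamma_1=\gamma_2=\tau/3$ and $b=n$. (i) There is an absolute constant $c>0$ such that, if some feasible set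 $O$ has $\mathrm{div}(O)\ge\tau$, then, however the arbitrary choices in the algorithm are made (by fixed rules independent of its random draws), with probability at least $1-2^{-cT}$ the returned set $S$ is feasible and $$\mathrm{div}(S)\ \ge\ \frac{\sqrt{\log m}\,\tau}{3m}.$$ (ii) If $\ell_i\le u_i$ for all $i$ and $\sum_i\ell_i\le k$ (which holds whenever a feasible set exists), and $T\ge 1$, then the running time is $O(T m^2 n^2)$ with an absolute constant: the algorithm, with suitable rules for the arbitrary choices, is carried out by one fixed program on a randomized real random access machine, with unit-cost operations (including the evaluation of $d(u,v)$) and random permutations of $N$ objects drawn at cost $O(N)$, that never makes more than $C\,T m^2 n^2$ steps. -/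

import Mathlib

open scoped ENNReal

universe u

namespace FairDiv

/-! ## The fair max-min diversification problem -/

/-- Data of a fair max-min diversification problem on the point set `V` with `m` colors. -/
structure Problem (V : Type u) (m : ℕ) where
  /-- the color of a point; the color class `V_i` is the fibre over `i` -/
  color : V → Fin m
  /-- `ℓ_i` -/
  lower : Fin m → ℕ
  /-- `u_i` -/
  upper : Fin m → ℕ
  /-- the size of a solution -/
  k : ℕ

/-- `S` satisfies the constraints: `|S| = k` and `ℓ_i ≤ |S ∩ V_i| ≤ u_i` for every color `i`. -/
def Problem.Feasible {V : Type u} {m : ℕ} (I : Problem V m) (S : Finset V) : Prop :=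
  S.card = I.k ∧
    ∀ i, I.lower i ≤ (S.filter (fun v => I.color v = i)).card ∧
      (S.filter (fun v => I.color v = i)).card ≤ I.upper i

/-- The diversity score: the least distance between two distinct points of `S`
(`∞` if `S` has at most one point). -/
noncomputable def diversity {V : Type u} [MetricSpace V] (S : Finset V) : ℝ≥0∞ :=
  (S : Set V).einfsep

/-! ## Pruning -/

open Classical in
/-- The while loop that prunes one color class. The arguments after the budget are a bound on the
number of passes, the set of unmarked points of the class, and the set of points selected so far.
Each pass marks at least the selected point when `0 < γ`, so that a number of passes equal to the
number of points lets the loop run until its own condition fails. -/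
noncomputable def pruneLoop {V : Type u} [MetricSpace V] (pick : Finset V → V) (γ : ℝ) (b : ℕ) :
    ℕ → Finset V → Finset V → Finset V
  | 0, _, W => W
  | passes + 1, unmarked, W =>
    if unmarked.Nonempty ∧ W.card ≤ b then
      pruneLoop pick γ b passes
        (unmarked.filter (fun u => ¬ dist u (pick unmarked) < γ))
        (insert (pick unmarked) W)
    else W

open Classical in
/-- The pruned set `U = U_1 ∪ ⋯ ∪ U_m`. -/
noncomputable def prune {V : Type u} [Fintype V] [MetricSpace V] {m : ℕ} (I : Problem V m)
    (pick : Finset V → V) (γ : ℝ) (b : ℕ) : Finset V :=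
  Finset.univ.biUnion fun i : Fin m =>
    pruneLoop pick γ b (Fintype.card V) (Finset.univ.filter (fun v => I.color v = i)) ∅

/-! ## Random decomposition -/

/-- `α = √(log m) / m`. -/
noncomputable def alpha (m : ℕ) : ℝ := Real.sqrt (Real.log m) / m

/-- `Δ₁ = max(⌊1/(4α)⌋, 1)`. -/
noncomputable def Δ₁ (m : ℕ) : ℕ := max ⌊1 / (4 * alpha m)⌋₊ 1

/-- `Δ₂ = ⌊1/(2α)⌋`. For `m = 1`, where `α = 0` and the quotient means nothing, the maximum makes
it `1`; the graph below has no edges then, and all radii `R ≥ 1` give the same decomposition.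
For `m ≥ 2` one has `Δ₁ ≤ ⌊1/(2α)⌋`, and the maximum has no effect. -/
noncomputable def Δ₂ (m : ℕ) : ℕ := max ⌊1 / (2 * alpha m)⌋₊ (Δ₁ m)

/-- The graph on `U` whose edges are the pairs at distance less than `r`
(points outside of `U` are isolated vertices). -/
def nearGraph {V : Type u} [MetricSpace V] (U : Finset V) (r : ℝ) : SimpleGraph V where
  Adj u v := u ≠ v ∧ u ∈ U ∧ v ∈ U ∧ dist u v < r
  symm := ⟨fun u v h => ⟨h.1.symm, h.2.2.1, h.2.1, by rw [dist_comm]; exact h.2.2.2⟩⟩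
  loopless := ⟨fun _ h => h.1 rfl⟩

open Classical in
/-- `B_G(u, R)`: the points of `U` at shortest path distance at most `R` from `u`. -/
noncomputable def ball {V : Type u} (U : Finset V) (G : SimpleGraph V) (u : V) (R : ℕ) :
    Finset V :=
  U.filter (fun v => G.edist u v ≤ (R : ℕ∞))

open Classical in
/-- `C_j`: the points of `B_G(π(j), R)` that lie in no `B_G(π(i), R)` with `i < j`. -/
noncomputable def cell {V : Type u} (U : Finset V) (G : SimpleGraph V) (π : Fin U.card ≃ U) (R : ℕ)
    (j : Fin U.card) : Finset V :=
  (ball U G (π j) R).filter (fun v => ∀ i < j, v ∉ ball U G (π i) R)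

open Classical in
/-- `D_j`: the points of `C_j` at shortest path distance less than `R` from `π(j)`. -/
noncomputable def cluster {V : Type u} (U : Finset V) (G : SimpleGraph V) (π : Fin U.card ≃ U)
    (R : ℕ) (j : Fin U.card) : Finset V :=
  (cell U G π R j).filter (fun v => G.edist (π j : V) v < (R : ℕ∞))

open Classical in
/-- The law of the decomposition `D_1, …, D_{|U|}`: `π` is a uniformly random enumeration of `U`
and `R` is uniform in `{Δ₁, …, Δ₂}`, independently. -/
noncomputable def decompose {V : Type u} [MetricSpace V] (m : ℕ) (U : Finset V)
    (γ : ℝ) : PMF (Fin U.card → Finset V) :=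
  haveI : Nonempty (Fin U.card ≃ U) := ⟨U.equivFin.symm⟩
  (PMF.uniformOfFintype (Fin U.card ≃ U)).bind fun π =>
    (PMF.uniformOfFinset (Finset.Icc (Δ₁ m) (Δ₂ m))
        (Finset.nonempty_Icc.2 (le_max_right _ _))).map fun R =>
      cluster U (nearGraph U (γ * alpha m)) π R

/-! ## Assigning colors to clusters -/

/-- An assignment of natural numbers to the edges of the network with nodes `s`, the clusters
`D_1, …, D_N`, the colors `c_1, …, c_m`, `z` and `t`. -/
structure EdgeFlow (N m : ℕ) where
  /-- on `s → D_i` -/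
  fromSource : Fin N → ℕ
  /-- on `D_i → c_j` (the sum over the parallel edges) -/
  assign : Fin N → Fin m → ℕ
  /-- on `c_j → t` -/
  toSink : Fin m → ℕ
  /-- on `c_j → z` -/
  toSlack : Fin m → ℕ
  /-- on `z → t` -/
  slackToSink : ℕ

/-- The amount that leaves the source. -/
def EdgeFlow.value {N m : ℕ} (f : EdgeFlow N m) : ℕ := ∑ i, f.fromSource i

/-- `f` is an integral flow: it respects the capacities (one unit edge `D_i → c_j` for each point
of `D_i` with color `j`) and is conserved at each node other than `s` and `t`. -/
structure IsFlow {V : Type u} {N m : ℕ} (I : Problem V m) (D : Fin N → Finset V)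
    (f : EdgeFlow N m) : Prop where
  fromSource_le : ∀ i, f.fromSource i ≤ 1
  assign_le : ∀ i j, f.assign i j ≤ ((D i).filter (fun v => I.color v = j)).card
  toSink_le : ∀ j, f.toSink j ≤ I.lower j
  toSlack_le : ∀ j, f.toSlack j ≤ I.upper j - I.lower j
  slackToSink_le : f.slackToSink ≤ I.k - ∑ j, I.lower j
  conserve_cluster : ∀ i, f.fromSource i = ∑ j, f.assign i j
  conserve_color : ∀ j, ∑ i, f.assign i j = f.toSink j + f.toSlack j
  conserve_slack : ∑ j, f.toSlack j = f.slackToSink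

/-- `f` is an integral flow of maximum value. -/
def IsMaxFlow {V : Type u} {N m : ℕ} (I : Problem V m) (D : Fin N → Finset V)
    (f : EdgeFlow N m) : Prop :=
  IsFlow I D f ∧ ∀ g, IsFlow I D g → g.value ≤ f.value

/-- The choices that the assignment step leaves open: which integral maximum flow is computed,
and which point of a given color is taken from a cluster. -/
structure AssignRule {V : Type u} {m : ℕ} (I : Problem V m) where
  solve : {N : ℕ} → (Fin N → Finset V) → EdgeFlow N m
  isMaxFlow_solve : ∀ {N : ℕ} (D : Fin N → Finset V), IsMaxFlow I D (solve D)
  rep : Finset V → V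
  rep_mem : ∀ A : Finset V, A.Nonempty → rep A ∈ A

open Classical in
/-- The set read off from a maximum flow: whenever `D_i` flows to `c_j`, a point of `D_i` of
color `j` is taken. -/
noncomputable def extract {V : Type u} {m : ℕ} (I : Problem V m) (A : AssignRule I) {N : ℕ}
    (D : Fin N → Finset V) : Finset V :=
  ((Finset.univ : Finset (Fin N × Fin m)).filter (fun p => 0 < (A.solve D).assign p.1 p.2)).image
    (fun p => A.rep ((D p.1).filter (fun v => I.color v = p.2)))

/-! ## The main algorithm -/

/-- All the choices that the main algorithm leaves open. The rules of the assignment step may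
differ from one repetition to the next. -/
structure Choices {V : Type u} {m : ℕ} (I : Problem V m) where
  /-- the next point to select, given the unmarked points -/
  pick : Finset V → V
  pick_mem : ∀ A : Finset V, A.Nonempty → pick A ∈ A
  rule : ℕ → AssignRule I

open Classical in
/-- Decompose and assign, at most as many times as the numeral says, until the result satisfies the
constraints. The last argument is the current set `S`. -/
noncomputable def repeatLoop {V : Type u} [MetricSpace V] {m : ℕ}
    (I : Problem V m) (rule : ℕ → AssignRule I) (U : Finset V) (γ : ℝ) :
    ℕ → Finset V → PMF (Finset V)
  | 0, S => PMF.pure S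
  | r + 1, _ => (decompose m U γ).bind fun D =>
      if I.Feasible (extract I (rule r) D) then PMF.pure (extract I (rule r) D)
      else repeatLoop I rule U γ r (extract I (rule r) D)

/-- The law of the output of the main algorithm with thresholds `γ₁`, `γ₂`, budget `b` and
repetition parameter `T` (there are at most `T * m` repetitions). -/
noncomputable def fmmd {V : Type u} [Fintype V] [MetricSpace V] {m : ℕ}
    (I : Problem V m) (χ : Choices I) (γ₁ γ₂ : ℝ) (b T : ℕ) : PMF (Finset V) :=
  repeatLoop I χ.rule (prune I χ.pick γ₁ b) γ₂ (T * m) ∅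

/-! ## A randomized real random access machine

Structured programs over natural-number variables, natural-number arrays and real variables.
Every elementary operation takes one step: addition and truncated subtraction of naturals (no
multiplication), array access, the operations `+ - * / √ log` on reals, comparisons, assignments,
the evaluation of the distance between two points given by their indices. Reals cannot be rounded
to naturals. A uniformly random natural number takes one step, and a uniformly random permutation
of `N` objects takes `N` steps. The only loops are `for` loops. -/

/-- The memory, with the number of steps made so far. -/
structure Store where
  num : ℕ → ℕ
  arr : ℕ → ℕ → ℕ
  real : ℕ → ℝ
  time : ℕ

/-- Let `t` steps pass. -/
def Store.tick (s : Store) (t : ℕ) : Store := { s with time := s.time + t }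

/-- Assign to a number variable. -/
def Store.setNum (s : Store) (x v : ℕ) : Store := { s with num := Function.update s.num x v }

/-- Assign to an array cell. -/
def Store.setArr (s : Store) (a i v : ℕ) : Store :=
  { s with arr := Function.update s.arr a (Function.update (s.arr a) i v) }

/-- Assign to a real variable. -/
noncomputable def Store.setReal (s : Store) (x : ℕ) (v : ℝ) : Store :=
  { s with real := Function.update s.real x v }

/-- Natural-number expressions. -/
inductive NatExpr where
  | lit (c : ℕ)
  | var (x : ℕ)
  | get (a : ℕ) (i : NatExpr)
  | add (e f : NatExpr)
  | sub (e f : NatExpr)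

def NatExpr.eval (s : Store) : NatExpr → ℕ
  | lit c => c
  | var x => s.num x
  | get a i => s.arr a (i.eval s)
  | add e f => e.eval s + f.eval s
  | sub e f => e.eval s - f.eval s

def NatExpr.cost : NatExpr → ℕ
  | lit _ => 1
  | var _ => 1
  | get _ i => i.cost + 1
  | add e f => e.cost + f.cost + 1
  | sub e f => e.cost + f.cost + 1

/-- Real expressions. -/
inductive RealExpr where
  | ofNat (e : NatExpr)
  | var (x : ℕ)
  | add (e f : RealExpr)
  | sub (e f : RealExpr)
  | mul (e f : RealExpr)
  | div (e f : RealExpr)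
  | sqrt (e : RealExpr)
  | log (e : RealExpr)
  | dist (i j : NatExpr)

/-- The value of a real expression, for the distance function `δ` on indices. -/
noncomputable def RealExpr.eval (δ : ℕ → ℕ → ℝ) (s : Store) : RealExpr → ℝ
  | ofNat e => (e.eval s : ℝ)
  | var x => s.real x
  | add e f => e.eval δ s + f.eval δ s
  | sub e f => e.eval δ s - f.eval δ s
  | mul e f => e.eval δ s * f.eval δ s
  | div e f => e.eval δ s / f.eval δ s
  | sqrt e => Real.sqrt (e.eval δ s)
  | log e => Real.log (e.eval δ s)
  | dist i j => δ (i.eval s) (j.eval s)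

def RealExpr.cost : RealExpr → ℕ
  | ofNat e => e.cost + 1
  | var _ => 1
  | add e f => e.cost + f.cost + 1
  | sub e f => e.cost + f.cost + 1
  | mul e f => e.cost + f.cost + 1
  | div e f => e.cost + f.cost + 1
  | sqrt e => e.cost + 1
  | log e => e.cost + 1
  | dist i j => i.cost + j.cost + 1

/-- Tests. -/
inductive Test where
  | lt (e f : NatExpr)
  | eq (e f : NatExpr)
  | ltReal (e f : RealExpr)
  | neg (b : Test)
  | conj (b c : Test)

def Test.Holds (δ : ℕ → ℕ → ℝ) (s : Store) : Test → Prop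
  | lt e f => e.eval s < f.eval s
  | eq e f => e.eval s = f.eval s
  | ltReal e f => e.eval δ s < f.eval δ s
  | neg b => ¬ b.Holds δ s
  | conj b c => b.Holds δ s ∧ c.Holds δ s

def Test.cost : Test → ℕ
  | lt e f => e.cost + f.cost + 1
  | eq e f => e.cost + f.cost + 1
  | ltReal e f => e.cost + f.cost + 1
  | neg b => b.cost + 1
  | conj b c => b.cost + c.cost + 1

/-- Programs. -/
inductive Prog where
  | skip
  /-- `x := e` -/
  | setNum (x : ℕ) (e : NatExpr)
  /-- `a[i] := e` -/
  | setArr (a : ℕ) (i e : NatExpr)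
  /-- `x := e` -/
  | setReal (x : ℕ) (e : RealExpr)
  /-- `x :=` a uniformly random element of `{0, …, e}` -/
  | rand (x : ℕ) (e : NatExpr)
  /-- `a[0], …, a[e - 1] :=` a uniformly random permutation of `0, …, e - 1` -/
  | shuffle (a : ℕ) (e : NatExpr)
  | seq (p q : Prog)
  | ite (b : Test) (p q : Prog)
  /-- `for x = 0, …, e - 1 do p`, where `e` is evaluated once, before the loop -/
  | loop (x : ℕ) (e : NatExpr) (p : Prog)

/-- The first `N` rounds of a loop with counter `x`; each round costs one step besides its body. -/
noncomputable def iterRounds (x : ℕ) (body : Store → PMF Store) : ℕ → Store → PMF Store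
  | 0, s => PMF.pure s
  | N + 1, s => (iterRounds x body N s).bind fun s' => body ((s'.setNum x N).tick 1)

open Classical in
/-- The law of the store after the execution of a program. -/
noncomputable def Prog.exec (δ : ℕ → ℕ → ℝ) : Prog → Store → PMF Store
  | skip => fun s => PMF.pure (s.tick 1)
  | setNum x e => fun s => PMF.pure ((s.setNum x (e.eval s)).tick (e.cost + 1))
  | setArr a i e => fun s =>
      PMF.pure ((s.setArr a (i.eval s) (e.eval s)).tick (i.cost + e.cost + 1))
  | setReal x e => fun s => PMF.pure ((s.setReal x (e.eval δ s)).tick (e.cost + 1))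
  | rand x e => fun s =>
      (PMF.uniformOfFintype (Fin (e.eval s + 1))).map fun v =>
        (s.setNum x v).tick (e.cost + 1)
  | shuffle a e => fun s =>
      (PMF.uniformOfFintype (Equiv.Perm (Fin (e.eval s)))).map fun σ =>
        Store.tick
          { s with
            arr := Function.update s.arr a fun i =>
              if h : i < e.eval s then (σ ⟨i, h⟩ : ℕ) else s.arr a i }
          (e.cost + e.eval s + 1)
  | seq p q => fun s => (p.exec δ s).bind (q.exec δ)
  | ite b p q => fun s =>
      if b.Holds δ s then p.exec δ (s.tick (b.cost + 1)) else q.exec δ (s.tick (b.cost + 1))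
  | loop x e p => fun s => iterRounds x (p.exec δ) (e.eval s) (s.tick (e.cost + 1))

/-! ## Input and output of a program for the diversification problem

The points are numbered from `0` to `n - 1` by `e`. -/

/-- Distances between points, by their numbers. -/
noncomputable def distByIndex {V : Type u} [Fintype V] [MetricSpace V]
    (e : V ≃ Fin (Fintype.card V)) (i j : ℕ) : ℝ :=
  if h : i < Fintype.card V ∧ j < Fintype.card V then
    dist (e.symm ⟨i, h.1⟩) (e.symm ⟨j, h.2⟩)
  else 0

/-- The initial store: number variables `0, …, 4` hold `n`, `m`, `k`, `b`, `T`; arrays `0`, `1`, `2`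
hold the colors of the points and the bounds `ℓ`, `u`; real variables `0`, `1` hold `γ₁`, `γ₂`;
everything else is zero. -/
noncomputable def inputStore {V : Type u} [Fintype V] {m : ℕ} (I : Problem V m)
    (e : V ≃ Fin (Fintype.card V)) (γ₁ γ₂ : ℝ) (b T : ℕ) : Store where
  num
    | 0 => Fintype.card V
    | 1 => m
    | 2 => I.k
    | 3 => b
    | 4 => T
    | _ => 0
  arr
    | 0 => fun i => if h : i < Fintype.card V then (I.color (e.symm ⟨i, h⟩) : ℕ) else 0
    | 1 => fun j => if h : j < m then I.lower ⟨j, h⟩ else 0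
    | 2 => fun j => if h : j < m then I.upper ⟨j, h⟩ else 0
    | _ => fun _ => 0
  real
    | 0 => γ₁
    | 1 => γ₂
    | _ => 0
  time := 0

/-- The set returned: the points whose entry in array `3` is not zero. -/
def outputSet {V : Type u} [Fintype V] (e : V ≃ Fin (Fintype.card V)) (s : Store) : Finset V :=
  Finset.univ.filter (fun v => s.arr 3 (e v) ≠ 0)

/-- On the given input, the program `p` performs the main algorithm (with some way of making the
choices that the algorithm leaves open), and never makes more than `t` steps. -/
def Implements {V : Type u} [Fintype V] [MetricSpace V] {m : ℕ} (p : Prog) (I : Problem V m)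
    (e : V ≃ Fin (Fintype.card V)) (γ₁ γ₂ : ℝ) (b T : ℕ) (t : ℕ) : Prop :=
  (∃ χ : Choices I,
    (p.exec (distByIndex e) (inputStore I e γ₁ γ₂ b T)).map (outputSet e) =
      fmmd I χ γ₁ γ₂ b T) ∧
  ∀ s ∈ (p.exec (distByIndex e) (inputStore I e γ₁ γ₂ b T)).support, s.time ≤ t

end FairDiv

/-! Write γ = τ/3 and G for the threshold graph on the pruned set U. Diversity of the output holds
surely; only feasibility is random. A cluster omits the outermost layer of its cell, so a G-neighbor
of one of its points is reached by the same center and cannot enter a later cluster. Hence different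
clusters are at distance at least γα (`le_dist_of_mem_cluster`), and the flow takes at most one
point from each.

For feasibility, pruning keeps points of equal color γ apart and moves a set of diversity τ to a
feasible O ⊆ U whose points are γ apart (`exists_feasible_subset_prune`). Since 2Δ₂α ≤ 1, any two
points of a ball of radius R ≤ Δ₂ are closer than γ. Such a ball has at most one point of each
color, hence at most m points, and at most one point of O. If the clusters cover O, then O itself
yields a flow of value k, and every maximum flow yields a feasible set.

For fixed R, a point o ∈ O is covered as soon as the first point of B(o,R) in the enumeration lies
in B(o,R-1). These balls are disjoint for different o, so the events are independent
(`card_firstIn_mul`), and O is covered with probability at least ∏ |B(o,R-1)|/|B(o,R)|. Averaging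
over the L = Δ₂-Δ₁+1 radii, the inequality of arithmetic and geometric means makes the ratios
telescope (`rpow_le_mean_prod`). Each resulting ratio |B(o,Δ₁-1)|/|B(o,Δ₂)| is at least Δ₁/m,
because a ball that still grows at radius Δ₁-1 has at least Δ₁ points. As Δ₁ and L are at least of
order m/√(log m), the bound (Δ₁/m)^(k/L) is at least c/m (`exists_const_le_rpow`), and Tm
repetitions all fail with probability at most (1-c/m)^(Tm) ≤ exp(-cT).

The running time is that of an explicit program, `mainProg`. Its correctness is shown by loop
invariants and its cost by the calculus `Takes`. A decomposition costs O(mn²): for each of n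
centers, at most m queue entries are scanned against n points. The flow costs O(mn²) as well: O(n)
augmentations, each found by m sweeps over n points. There are Tm repetitions. The flow is maximized
in two phases, within the lower and then within the upper bounds, and a set of saturated colors
certifies optimality (`sum_le_of_stuck`). The flow found depends on the clusters alone
(`Prog.run_agree`), so one fixed rule describes all repetitions, and the law of the program is that
of the algorithm. -/

namespace FairDiv

/-! ## Geometry of the threshold graph -/

section Geometry

variable {V : Type u}

theorem dist_le_length_mul [MetricSpace V] {U : Finset V} {r : ℝ} :
    ∀ {u v : V} (p : (nearGraph U r).Walk u v), dist u v ≤ p.length * r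
  | _, _, .nil => by simp
  | u, v, .cons (v := w) h p => by
    have h1 := dist_le_length_mul p
    have h2 : dist u w < r := h.2.2.2
    have h3 := dist_triangle u w v
    rw [SimpleGraph.Walk.length_cons]
    push_cast
    linarith

/-- Strictness comes from the first edge, which exists because `u ≠ v`. -/
theorem dist_lt_of_edist_le [MetricSpace V] {U : Finset V} {r : ℝ} {u v : V} {L : ℕ} (hr : 0 ≤ r)
    (huv : u ≠ v) (h : (nearGraph U r).edist u v ≤ L) : dist u v < L * r := by
  obtain ⟨p, hp⟩ := SimpleGraph.exists_walk_of_edist_ne_top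
    (ne_top_of_le_ne_top (ENat.natCast_ne_top L) h)
  rw [← hp, Nat.cast_le] at h
  have hL : (p.length : ℝ) ≤ L := by exact_mod_cast h
  have hlt : dist u v < p.length * r := by
    cases p with
    | nil => exact absurd rfl huv
    | cons hadj q =>
      rename_i w
      have h1 := dist_le_length_mul q
      have h2 : dist u w < r := hadj.2.2.2
      have h3 := dist_triangle u w v
      rw [SimpleGraph.Walk.length_cons]
      push_cast
      linarith
  exact hlt.trans_le (mul_le_mul_of_nonneg_right hL hr)

theorem mem_ball {U : Finset V} {G : SimpleGraph V} {u v : V} {R : ℕ} :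
    v ∈ ball U G u R ↔ v ∈ U ∧ G.edist u v ≤ R := by
  simp [ball]

theorem self_mem_ball {U : Finset V} {G : SimpleGraph V} {u : V} (hu : u ∈ U) (R : ℕ) :
    u ∈ ball U G u R := by
  simp [mem_ball, hu]

theorem ball_mono {U : Finset V} {G : SimpleGraph V} (u : V) {R R' : ℕ} (h : R ≤ R') :
    ball U G u R ⊆ ball U G u R' := fun v hv => by
  rw [mem_ball] at *
  exact ⟨hv.1, hv.2.trans (by exact_mod_cast h)⟩

theorem mem_ball_comm {U : Finset V} {G : SimpleGraph V} {u v : V} {R : ℕ} (hu : u ∈ U)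
    (hv : v ∈ U) : v ∈ ball U G u R ↔ u ∈ ball U G v R := by
  rw [mem_ball, mem_ball, SimpleGraph.edist_comm]; tauto

theorem alpha_nonneg (m : ℕ) : 0 ≤ alpha m := by unfold alpha; positivity

/-- log m ≤ m - 1 ≤ m²/4. This yields α ≤ 1/2, so that the range of radii is nonempty. -/
theorem log_le_sq_div_four {m : ℕ} (hm : 2 ≤ m) : Real.log m ≤ (m : ℝ) ^ 2 / 4 := by
  have hm' : (2 : ℝ) ≤ m := by exact_mod_cast hm
  have := Real.log_le_sub_one_of_pos (show (0 : ℝ) < m by linarith)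
  nlinarith [sq_nonneg ((m : ℝ) - 2)]

theorem sqrt_log_pos {m : ℕ} (hm : 2 ≤ m) : 0 < Real.sqrt (Real.log m) :=
  Real.sqrt_pos.2 (Real.log_pos (by exact_mod_cast hm))

theorem alpha_pos {m : ℕ} (hm : 2 ≤ m) : 0 < alpha m :=
  div_pos (sqrt_log_pos hm) (by positivity)

theorem two_mul_alpha_le_one {m : ℕ} (hm : 2 ≤ m) : 2 * alpha m ≤ 1 := by
  have hm' : (0 : ℝ) < m := by positivity
  have : Real.sqrt (Real.log m) ≤ m / 2 := by
    apply Real.sqrt_le_iff.2 ⟨by positivity, ?_⟩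
    have := log_le_sq_div_four hm
    linarith
  unfold alpha
  rw [mul_div_assoc', div_le_one hm']
  linarith

theorem one_le_floor_half {m : ℕ} (hm : 2 ≤ m) : 1 ≤ ⌊1 / (2 * alpha m)⌋₊ := by
  rw [Nat.one_le_floor_iff, le_div_iff₀ (by linarith [alpha_pos hm])]
  linarith [two_mul_alpha_le_one hm]

theorem Δ₁_le_floor_half {m : ℕ} (hm : 2 ≤ m) : Δ₁ m ≤ ⌊1 / (2 * alpha m)⌋₊ := by
  refine max_le (Nat.floor_mono ?_) (one_le_floor_half hm)
  have := alpha_pos hm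
  gcongr
  norm_num

theorem Δ₂_eq {m : ℕ} (hm : 2 ≤ m) : Δ₂ m = ⌊1 / (2 * alpha m)⌋₊ :=
  max_eq_left (Δ₁_le_floor_half hm)

theorem alpha_eq_zero {m : ℕ} (hm : m < 2) : alpha m = 0 := by
  interval_cases m <;> simp [alpha]

theorem two_mul_Δ₂_mul_alpha_le (m : ℕ) : 2 * (Δ₂ m : ℝ) * alpha m ≤ 1 := by
  by_cases hm : 2 ≤ m
  · have h := alpha_pos hm
    have h2 : ((⌊1 / (2 * alpha m)⌋₊ : ℕ) : ℝ) ≤ 1 / (2 * alpha m) := Nat.floor_le (by positivity)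
    rw [le_div_iff₀ (by positivity)] at h2
    rw [Δ₂_eq hm]
    linarith
  · simp [alpha_eq_zero (not_le.1 hm)]

theorem one_le_Δ₁ (m : ℕ) : 1 ≤ Δ₁ m := le_max_right _ _

theorem Δ₁_le_Δ₂ (m : ℕ) : Δ₁ m ≤ Δ₂ m := le_max_right _ _

/-- Through the center there is a path of at most 2R ≤ 2Δ₂ edges, each shorter than γα, and 2Δ₂α ≤
1. The choice of Δ₂ serves this bound. -/
theorem dist_lt_of_mem_ball [MetricSpace V] {U : Finset V} {m R : ℕ} {γ : ℝ} (hγ : 0 < γ)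
    (hR : R ≤ Δ₂ m) {c u v : V} (hu : u ∈ ball U (nearGraph U (γ * alpha m)) c R)
    (hv : v ∈ ball U (nearGraph U (γ * alpha m)) c R) : dist u v < γ := by
  by_cases huv : u = v
  · simpa [huv] using hγ
  · rw [mem_ball] at hu hv
    have hα := alpha_nonneg m
    have h : (nearGraph U (γ * alpha m)).edist u v ≤ ((2 * R : ℕ) : ℕ∞) := by
      refine (SimpleGraph.edist_triangle (v := c)).trans ?_
      rw [SimpleGraph.edist_comm, two_mul, Nat.cast_add]
      exact add_le_add hu.2 hv.2
    refine (dist_lt_of_edist_le (by positivity) huv h).trans_le ?_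
    have h1 := two_mul_Δ₂_mul_alpha_le m
    have h2 : (R : ℝ) ≤ Δ₂ m := by exact_mod_cast hR
    calc ((2 * R : ℕ) : ℝ) * (γ * alpha m) = γ * (2 * (R : ℝ) * alpha m) := by push_cast; ring
      _ ≤ γ * (2 * (Δ₂ m : ℝ) * alpha m) := by gcongr
      _ ≤ γ * 1 := by gcongr
      _ = γ := mul_one γ

theorem mem_cell {U : Finset V} {G : SimpleGraph V} {π : Fin U.card ≃ U} {R : ℕ}
    {j : Fin U.card} {v : V} :
    v ∈ cell U G π R j ↔ v ∈ ball U G (π j) R ∧ ∀ i < j, v ∉ ball U G (π i) R := by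
  simp [cell]

theorem mem_cluster {U : Finset V} {G : SimpleGraph V} {π : Fin U.card ≃ U} {R : ℕ}
    {j : Fin U.card} {v : V} :
    v ∈ cluster U G π R j ↔ (v ∈ ball U G (π j) R ∧ ∀ i < j, v ∉ ball U G (π i) R) ∧
      G.edist (π j : V) v < R := by
  simp [cluster, mem_cell]

theorem cluster_subset_ball {U : Finset V} {G : SimpleGraph V} {π : Fin U.card ≃ U} {R : ℕ}
    {j : Fin U.card} : cluster U G π R j ⊆ ball U G (π j) R := fun _ hv =>
  (mem_cluster.1 hv).1.1

theorem cluster_disjoint {U : Finset V} {G : SimpleGraph V} {π : Fin U.card ≃ U} {R : ℕ}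
    {i j : Fin U.card} {v : V} (hi : v ∈ cluster U G π R i) (hj : v ∈ cluster U G π R j) :
    i = j := by
  rw [mem_cluster] at hi hj
  rcases lt_trichotomy i j with h | h | h
  · exact absurd hi.1.1 (hj.1.2 i h)
  · exact h
  · exact absurd hj.1.1 (hi.1.2 j h)

/-- Let i < j. The point `u` is at graph distance less than R from π(i), so a neighbor `v` would be
within R of π(i) and could not belong to the later cell. This is why clusters leave out the points
at distance exactly R. -/
theorem le_dist_of_mem_cluster [MetricSpace V] {U : Finset V} {r : ℝ} {π : Fin U.card ≃ U} {R : ℕ}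
    {i j : Fin U.card} (hij : i ≠ j) {u v : V} (hu : u ∈ cluster U (nearGraph U r) π R i)
    (hv : v ∈ cluster U (nearGraph U r) π R j) : r ≤ dist u v := by
  wlog h : i < j generalizing i j u v
  · rw [dist_comm]
    exact this hij.symm hv hu (lt_of_le_of_ne (not_lt.1 h) hij.symm)
  by_contra hlt
  have huv : u ≠ v := fun e => hij (cluster_disjoint hu (e ▸ hv))
  rw [mem_cluster] at hu hv
  have huU := (mem_ball.1 hu.1.1).1
  have hvU := (mem_ball.1 hv.1.1).1
  refine hv.1.2 i h (mem_ball.2 ⟨hvU, ?_⟩)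
  have hadj : (nearGraph U r).Adj u v := ⟨huv, huU, hvU, not_le.1 hlt⟩
  refine (SimpleGraph.edist_triangle (v := u)).trans ?_
  rw [SimpleGraph.edist_eq_one_iff_adj.2 hadj]
  exact Order.add_one_le_of_lt hu.2

/-- A vertex at distance `d + 1` has a neighbor at distance `d`. -/
theorem exists_adj_edist_eq {G : SimpleGraph V} {c v : V} {d : ℕ}
    (h : G.edist c v = ((d + 1 : ℕ) : ℕ∞)) : ∃ w, G.Adj w v ∧ G.edist c w = (d : ℕ∞) := by
  rw [SimpleGraph.edist_comm] at h
  obtain ⟨p, hp⟩ := SimpleGraph.exists_walk_of_edist_ne_top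
    (by rw [h]; exact ENat.natCast_ne_top _)
  rw [h, Nat.cast_inj] at hp
  cases p with
  | nil => simp at hp
  | cons hadj q =>
    rename_i w
    rw [SimpleGraph.Walk.length_cons, Nat.add_right_cancel_iff] at hp
    refine ⟨w, hadj.symm, ?_⟩
    rw [SimpleGraph.edist_comm]
    refine le_antisymm (hp ▸ SimpleGraph.edist_le q) ?_
    have h1 := SimpleGraph.edist_triangle (G := G) (u := v) (v := w) (w := c)
    rw [SimpleGraph.edist_eq_one_iff_adj.2 hadj, h, Nat.cast_add, add_comm] at h1
    exact (ENat.add_le_add_iff_left (by simp)).1 h1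

theorem exists_edist_eq_of_le {G : SimpleGraph V} {c : V} {i : ℕ} :
    ∀ {d : ℕ} {v : V}, G.edist c v = (d : ℕ∞) → i ≤ d → ∃ w, G.edist c w = (i : ℕ∞) := by
  intro d
  induction d with
  | zero => intro v h hi; exact ⟨v, by simpa [Nat.le_zero.1 hi] using h⟩
  | succ d ih =>
    intro v h hi
    rcases hi.lt_or_eq with h1 | h1
    · obtain ⟨w, _, hw⟩ := exists_adj_edist_eq h
      exact ih hw (Nat.lt_succ_iff.1 h1)
    · exact ⟨v, by rw [h, h1]⟩

theorem nearGraph_mem_of_edist [MetricSpace V] {U : Finset V} {r : ℝ} {c v : V} (hc : c ∈ U)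
    (h : (nearGraph U r).edist c v ≠ ⊤) : v ∈ U := by
  obtain ⟨p, -⟩ := SimpleGraph.exists_walk_of_edist_ne_top h
  cases hp : p.reverse with
  | nil => exact hc
  | cons hadj q => exact hadj.2.1

/-- A ball that keeps growing at radius `t` or later has more than `t` points. -/
theorem lt_card_ball [MetricSpace V] {U : Finset V} {r : ℝ} {c : V} (hc : c ∈ U) {t R : ℕ}
    (h : ball U (nearGraph U r) c R ≠ ball U (nearGraph U r) c t) (htR : t ≤ R) :
    t < (ball U (nearGraph U r) c t).card := by
  obtain ⟨v, hvR, hvt⟩ : ∃ v ∈ ball U (nearGraph U r) c R, v ∉ ball U (nearGraph U r) c t := by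
    by_contra! hcon
    exact h (Finset.Subset.antisymm hcon (ball_mono c htR))
  rw [mem_ball] at hvR hvt
  obtain ⟨d, hd⟩ := ENat.ne_top_iff_exists.1 (ne_top_of_le_ne_top (ENat.natCast_ne_top R) hvR.2)
  have htd : t < d := by
    by_contra hcon
    refine hvt ⟨hvR.1, ?_⟩
    rw [← hd]
    exact_mod_cast not_lt.1 hcon
  -- A shortest path to a point outside the ball of radius t passes every distance 0, …, t, which
  -- gives t + 1 different points inside.
  have hex : ∀ i : Fin (t + 1), ∃ w, (nearGraph U r).edist c w = ((i : ℕ) : ℕ∞) := fun i =>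
    exists_edist_eq_of_le hd.symm (by omega)
  choose f hf using hex
  have hinj : Function.Injective f := fun i j hij => by
    have h1 := hf i
    rw [hij, hf j, Nat.cast_inj] at h1
    exact Fin.ext h1.symm
  have := Finset.card_le_card_of_injOn (s := Finset.univ) (t := ball U (nearGraph U r) c t) f
    (fun i _ => mem_ball.2 ⟨nearGraph_mem_of_edist hc (by rw [hf]; exact ENat.natCast_ne_top _), by
      rw [hf]; exact_mod_cast Nat.lt_succ_iff.1 i.2⟩) hinj.injOn
  simp at this
  omega

end Geometry

/-! ## Pruning -/

section Pruning

variable {V : Type u} [MetricSpace V]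

open Classical in
/-- The selected points of a color class are separated, and each point of the class is close to a
selected one. The relation `P` may record in which order points are picked. -/
theorem pruneLoop_spec {pick : Finset V → V} (hpick : ∀ A : Finset V, A.Nonempty → pick A ∈ A)
    {P : V → V → Prop} (hP : ∀ A : Finset V, ∀ v ∈ A, P (pick A) v)
    {γ : ℝ} (hγ : 0 < γ) {b : ℕ} {A : Finset V} (hb : A.card ≤ b) :
    ∀ (passes : ℕ) (X W : Finset V), W ⊆ A → X ⊆ A →
      (∀ v ∈ X, ∀ w ∈ W, γ ≤ dist v w) → (∀ v ∈ A, v ∉ X → ∃ w ∈ W, P w v ∧ dist v w < γ) →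
      X.card ≤ passes → (∀ u ∈ W, ∀ v ∈ W, u ≠ v → γ ≤ dist u v) →
      pruneLoop pick γ b passes X W ⊆ A ∧
      (∀ u ∈ pruneLoop pick γ b passes X W, ∀ v ∈ pruneLoop pick γ b passes X W,
        u ≠ v → γ ≤ dist u v) ∧
      ∀ v ∈ A, ∃ w ∈ pruneLoop pick γ b passes X W, P w v ∧ dist v w < γ := by
  intro passes
  induction passes with
  | zero =>
    intro X W hW _ _ hcov hc hsep
    have hX : X = ∅ := by simpa using hc
    exact ⟨hW, hsep, fun v hv => hcov v hv (by simp [hX])⟩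
  | succ passes ih =>
    intro X W hW hXA hX hcov hc hsep
    rw [pruneLoop]
    split_ifs with h
    · have hp := hpick X h.1
      have hPp := hP X
      set p := pick X
      apply ih
      · exact Finset.insert_subset (hXA hp) hW
      · exact (Finset.filter_subset _ _).trans hXA
      · intro v hv w hw
        rw [Finset.mem_filter] at hv
        rcases Finset.mem_insert.1 hw with rfl | hw
        · exact not_lt.1 hv.2
        · exact hX v hv.1 w hw
      · intro v hv hvX
        by_cases hvX' : v ∈ X
        · refine ⟨p, Finset.mem_insert_self _ _, hPp v hvX', ?_⟩
          by_contra hcon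
          exact hvX (Finset.mem_filter.2 ⟨hvX', hcon⟩)
        · obtain ⟨w, hw, hw'⟩ := hcov v hv hvX'
          exact ⟨w, Finset.mem_insert_of_mem hw, hw'⟩
      -- The picked point marks itself because γ > 0, so the number of unmarked points drops and
      -- bounds the passes still needed.
      · refine Nat.lt_succ_iff.1 (lt_of_lt_of_le (Finset.card_lt_card ?_) hc)
        refine ⟨Finset.filter_subset _ _, fun hsub => ?_⟩
        have := (Finset.mem_filter.1 (hsub hp)).2
        simp [hγ] at this
      · intro u hu v hv huv
        rw [Finset.mem_insert] at hu hv
        rcases hu with rfl | hu <;> rcases hv with rfl | hv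
        · exact absurd rfl huv
        · exact hX _ hp v hv
        · rw [dist_comm]; exact hX _ hp u hu
        · exact hsep u hu v hv huv
    -- The budget cannot be what stopped the loop, since W ⊆ A has at most b points. So no point is
    -- left unmarked.
    · refine ⟨hW, hsep, fun v hv => hcov v hv fun hvX => h ⟨⟨v, hvX⟩, ?_⟩⟩
      exact (Finset.card_le_card hW).trans hb

variable [Fintype V] {m : ℕ} (I : Problem V m)

open Classical in
-- The guarantee needs only the trivial relation `P`. To identify the set that the program selects,
-- `P` is taken to compare the numbers of the points.
theorem prune_spec {pick : Finset V → V} (hpick : ∀ A : Finset V, A.Nonempty → pick A ∈ A)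
    {P : V → V → Prop} (hP : ∀ A : Finset V, ∀ v ∈ A, P (pick A) v) {γ : ℝ} (hγ : 0 < γ) :
    (∀ u ∈ prune I pick γ (Fintype.card V), ∀ v ∈ prune I pick γ (Fintype.card V),
      I.color u = I.color v → u ≠ v → γ ≤ dist u v) ∧
    ∀ v, ∃ w ∈ prune I pick γ (Fintype.card V), I.color w = I.color v ∧ P w v ∧ dist v w < γ := by
  have key := fun i : Fin m => pruneLoop_spec hpick hP hγ
    (A := Finset.univ.filter (fun v => I.color v = i)) (Finset.card_le_univ _) (Fintype.card V)
    (Finset.univ.filter (fun v => I.color v = i)) ∅ (Finset.empty_subset _) subset_rfl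
    (by simp) (fun v hv hv' => absurd hv hv') (Finset.card_le_univ _) (by simp)
  have hmem : ∀ v, v ∈ prune I pick γ (Fintype.card V) ↔ ∃ i, v ∈ pruneLoop pick γ
      (Fintype.card V) (Fintype.card V) (Finset.univ.filter (fun v => I.color v = i)) ∅ := by
    intro v; simp [prune]
  have hcol : ∀ v i, v ∈ pruneLoop pick γ
      (Fintype.card V) (Fintype.card V) (Finset.univ.filter (fun v => I.color v = i)) ∅ →
      I.color v = i := fun v i hv => (Finset.mem_filter.1 ((key i).1 hv)).2
  constructor
  · intro u hu v hv huv hne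
    obtain ⟨i, hi⟩ := (hmem u).1 hu
    obtain ⟨j, hj⟩ := (hmem v).1 hv
    obtain rfl : i = j := by rw [← hcol u i hi, ← hcol v j hj, huv]
    exact (key i).2.1 u hi v hj hne
  · intro v
    obtain ⟨w, hw, hPw⟩ := (key (I.color v)).2.2 v (by simp)
    exact ⟨w, (hmem w).2 ⟨_, hw⟩, hcol w _ hw, hPw⟩

end Pruning

/-! ### Balls of radius at most Δ₂ in a set whose color classes are separated -/

section Separated

variable {V : Type u} [MetricSpace V] {m : ℕ} {I : Problem V m} {U : Finset V} {γ : ℝ}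

/-- In a ball, the color determines the point. -/
theorem eq_of_mem_ball_of_color (hγ : 0 < γ)
    (hU : ∀ u ∈ U, ∀ v ∈ U, I.color u = I.color v → u ≠ v → γ ≤ dist u v) {R : ℕ}
    (hR : R ≤ Δ₂ m) {c u v : V} (hu : u ∈ ball U (nearGraph U (γ * alpha m)) c R)
    (hv : v ∈ ball U (nearGraph U (γ * alpha m)) c R) (h : I.color u = I.color v) : u = v := by
  by_contra hne
  exact (hU u (mem_ball.1 hu).1 v (mem_ball.1 hv).1 h hne).not_gt
    (dist_lt_of_mem_ball hγ hR hu hv)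

/-- The coloring is injective on the ball. The bound serves twice: for the ratios of ball sizes in
the success probability, and for the length of the queue in the search. -/
theorem card_ball_le (hγ : 0 < γ)
    (hU : ∀ u ∈ U, ∀ v ∈ U, I.color u = I.color v → u ≠ v → γ ≤ dist u v) {R : ℕ}
    (hR : R ≤ Δ₂ m) (c : V) : (ball U (nearGraph U (γ * alpha m)) c R).card ≤ m := by
  simpa using Finset.card_le_card_of_injOn (t := (Finset.univ : Finset (Fin m))) I.color
    (fun _ _ => Finset.mem_coe.2 (Finset.mem_univ _))
    (fun u hu v hv h => eq_of_mem_ball_of_color hγ hU hR hu hv h)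

end Separated


/-! ## Flows and the sets read off from them -/

section Flow

variable {V : Type u} {m N : ℕ} {I : Problem V m} {D : Fin N → Finset V}

open Classical in
theorem IsFlow.assign_le_one {f : EdgeFlow N m} (hf : IsFlow I D f) (i : Fin N) (j : Fin m) :
    f.assign i j ≤ 1 := by
  refine le_trans ?_ (hf.fromSource_le i)
  rw [hf.conserve_cluster i]
  exact Finset.single_le_sum (f := fun j => f.assign i j) (fun _ _ => Nat.zero_le _)
    (Finset.mem_univ j)

theorem IsFlow.value_eq {f : EdgeFlow N m} (hf : IsFlow I D f) :
    f.value = ∑ j, ∑ i, f.assign i j := by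
  rw [EdgeFlow.value, Finset.sum_comm]
  exact Finset.sum_congr rfl fun i _ => hf.conserve_cluster i

theorem IsFlow.value_eq_sink {f : EdgeFlow N m} (hf : IsFlow I D f) :
    f.value = ∑ j, f.toSink j + f.slackToSink := by
  rw [hf.value_eq, ← hf.conserve_slack, ← Finset.sum_add_distrib]
  exact Finset.sum_congr rfl fun j _ => hf.conserve_color j

theorem IsFlow.value_le {f : EdgeFlow N m} (hf : IsFlow I D f) (hk : ∑ i, I.lower i ≤ I.k) :
    f.value ≤ I.k := by
  have h1 : ∑ j, f.toSink j ≤ ∑ j, I.lower j := Finset.sum_le_sum fun j _ => hf.toSink_le j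
  have h2 := hf.slackToSink_le
  rw [hf.value_eq_sink]
  omega

/-- A flow of value `k` meets all constraints on the colors. -/
theorem IsFlow.bounds_of_value_eq {f : EdgeFlow N m} (hf : IsFlow I D f)
    (hk : ∑ i, I.lower i ≤ I.k) (hlu : ∀ i, I.lower i ≤ I.upper i) (h : f.value = I.k)
    (j : Fin m) : I.lower j ≤ ∑ i, f.assign i j ∧ ∑ i, f.assign i j ≤ I.upper j := by
  have h1 : ∑ j, f.toSink j ≤ ∑ j, I.lower j := Finset.sum_le_sum fun j _ => hf.toSink_le j
  have h2 := hf.slackToSink_le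
  rw [hf.value_eq_sink] at h
  -- The edges into `t` have total capacity k, so a flow of value k saturates each of them, in
  -- particular each edge from a color to `t`.
  have h3 : ∑ j, f.toSink j = ∑ j, I.lower j := by omega
  have h4 := (Finset.sum_eq_sum_iff_of_le fun j _ => hf.toSink_le j).1 h3 j (Finset.mem_univ j)
  have h5 := hf.toSlack_le j
  have h6 := hlu j
  rw [hf.conserve_color j]
  omega

theorem AssignRule.isFlow (A : AssignRule I) (D : Fin N → Finset V) : IsFlow I D (A.solve D) :=
  (A.isMaxFlow_solve D).1

open Classical in
theorem AssignRule.rep_mem_of_assign (A : AssignRule I) {i : Fin N} {j : Fin m}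
    (h : 0 < (A.solve D).assign i j) :
    A.rep ((D i).filter (fun v => I.color v = j)) ∈ D i ∧
      I.color (A.rep ((D i).filter (fun v => I.color v = j))) = j := by
  have := A.rep_mem ((D i).filter (fun v => I.color v = j)) (Finset.card_pos.1 (by
    have := (A.isFlow D).assign_le i j
    convert h.trans_le this))
  simpa using this

open Classical in
theorem mem_extract {A : AssignRule I} {v : V} : v ∈ extract I A D ↔
    ∃ i j, 0 < (A.solve D).assign i j ∧ A.rep ((D i).filter (fun v => I.color v = j)) = v := by
  simp [extract]

open Classical in
-- Representatives taken from different clusters differ because the clusters are disjoint, so points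
-- of a color correspond to units of flow into it.
theorem card_extract_color (A : AssignRule I) (hD : ∀ i j v, v ∈ D i → v ∈ D j → i = j)
    (j : Fin m) :
    ((extract I A D).filter (fun v => I.color v = j)).card = ∑ i, (A.solve D).assign i j := by
  have h1 : (extract I A D).filter (fun v => I.color v = j) =
      (Finset.univ.filter (fun i => 0 < (A.solve D).assign i j)).image
        (fun i => A.rep ((D i).filter (fun v => I.color v = j))) := by
    ext v
    simp only [Finset.mem_filter, mem_extract, Finset.mem_image, Finset.mem_univ, true_and]
    constructor
    · rintro ⟨⟨i, j', h, rfl⟩, hc⟩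
      obtain rfl := (A.rep_mem_of_assign h).2.symm.trans hc
      exact ⟨i, h, rfl⟩
    · rintro ⟨i, h, rfl⟩
      exact ⟨⟨i, j, h, rfl⟩, (A.rep_mem_of_assign h).2⟩
  rw [h1, Finset.card_image_of_injOn, Finset.card_filter]
  · refine Finset.sum_congr rfl fun i _ => ?_
    have := (A.isFlow D).assign_le_one i j
    split_ifs <;> omega
  · intro i hi i' hi' h
    simp only [Finset.coe_filter, Finset.mem_univ, true_and, Set.mem_ofPred_eq] at hi hi'
    refine hD i i' _ (A.rep_mem_of_assign hi).1 ?_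
    simp only at h
    rw [h]
    exact (A.rep_mem_of_assign hi').1

open Classical in
theorem card_extract (A : AssignRule I) (hD : ∀ i j v, v ∈ D i → v ∈ D j → i = j) :
    (extract I A D).card = (A.solve D).value := by
  rw [(A.isFlow D).value_eq, Finset.card_eq_sum_card_fiberwise (f := I.color) (t := Finset.univ)
    (fun _ _ => Finset.mem_coe.2 (Finset.mem_univ _))]
  exact Finset.sum_congr rfl fun j _ => by rw [← card_extract_color A hD j]

/-- At value k the color constraints hold automatically, so feasibility can be read off from the
value alone. The program tests it in this way. -/
theorem feasible_extract_iff (A : AssignRule I) (hD : ∀ i j v, v ∈ D i → v ∈ D j → i = j)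
    (hk : ∑ i, I.lower i ≤ I.k) (hlu : ∀ i, I.lower i ≤ I.upper i) :
    I.Feasible (extract I A D) ↔ (A.solve D).value = I.k := by
  classical
  rw [Problem.Feasible, card_extract A hD]
  refine ⟨fun h => h.1, fun h => ⟨h, fun i => ?_⟩⟩
  have := (A.isFlow D).bounds_of_value_eq hk hlu h i
  rw [← card_extract_color A hD i] at this
  convert this

theorem Problem.Feasible.lower_le_upper {S : Finset V} (h : I.Feasible S) (i : Fin m) :
    I.lower i ≤ I.upper i := (h.2 i).1.trans (h.2 i).2

theorem Problem.Feasible.sum_lower_le {S : Finset V} (h : I.Feasible S) :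
    ∑ i, I.lower i ≤ I.k := by
  classical
  rw [← h.1, Finset.card_eq_sum_card_fiberwise (f := I.color) (t := Finset.univ)
    (fun _ _ => Finset.mem_coe.2 (Finset.mem_univ _))]
  exact Finset.sum_le_sum fun i _ => by convert (h.2 i).1

open Classical in
/-- A feasible set, each point of which lies in a cluster of its own, gives a flow of value `k`. -/
theorem exists_flow_of_feasible {O : Finset V} (hO : I.Feasible O)
    (hcov : ∀ o ∈ O, ∃ i, o ∈ D i) (hD : ∀ i j v, v ∈ D i → v ∈ D j → i = j)
    (hone : ∀ i, ∀ u ∈ O, ∀ v ∈ O, u ∈ D i → v ∈ D i → u = v) :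
    ∃ f : EdgeFlow N m, IsFlow I D f ∧ f.value = I.k := by
  let g : Fin N → Fin m → ℕ := fun i j => (O.filter (fun v => v ∈ D i ∧ I.color v = j)).card
  have hcard : ∀ i, (O.filter (fun v => v ∈ D i)).card ≤ 1 := fun i =>
    Finset.card_le_one.2 fun u hu v hv => by
      rw [Finset.mem_filter] at hu hv
      exact hone i u hu.1 v hv.1 hu.2 hv.2
  have hrow : ∀ i, (O.filter (fun v => v ∈ D i)).card = ∑ j, g i j := fun i => by
    rw [Finset.card_eq_sum_card_fiberwise (f := I.color) (t := Finset.univ)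
      (fun _ _ => Finset.mem_coe.2 (Finset.mem_univ _))]
    simp only [Finset.filter_filter, g]
  have hcol : ∀ j, ∑ i, g i j = (O.filter (fun v => I.color v = j)).card := fun j => by
    rw [← Finset.card_biUnion]
    · congr 1
      ext v
      simp only [Finset.mem_biUnion, Finset.mem_filter, Finset.mem_univ, true_and]
      constructor
      · rintro ⟨i, h⟩; exact ⟨h.1, h.2.2⟩
      · rintro ⟨h1, h2⟩
        obtain ⟨i, hi⟩ := hcov v h1
        exact ⟨i, h1, hi, h2⟩
    · intro i _ i' _ hii
      refine Finset.disjoint_left.2 fun v hv hv' => hii ?_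
      rw [Finset.mem_filter] at hv hv'
      exact hD i i' v hv.2.1 hv'.2.1
  have hbound : ∀ j, I.lower j ≤ ∑ i, g i j ∧ ∑ i, g i j ≤ I.upper j := fun j => by
    rw [hcol]; convert hO.2 j
  have htot : ∑ j, ∑ i, g i j = I.k := by
    rw [← hO.1, Finset.card_eq_sum_card_fiberwise (f := I.color) (t := Finset.univ)
      (fun _ _ => Finset.mem_coe.2 (Finset.mem_univ _))]
    exact Finset.sum_congr rfl fun j _ => hcol j
  have hslack : ∑ j, (∑ i, g i j - I.lower j) = I.k - ∑ j, I.lower j := by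
    rw [← htot, ← Finset.sum_tsub_distrib _ fun j _ => (hbound j).1]
  -- Each color sends ℓ_j units straight to `t` and its surplus through `z`. As O has k points, the
  -- surpluses add up to exactly the capacity of `z → t`.
  refine ⟨⟨fun i => ∑ j, g i j, g, I.lower, fun j => ∑ i, g i j - I.lower j,
    ∑ j, (∑ i, g i j - I.lower j)⟩, ⟨?_, ?_, ?_, ?_, ?_, ?_, ?_, ?_⟩, ?_⟩
  · intro i; exact (hrow i).symm.trans_le (hcard i)
  · intro i j
    refine le_trans (b := ((D i).filter (fun v => I.color v = j)).card)
      (Finset.card_le_card fun v hv => ?_) (by convert le_rfl)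
    rw [Finset.mem_filter] at *
    exact hv.2
  · intro j; exact le_rfl
  · intro j
    have := hbound j
    simp only
    omega
  · exact hslack.le
  · intro i; rfl
  · intro j
    have := hbound j
    simp only
    omega
  · rfl
  · rw [EdgeFlow.value, ← htot, Finset.sum_comm]

/-- The unit capacity of `s → D_i` prevents two colors from being served by one cluster, so distinct
extracted points come from distinct clusters. -/
theorem le_diversity_extract [MetricSpace V] (A : AssignRule I) {r : ℝ}
    (hD : ∀ i j, i ≠ j → ∀ u ∈ D i, ∀ v ∈ D j, r ≤ dist u v) :
    ENNReal.ofReal r ≤ diversity (extract I A D) := by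
  classical
  rw [diversity, Set.le_einfsep_iff]
  intro u hu v hv huv
  rw [Finset.mem_coe, mem_extract] at hu hv
  obtain ⟨i, j, hij, rfl⟩ := hu
  obtain ⟨i', j', hij', rfl⟩ := hv
  rw [edist_dist]
  refine ENNReal.ofReal_le_ofReal (hD i i' ?_ _ (A.rep_mem_of_assign hij).1 _
    (A.rep_mem_of_assign hij').1)
  rintro rfl
  refine huv ?_
  suffices j = j' by rw [this]
  by_contra hjj
  have h1 := (A.isFlow D).conserve_cluster i
  have h2 := (A.isFlow D).fromSource_le i
  have h3 : (A.solve D).assign i j + (A.solve D).assign i j' ≤ ∑ l, (A.solve D).assign i l := by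
    rw [← Finset.sum_pair hjj]
    exact Finset.sum_le_sum_of_subset (Finset.subset_univ _)
  omega

end Flow


/-! ## Random enumerations -/

section Enumeration

variable {X : Type u} {N : ℕ}

/-- The first element of `B` in the enumeration `π` exists and belongs to `A`. -/
def FirstIn (π : Fin N ≃ X) (A B : Finset X) : Prop :=
  ∃ j, π j ∈ A ∧ ∀ i < j, π i ∉ B

theorem firstIn_unique {π : Fin N ≃ X} {B : Finset X} {i j : Fin N} (hi : π i ∈ B) (hj : π j ∈ B)
    (hi' : ∀ l < i, π l ∉ B) (hj' : ∀ l < j, π l ∉ B) : i = j := by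
  rcases lt_trichotomy i j with h | h | h
  · exact absurd hi (hj' i h)
  · exact h
  · exact absurd hj (hi' j h)

theorem exists_firstIn (π : Fin N ≃ X) {B : Finset X} (hB : B.Nonempty) :
    ∃ b ∈ B, FirstIn π {b} B := by
  classical
  obtain ⟨b, hb⟩ := hB
  have hne : (Finset.univ.filter fun j => π j ∈ B).Nonempty := ⟨π.symm b, by simpa using hb⟩
  have hmin := Finset.min'_mem _ hne
  refine ⟨π ((Finset.univ.filter fun j => π j ∈ B).min' hne), by simpa using hmin, _,
    Finset.mem_singleton_self _, fun i hi hiB => ?_⟩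
  exact (Finset.min'_le _ i (by simpa using hiB)).not_gt hi

variable [Fintype X] [DecidableEq X]

open Classical in
/-- The numbers of elements in the balls of disjoint sets `B o` determine how many enumerations
have their first element of `B o` in `A o`, for all `o ∈ F`. -/
theorem card_firstIn_mul {ι : Type*} (F : Finset ι) (A B : ι → Finset X)
    (hAB : ∀ o ∈ F, A o ⊆ B o) (hne : ∀ o ∈ F, (B o).Nonempty)
    (hdisj : ∀ o ∈ F, ∀ o' ∈ F, o ≠ o' → Disjoint (B o) (B o')) :
    (Finset.univ.filter fun π : Fin N ≃ X => ∀ o ∈ F, FirstIn π (A o) (B o)).card *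
      ∏ o ∈ F, (B o).card = Fintype.card (Fin N ≃ X) * ∏ o ∈ F, (A o).card := by
  induction F using Finset.induction_on with
  | empty => simp
  | insert o F ho ih =>
    have ih' := ih (fun p hp => hAB p (Finset.mem_insert_of_mem hp))
      (fun p hp => hne p (Finset.mem_insert_of_mem hp))
      (fun p hp q hq => hdisj p (Finset.mem_insert_of_mem hp) q (Finset.mem_insert_of_mem hq))
    have hoF := Finset.mem_insert_self o F
    -- The enumerations that satisfy the conditions for F are split according to their first element
    -- `b` of `B o`. All parts turn out to have the same size.
    let E : X → Finset (Fin N ≃ X) := fun b => Finset.univ.filter fun π : Fin N ≃ X =>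
      (∀ p ∈ F, FirstIn π (A p) (B p)) ∧ FirstIn π {b} (B o)
    -- Exchanging the positions of `b` and `b'` maps `E b` into `E b'`. The conditions for the other
    -- indices are unaffected, because their sets are disjoint from `B o`.
    have hmono : ∀ b ∈ B o, ∀ b' ∈ B o, (E b).card ≤ (E b').card := by
      intro b hb b' hb'
      refine Finset.card_le_card_of_injOn (fun π => π.trans (Equiv.swap b b')) ?_ ?_
      · intro π hπ
        simp only [E, Finset.coe_filter, Finset.mem_univ, true_and, Set.mem_ofPred_eq] at hπ ⊢
        have hfix : ∀ p ∈ F, ∀ S ⊆ B p, ∀ x, Equiv.swap b b' x ∈ S ↔ x ∈ S := by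
          intro p hp S hS x
          have hd : Disjoint (B o) (B p) := hdisj o hoF p (Finset.mem_insert_of_mem hp)
            (fun e => ho (e ▸ hp))
          have hbS : b ∉ S := fun h => Finset.disjoint_left.1 hd hb (hS h)
          have hbS' : b' ∉ S := fun h => Finset.disjoint_left.1 hd hb' (hS h)
          by_cases h1 : x = b
          · subst h1; simp [hbS, hbS']
          · by_cases h2 : x = b'
            · subst h2; simp [hbS, hbS']
            · rw [Equiv.swap_apply_of_ne_of_ne h1 h2]
        have hBo : ∀ x, Equiv.swap b b' x ∈ B o ↔ x ∈ B o := by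
          intro x
          by_cases h1 : x = b
          · subst h1; simp [hb, hb']
          · by_cases h2 : x = b'
            · subst h2; simp [hb, hb']
            · rw [Equiv.swap_apply_of_ne_of_ne h1 h2]
        constructor
        · intro p hp
          obtain ⟨j, hj, hj'⟩ := hπ.1 p hp
          refine ⟨j, ?_, fun i hi => ?_⟩
          · rw [Equiv.trans_apply, hfix p hp _ (hAB p (Finset.mem_insert_of_mem hp))]
            exact hj
          · rw [Equiv.trans_apply, hfix p hp _ subset_rfl]
            exact hj' i hi
        · obtain ⟨j, hj, hj'⟩ := hπ.2
          refine ⟨j, ?_, fun i hi => ?_⟩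
          · rw [Equiv.trans_apply, Finset.mem_singleton.1 hj]
            simp
          · rw [Equiv.trans_apply, hBo]
            exact hj' i hi
      · intro π _ π' _ h
        ext i
        have := Equiv.congr_fun h i
        simpa using this
    obtain ⟨b₀, hb₀⟩ := hne o hoF
    have hcard : ∀ b ∈ B o, (E b).card = (E b₀).card := fun b hb =>
      le_antisymm (hmono b hb b₀ hb₀) (hmono b₀ hb₀ b hb)
    have hE : ∀ S ⊆ B o, (S.biUnion E).card = S.card * (E b₀).card := by
      intro S hS
      rw [Finset.card_biUnion, Finset.sum_congr rfl fun b hb => hcard b (hS hb)]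
      · simp
      · intro b hb b' hb' hbb
        refine Finset.disjoint_left.2 fun π hπ hπ' => hbb ?_
        simp only [E, Finset.mem_filter, Finset.mem_univ, true_and] at hπ hπ'
        obtain ⟨j, hj, hj'⟩ := hπ.2
        obtain ⟨i, hi, hi'⟩ := hπ'.2
        rw [Finset.mem_singleton] at hi hj
        have := firstIn_unique (π := π) (B := B o) (i := i) (j := j) (hi ▸ hS hb') (hj ▸ hS hb)
          hi' hj'
        rw [← hi, ← hj, this]
    have hall : Finset.univ.filter (fun π : Fin N ≃ X => ∀ p ∈ F, FirstIn π (A p) (B p)) =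
        (B o).biUnion E := by
      ext π
      simp only [E, Finset.mem_filter, Finset.mem_univ, true_and, Finset.mem_biUnion]
      constructor
      · intro h
        obtain ⟨b, hb, hb'⟩ := exists_firstIn π (hne o hoF)
        exact ⟨b, hb, h, hb'⟩
      · rintro ⟨b, _, h, _⟩; exact h
    have hins : Finset.univ.filter
        (fun π : Fin N ≃ X => ∀ p ∈ insert o F, FirstIn π (A p) (B p)) = (A o).biUnion E := by
      ext π
      simp only [E, Finset.mem_filter, Finset.mem_univ, true_and, Finset.mem_biUnion,
        Finset.forall_mem_insert]
      constructor
      · rintro ⟨⟨j, hj, hj'⟩, h⟩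
        exact ⟨π j, hj, h, j, Finset.mem_singleton_self _, hj'⟩
      · rintro ⟨b, hb, h, j, hj, hj'⟩
        exact ⟨⟨j, (Finset.mem_singleton.1 hj).symm ▸ hb, hj'⟩, h⟩
    rw [hall, hE _ subset_rfl] at ih'
    rw [hins, hE _ (hAB o hoF), Finset.prod_insert ho, Finset.prod_insert ho]
    calc (A o).card * (E b₀).card * ((B o).card * ∏ p ∈ F, (B p).card)
        = (A o).card * ((B o).card * (E b₀).card * ∏ p ∈ F, (B p).card) := by ring
      _ = _ := by rw [ih']; ring

end Enumeration

/-! ## Means of products of ratios -/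

theorem prod_div_telescope (g : ℕ → ℝ) (hg : ∀ i, 0 < g i) (L : ℕ) :
    ∏ i ∈ Finset.range L, g i / g (i + 1) = g 0 / g L := by
  induction L with
  | zero => simp [(hg 0).ne']
  | succ L ih =>
    rw [Finset.prod_range_succ, ih]
    have := (hg L).ne'
    have := (hg (L + 1)).ne'
    field_simp

/-- The mean over `i < L` of `∏ o, g o i / g o (i + 1)` is at least the geometric mean. -/
theorem rpow_le_mean_prod {ι : Type*} (F : Finset ι) (g : ι → ℕ → ℝ) (hg : ∀ o i, 0 < g o i)
    {L : ℕ} (hL : 0 < L) {ρ : ℝ} (hρ : 0 < ρ) (hr : ∀ o ∈ F, ρ ≤ g o 0 / g o L) :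
    (ρ ^ F.card) ^ (1 / (L : ℝ)) ≤
      ∑ i ∈ Finset.range L, 1 / (L : ℝ) * ∏ o ∈ F, g o i / g o (i + 1) := by
  have hL' : (0 : ℝ) < L := by exact_mod_cast hL
  have hpos : ∀ i, 0 ≤ ∏ o ∈ F, g o i / g o (i + 1) := fun i =>
    Finset.prod_nonneg fun o _ => (div_pos (hg _ _) (hg _ _)).le
  -- In the geometric mean the two products may be exchanged, and for each `o` the product over the
  -- radii telescopes to `g o 0 / g o L`.
  refine le_trans ?_ (Real.geom_mean_le_arith_mean_weighted (Finset.range L) (fun _ => 1 / (L : ℝ))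
    (fun i => ∏ o ∈ F, g o i / g o (i + 1)) (fun _ _ => by positivity)
    (by simp [hL'.ne']) (fun i _ => hpos i))
  rw [Real.finsetProd_rpow _ _ fun i _ => hpos i, Finset.prod_comm]
  refine Real.rpow_le_rpow (by positivity) ?_ (by positivity)
  rw [← Finset.prod_const]
  refine Finset.prod_le_prod (fun _ _ => hρ.le) fun o ho => ?_
  rw [prod_div_telescope (g o) (hg o)]
  exact hr o ho

/-! ## The success probability of one repetition -/

/-- With x = 1/(4α) one has Δ₁ = max(⌊x⌋, 1) and Δ₂ = ⌊2x⌋. If x ≥ 1, then ⌊2x⌋ - ⌊x⌋ + 1 > x and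
2⌊x⌋ ≥ ⌊x⌋ + 1 > x. If x < 1, both left sides are below 1, while the gap and Δ₁ are at least 1. -/
theorem Δ_gap_ge {m : ℕ} (hm : 2 ≤ m) :
    (m : ℝ) / (4 * Real.sqrt (Real.log m)) ≤ ((Δ₂ m - Δ₁ m + 1 : ℕ) : ℝ) ∧
    (m : ℝ) / (4 * Real.sqrt (Real.log m)) / 2 ≤ Δ₁ m := by
  have hs := sqrt_log_pos hm
  have hm' : (0 : ℝ) < m := by positivity
  have hα := alpha_pos hm
  set x : ℝ := (m : ℝ) / (4 * Real.sqrt (Real.log m)) with hx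
  have hx0 : 0 < x := by positivity
  have h1 : 1 / (4 * alpha m) = x := by rw [hx, alpha]; field_simp
  have h2 : 1 / (2 * alpha m) = 2 * x := by rw [hx, alpha]; field_simp; norm_num
  have hD2 : Δ₂ m = ⌊2 * x⌋₊ := by rw [Δ₂_eq hm, h2]
  have hD1 : Δ₁ m = max ⌊x⌋₊ 1 := by rw [Δ₁, h1]
  have hle := Δ₁_le_Δ₂ m
  have hgap : ((Δ₂ m - Δ₁ m + 1 : ℕ) : ℝ) = Δ₂ m - Δ₁ m + 1 := by
    push_cast [hle]; ring
  have hf1 := Nat.floor_le hx0.le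
  have hf2 := Nat.lt_floor_add_one (2 * x)
  have hf3 := Nat.lt_floor_add_one x
  rcases le_or_gt 1 x with h | h
  · have hfl : 1 ≤ ⌊x⌋₊ := by rwa [Nat.one_le_floor_iff]
    have hfl' : (1 : ℝ) ≤ ⌊x⌋₊ := by exact_mod_cast hfl
    rw [max_eq_left hfl] at hD1
    rw [hgap, hD1, hD2]
    constructor <;> linarith
  · have hfl : ⌊x⌋₊ = 0 := Nat.floor_eq_zero.2 h
    rw [hfl] at hD1
    have h3 : (1 : ℝ) ≤ Δ₁ m := by exact_mod_cast one_le_Δ₁ m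
    have h4 : (Δ₁ m : ℝ) ≤ Δ₂ m := by exact_mod_cast hle
    rw [hgap]
    constructor <;> linarith

theorem Δ₁_le_self {m : ℕ} (hm : 1 ≤ m) : Δ₁ m ≤ m := by
  refine max_le ?_ hm
  by_cases h2 : 2 ≤ m
  · refine Nat.floor_le_of_le ?_
    have hs := sqrt_log_pos h2
    have : (1 / 4 : ℝ) ≤ Real.sqrt (Real.log m) := by
      apply Real.le_sqrt_of_sq_le
      have h3 : Real.log 2 ≤ Real.log m := Real.log_le_log (by norm_num) (by exact_mod_cast h2)
      have := Real.log_two_gt_d9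
      norm_num at *
      linarith
    have hm' : (0 : ℝ) < m := by positivity
    rw [alpha, div_le_iff₀ (by positivity)]
    field_simp
    linarith
  · simp [alpha_eq_zero (not_le.1 h2)]

/-- `(Δ₁ / m)^(k / L)`, with `L = Δ₂ - Δ₁ + 1`, is at least a constant times `1 / m`. -/
theorem exists_const_le_rpow : ∃ c : ℝ, 0 < c ∧ c ≤ 1 ∧ ∀ m k : ℕ, 1 ≤ m → k ≤ m →
    c / m ≤ (((Δ₁ m : ℝ) / m) ^ k) ^ (1 / ((Δ₂ m - Δ₁ m + 1 : ℕ) : ℝ)) := by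
  -- Put s = √(log m). Since Δ₁/m ≥ 1/(8s) and k/L ≤ 4s, the logarithm of the right side plus log m
  -- is at least s² - 4s(s/8 + log 64) = (s - 4 log 64)²/2 - 8(log 64)².
  refine ⟨Real.exp (-(8 * (Real.log 64) ^ 2)), Real.exp_pos _,
    Real.exp_le_one_iff.2 (by nlinarith [sq_nonneg (Real.log 64)]), fun m k hm hk => ?_⟩
  have hc1 : Real.exp (-(8 * (Real.log 64) ^ 2)) ≤ 1 :=
    Real.exp_le_one_iff.2 (by nlinarith [sq_nonneg (Real.log 64)])
  have hm' : (0 : ℝ) < m := by positivity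
  by_cases h2 : 2 ≤ m
  · obtain ⟨hL, hΔ⟩ := Δ_gap_ge h2
    have hs := sqrt_log_pos h2
    have hs2 : Real.sqrt (Real.log m) ^ 2 = Real.log m :=
      Real.sq_sqrt (Real.log_nonneg (by exact_mod_cast hm))
    set s := Real.sqrt (Real.log m)
    set L : ℝ := ((Δ₂ m - Δ₁ m + 1 : ℕ) : ℝ)
    have hLpos : 0 < L := lt_of_lt_of_le (by positivity) hL
    have hρ1 : (Δ₁ m : ℝ) / m ≤ 1 := by
      rw [div_le_one hm']; exact_mod_cast Δ₁_le_self hm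
    have hρ0 : 1 / (8 * s) ≤ (Δ₁ m : ℝ) / m := by
      rw [le_div_iff₀ hm']
      refine le_trans (le_of_eq ?_) hΔ
      field_simp
      norm_num
    have hρpos : 0 < (Δ₁ m : ℝ) / m := lt_of_lt_of_le (by positivity) hρ0
    set ρ := (Δ₁ m : ℝ) / m
    have hlog : 0 ≤ -Real.log ρ := by linarith [Real.log_nonpos hρpos.le hρ1]
    have hlog2 : -Real.log ρ ≤ Real.log (8 * s) := by
      have := Real.log_le_log (by positivity) hρ0
      rw [one_div, Real.log_inv] at this
      linarith
    -- Writing 8s = (s/8)·64 before using log y ≤ y - 1 makes the coefficient of s small. After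
    -- multiplication by 4s only s²/2 arises, which log m = s² absorbs.
    have hlog3 : Real.log (8 * s) ≤ s / 8 + Real.log 64 := by
      have h3 : 8 * s = s / 8 * 64 := by ring
      rw [h3, Real.log_mul (by positivity) (by norm_num)]
      have := Real.log_le_sub_one_of_pos (show 0 < s / 8 by positivity)
      linarith
    have hkL : (k : ℝ) / L ≤ 4 * s := by
      rw [div_le_iff₀ hLpos]
      have h3 : (k : ℝ) ≤ m := by exact_mod_cast hk
      rw [div_le_iff₀ (by positivity)] at hL
      linarith
    have h4 : (k : ℝ) * (1 / L) = k / L := by ring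
    have h5 : -Real.log ρ * (k / L) ≤ (s / 8 + Real.log 64) * (4 * s) :=
      mul_le_mul (hlog2.trans hlog3) hkL (by positivity) (by linarith)
    rw [← Real.rpow_natCast ρ k, ← Real.rpow_mul hρpos.le, Real.rpow_def_of_pos hρpos, h4,
      div_le_iff₀ hm']
    calc Real.exp (-(8 * Real.log 64 ^ 2)) ≤ Real.exp (Real.log ρ * (k / L) + Real.log m) := by
          rw [Real.exp_le_exp, ← hs2]
          nlinarith [sq_nonneg (s - 4 * Real.log 64)]
      _ = Real.exp (Real.log ρ * (k / L)) * m := by rw [Real.exp_add, Real.exp_log hm']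
  · obtain rfl : m = 1 := by omega
    have : Δ₁ 1 = 1 := by simp [Δ₁, alpha]
    rw [this]
    simpa using hc1


/-! ## Probability bounds for the main algorithm -/

theorem toOuterMeasure_add_compl {X : Type*} (p : PMF X) (s : Set X) :
    p.toOuterMeasure s + p.toOuterMeasure sᶜ = 1 := by
  rw [PMF.toOuterMeasure_apply, PMF.toOuterMeasure_apply, ← ENNReal.tsum_add, ← p.tsum_coe]
  refine tsum_congr fun x => ?_
  exact congrFun (Set.indicator_self_add_compl s p) x

/-! ### The probability that the clusters cover a separated set -/

section Success

variable {V : Type u} [MetricSpace V] {m : ℕ} {U O : Finset V} {γ : ℝ}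

open Classical in
-- If the first point of B(o,R) in the enumeration lies in B(o,R-1), then it is the first center to
-- reach o, and it does so at distance less than R; hence o lies in its cluster. A common point of
-- the balls around o and o' would have both in its own ball of radius R, closer than γ; so these
-- balls are disjoint and `card_firstIn_mul` applies.
theorem card_covering_ge (hγ : 0 < γ) (hOU : O ⊆ U)
    (hsep : ∀ u ∈ O, ∀ v ∈ O, u ≠ v → γ ≤ dist u v) {R : ℕ} (hR1 : 1 ≤ R) (hR : R ≤ Δ₂ m) :
    (∏ o ∈ O, ((ball U (nearGraph U (γ * alpha m)) o (R - 1)).card : ℝ) /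
        (ball U (nearGraph U (γ * alpha m)) o R).card) * Fintype.card (Fin U.card ≃ U) ≤
      (Finset.univ.filter fun π : Fin U.card ≃ U => ∀ o ∈ O, ∃ j,
        o ∈ cluster U (nearGraph U (γ * alpha m)) π R j).card := by
  set G := nearGraph U (γ * alpha m)
  let B : ℕ → V → Finset U := fun R o => Finset.univ.filter fun x : U => (x : V) ∈ ball U G o R
  have hBcard : ∀ R o, (B R o).card = (ball U G o R).card := fun R o => by
    rw [← Finset.card_map (Function.Embedding.subtype _)]
    congr 1
    ext v
    simp only [B, Finset.mem_map, Finset.mem_filter, Finset.mem_univ, true_and,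
      Function.Embedding.subtype_apply, Subtype.exists, exists_and_left, exists_prop,
      exists_eq_right_right]
    exact ⟨fun h => h.1, fun h => ⟨h, (mem_ball.1 h).1⟩⟩
  have hpos : ∀ R, ∀ o ∈ O, 0 < (ball U G o R).card := fun R o ho =>
    Finset.card_pos.2 ⟨o, self_mem_ball (hOU ho) R⟩
  have key := card_firstIn_mul (N := U.card) O (B (R - 1)) (B R)
    (fun o _ x hx => by
      simp only [B, Finset.mem_filter, Finset.mem_univ, true_and] at hx ⊢
      exact ball_mono o (Nat.sub_le R 1) hx)
    (fun o ho => Finset.card_pos.1 (by rw [hBcard]; exact hpos R o ho))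
    (fun o ho o' ho' hne => Finset.disjoint_left.2 fun x hx hx' => by
      simp only [B, Finset.mem_filter, Finset.mem_univ, true_and] at hx hx'
      rw [mem_ball_comm (hOU ho) x.2] at hx
      rw [mem_ball_comm (hOU ho') x.2] at hx'
      exact (hsep o ho o' ho' hne).not_gt (dist_lt_of_mem_ball hγ hR hx hx'))
  simp only [hBcard] at key
  have hprod : (0 : ℝ) < ∏ o ∈ O, ((ball U G o R).card : ℝ) :=
    Finset.prod_pos fun o ho => by exact_mod_cast hpos R o ho
  have key' : ((Finset.univ.filter fun π : Fin U.card ≃ U =>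
      ∀ o ∈ O, FirstIn π (B (R - 1) o) (B R o)).card : ℝ) * ∏ o ∈ O, ((ball U G o R).card : ℝ) =
      Fintype.card (Fin U.card ≃ U) * ∏ o ∈ O, ((ball U G o (R - 1)).card : ℝ) := by
    exact_mod_cast key
  rw [Finset.prod_div_distrib, div_mul_eq_mul_div, div_le_iff₀ hprod, mul_comm, ← key']
  refine mul_le_mul_of_nonneg_right ?_ hprod.le
  refine Nat.cast_le.2 (Finset.card_le_card fun π hπ => ?_)
  simp only [Finset.mem_filter, Finset.mem_univ, true_and] at hπ ⊢
  intro o ho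
  obtain ⟨j, hj, hj'⟩ := hπ o ho
  simp only [B, Finset.mem_filter, Finset.mem_univ, true_and] at hj hj'
  refine ⟨j, mem_cluster.2 ⟨⟨?_, fun i hi => ?_⟩, ?_⟩⟩
  · rw [mem_ball_comm (π j).2 (hOU ho)]
    exact ball_mono o (Nat.sub_le R 1) hj
  · rw [mem_ball_comm (π i).2 (hOU ho)]
    exact hj' i hi
  · rw [SimpleGraph.edist_comm]
    refine lt_of_le_of_lt (mem_ball.1 hj).2 ?_
    exact_mod_cast Nat.sub_lt hR1 one_pos

open Classical in
-- The bound for a fixed radius is averaged over R = Δ₁ + i with i < L. The mean is bounded by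
-- `rpow_le_mean_prod`, where the sizes of the balls of radius Δ₁ - 1 + i play the role of `g o i`.
theorem decompose_covering_ge (hγ : 0 < γ) (hOU : O ⊆ U)
    (hsep : ∀ u ∈ O, ∀ v ∈ O, u ≠ v → γ ≤ dist u v)
    (hball : ∀ c R, R ≤ Δ₂ m → (ball U (nearGraph U (γ * alpha m)) c R).card ≤ m) (hm : 1 ≤ m) :
    ENNReal.ofReal ((((Δ₁ m : ℝ) / m) ^ O.card) ^ (1 / ((Δ₂ m - Δ₁ m + 1 : ℕ) : ℝ))) ≤
      (decompose m U γ).toOuterMeasure {D | ∀ o ∈ O, ∃ j, o ∈ D j} := by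
  have : Nonempty (Fin U.card ≃ U) := ⟨U.equivFin.symm⟩
  set G := nearGraph U (γ * alpha m) with hG
  set L := Δ₂ m - Δ₁ m + 1 with hLdef
  have hL : 0 < L := by omega
  have hm' : (0 : ℝ) < m := by exact_mod_cast hm
  have hΔ := one_le_Δ₁ m
  have hΔ2 := Δ₁_le_Δ₂ m
  let cov : (Fin U.card ≃ U) → ℕ → Prop := fun π R => ∀ o ∈ O, ∃ j, o ∈ cluster U G π R j
  -- The value 1 outside of `O` only makes `g` positive everywhere; a ball around a point outside of
  -- U may be empty.
  let g : V → ℕ → ℝ := fun o i => if o ∈ O then ((ball U G o (Δ₁ m - 1 + i)).card : ℝ) else 1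
  have hgO : ∀ o ∈ O, ∀ i, g o i = (ball U G o (Δ₁ m - 1 + i)).card := fun o ho i => by
    simp [g, ho]
  have hg : ∀ o i, 0 < g o i := fun o i => by
    by_cases ho : o ∈ O
    · rw [hgO o ho]
      exact_mod_cast Finset.card_pos.2 ⟨o, self_mem_ball (hOU ho) _⟩
    · simp [g, ho]
  have hmean := rpow_le_mean_prod O g hg hL (ρ := (Δ₁ m : ℝ) / m)
    (div_pos (by exact_mod_cast hΔ) hm') (fun o ho => by
      rw [hgO o ho, hgO o ho, Nat.add_zero]
      have hend : Δ₁ m - 1 + L = Δ₂ m := by omega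
      rw [hend]
      have hposc : (0 : ℝ) < (ball U G o (Δ₂ m)).card := by
        exact_mod_cast Finset.card_pos.2 ⟨o, self_mem_ball (hOU ho) _⟩
      -- If the ball does not grow, the ratio is 1. Otherwise the inner ball has at least Δ₁ points
      -- and the outer one at most m.
      by_cases heq : ball U G o (Δ₂ m) = ball U G o (Δ₁ m - 1)
      · rw [heq, div_self (by rw [← heq]; exact hposc.ne'), div_le_one hm']
        exact_mod_cast Δ₁_le_self hm
      · have h1 : Δ₁ m - 1 < (ball U G o (Δ₁ m - 1)).card := lt_card_ball (hOU ho) heq (by omega)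
        have h2 : (Δ₁ m : ℝ) ≤ (ball U G o (Δ₁ m - 1)).card := by
          exact_mod_cast (by omega : Δ₁ m ≤ (ball U G o (Δ₁ m - 1)).card)
        have h3 : ((ball U G o (Δ₂ m)).card : ℝ) ≤ m := by exact_mod_cast hball o _ le_rfl
        exact div_le_div₀ (by positivity) h2 hposc h3)
  set E := Fintype.card (Fin U.card ≃ U) with hE
  have hEpos : (0 : ℝ) < E := by exact_mod_cast Fintype.card_pos
  have hsum : ∀ i ∈ Finset.range L, ∏ o ∈ O, g o i / g o (i + 1) ≤
      ((Finset.univ.filter fun π => cov π (Δ₁ m + i)).card : ℝ) / E := fun i hi => by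
    rw [Finset.mem_range] at hi
    rw [le_div_iff₀ hEpos]
    have := card_covering_ge (m := m) (R := Δ₁ m + i) hγ hOU hsep (by omega) (by omega)
    refine le_trans (le_of_eq ?_) this
    congr 1
    refine Finset.prod_congr rfl fun o ho => ?_
    rw [hgO o ho, hgO o ho]
    have e1 : Δ₁ m - 1 + i = Δ₁ m + i - 1 := by omega
    have e2 : Δ₁ m - 1 + (i + 1) = Δ₁ m + i := by omega
    rw [e1, e2]
  have hreal : (((Δ₁ m : ℝ) / m) ^ O.card) ^ (1 / (L : ℝ)) ≤
      (∑ i ∈ Finset.range L, ((Finset.univ.filter fun π => cov π (Δ₁ m + i)).card : ℝ)) /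
        (L * E) := by
    refine hmean.trans ((Finset.sum_le_sum fun i hi =>
      mul_le_mul_of_nonneg_left (hsum i hi) (by positivity)).trans (le_of_eq ?_))
    rw [Finset.sum_div]
    refine Finset.sum_congr rfl fun i _ => ?_
    field_simp
  -- The pairs (π, R) that cover O are counted by radius for the averaging argument and by
  -- enumeration to match the law `decompose`.
  have hswap : ∑ i ∈ Finset.range L, (Finset.univ.filter fun π => cov π (Δ₁ m + i)).card =
      ∑ π, ((Finset.Icc (Δ₁ m) (Δ₂ m)).filter fun R => cov π R).card := by
    simp only [Finset.card_filter]
    rw [Finset.sum_comm]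
    refine Finset.sum_congr rfl fun π _ => ?_
    rw [Finset.range_eq_Ico, Finset.sum_Ico_add (fun R => if cov π R then 1 else 0) 0 L (Δ₁ m)]
    refine Finset.sum_congr ?_ fun _ _ => rfl
    ext R
    simp only [Finset.mem_Ico, Finset.mem_Icc]
    omega
  have hprob : (decompose m U γ).toOuterMeasure {D | ∀ o ∈ O, ∃ j, o ∈ D j} =
      ENNReal.ofReal ((∑ i ∈ Finset.range L,
        ((Finset.univ.filter fun π => cov π (Δ₁ m + i)).card : ℝ)) / (L * E)) := by
    have hcard : (Finset.Icc (Δ₁ m) (Δ₂ m)).card = L := by rw [Nat.card_Icc]; omega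
    rw [decompose, PMF.toOuterMeasure_bind_apply, tsum_fintype]
    rw [← Nat.cast_sum, hswap, ENNReal.ofReal_div_of_pos (by positivity),
      ENNReal.ofReal_mul (by positivity)]
    rw [ENNReal.ofReal_natCast, ENNReal.ofReal_natCast, ENNReal.ofReal_natCast, Nat.cast_sum,
      div_eq_mul_inv, Finset.sum_mul]
    refine Finset.sum_congr rfl fun π _ => ?_
    rw [PMF.toOuterMeasure_map_apply, PMF.toOuterMeasure_uniformOfFinset_apply,
      PMF.uniformOfFintype_apply, hcard, ← hE,
      ENNReal.mul_inv (Or.inl (by simp [L])) (Or.inl (by simp))]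
    rw [div_eq_mul_inv, mul_comm, mul_assoc]
    congr! 3
    ext R
    simp only [Finset.mem_filter]
    rfl
  rw [hprob]
  exact ENNReal.ofReal_le_ofReal hreal

end Success

/-- A bad result requires every repetition to end infeasible. The draws are independent and each
fails with probability at most 1 - q, whatever rule is used in it. -/
theorem repeatLoop_compl_le {V : Type u} [MetricSpace V] {m : ℕ} {I : Problem V m}
    {rule : ℕ → AssignRule I} {U : Finset V} {γ : ℝ} {q : ℝ≥0∞} {Good : Set (Finset V)}
    (hq : ∀ r, q ≤ (decompose m U γ).toOuterMeasure {D | I.Feasible (extract I (rule r) D)})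
    (hgood : ∀ r, ∀ D ∈ (decompose m U γ).support, I.Feasible (extract I (rule r) D) →
      extract I (rule r) D ∈ Good) :
    ∀ r S, (repeatLoop I rule U γ r S).toOuterMeasure Goodᶜ ≤ (1 - q) ^ r := by
  classical
  intro r
  induction r with
  | zero =>
    intro S
    rw [pow_zero, ← toOuterMeasure_add_compl _ Good]
    exact le_add_self
  | succ r ih =>
    intro S
    rw [repeatLoop, PMF.toOuterMeasure_bind_apply, pow_succ']
    calc _ ≤ ∑' D, {D | I.Feasible (extract I (rule r) D)}ᶜ.indicator (decompose m U γ) D *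
          (1 - q) ^ r := by
          refine ENNReal.tsum_le_tsum fun D => ?_
          by_cases hD : D ∈ (decompose m U γ).support
          · by_cases hf : I.Feasible (extract I (rule r) D)
            · simp [hf, hgood r D hD hf]
            · rw [if_neg hf, Set.indicator_of_mem (by simpa using hf)]
              exact mul_le_mul_right (ih _) _
          · rw [PMF.mem_support_iff, not_not] at hD
            simp [hD]
      _ = (decompose m U γ).toOuterMeasure {D | I.Feasible (extract I (rule r) D)}ᶜ *
          (1 - q) ^ r := by
          rw [ENNReal.tsum_mul_right, PMF.toOuterMeasure_apply]
      _ ≤ _ := by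
          refine mul_le_mul_left ?_ _
          refine ENNReal.le_sub_of_add_le_left ?_ ?_
          · exact ne_top_of_le_ne_top ENNReal.one_ne_top ((hq r).trans
              ((toOuterMeasure_add_compl _ _).symm ▸ le_self_add))
          · rw [← toOuterMeasure_add_compl (decompose m U γ)
              {D | I.Feasible (extract I (rule r) D)}]
            exact add_le_add_left (hq r) _

theorem mem_support_decompose {V : Type u} [MetricSpace V] {m : ℕ} {U : Finset V} {γ : ℝ}
    {D : Fin U.card → Finset V} (hD : D ∈ (decompose m U γ).support) :
    ∃ π R, R ≤ Δ₂ m ∧ D = cluster U (nearGraph U (γ * alpha m)) π R := by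
  rw [decompose, PMF.mem_support_bind_iff] at hD
  obtain ⟨π, -, hπ⟩ := hD
  rw [PMF.mem_support_map_iff] at hπ
  obtain ⟨R, hR, rfl⟩ := hπ
  rw [PMF.mem_support_uniformOfFinset_iff, Finset.mem_Icc] at hR
  exact ⟨π, R, hR.2, rfl⟩

/-- A feasible set of diversity `τ` moves to a feasible subset of the pruned set that is separated
by `τ / 3`. -/
theorem exists_feasible_subset_prune {V : Type u} [Fintype V] [MetricSpace V] {m : ℕ}
    {I : Problem V m} {τ : ℝ} (hτ : 0 < τ) {O : Finset V} (hO : I.Feasible O)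
    (hdiv : ENNReal.ofReal τ ≤ diversity O) {pick : Finset V → V}
    (hpick : ∀ A : Finset V, A.Nonempty → pick A ∈ A) :
    ∃ O' ⊆ prune I pick (τ / 3) (Fintype.card V), I.Feasible O' ∧
      ∀ u ∈ O', ∀ v ∈ O', u ≠ v → τ / 3 ≤ dist u v := by
  classical
  obtain ⟨-, hcov⟩ := prune_spec I hpick (P := fun _ _ => True) (fun _ _ _ => trivial)
    (show 0 < τ / 3 by positivity)
  choose f hfU hfc hf using hcov
  -- Both points move by less than τ/3, so a distance of at least τ stays above τ - 2τ/3. In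
  -- particular `f` is injective on O.
  have hfar : ∀ u ∈ O, ∀ v ∈ O, u ≠ v → τ / 3 ≤ dist (f u) (f v) := by
    intro u hu v hv huv
    have h1 : ENNReal.ofReal τ ≤ edist u v :=
      (Set.le_einfsep_iff.1 hdiv) u (Finset.mem_coe.2 hu) v (Finset.mem_coe.2 hv) huv
    rw [edist_dist, ENNReal.ofReal_le_ofReal_iff dist_nonneg] at h1
    have h2 := dist_triangle4 u (f u) (f v) v
    have h3 := (hf u).2
    have h4 := (hf v).2
    rw [dist_comm v] at h4
    linarith
  have hinj : Set.InjOn f O := by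
    intro u hu v hv h
    by_contra hne
    have := hfar u hu v hv hne
    rw [h, dist_self] at this
    linarith
  refine ⟨O.image f, Finset.image_subset_iff.2 fun o _ => hfU o, ⟨?_, fun i => ?_⟩, ?_⟩
  · rw [Finset.card_image_of_injOn hinj, hO.1]
  · have h : ((O.image f).filter fun v => I.color v = i) =
        (O.filter fun v => I.color v = i).image f := by
      ext v
      simp only [Finset.mem_filter, Finset.mem_image]
      constructor
      · rintro ⟨⟨o, ho, rfl⟩, h⟩
        exact ⟨o, ⟨ho, (hfc o) ▸ h⟩, rfl⟩
      · rintro ⟨o, ⟨ho, h⟩, rfl⟩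
        exact ⟨⟨o, ho, rfl⟩, (hfc o).trans h⟩
    have := hO.2 i
    rw [h, Finset.card_image_of_injOn (hinj.mono (Finset.coe_subset.2 (Finset.filter_subset _ _)))]
    convert this
  · intro u hu v hv huv
    obtain ⟨a, ha, rfl⟩ := Finset.mem_image.1 hu
    obtain ⟨b, hb, rfl⟩ := Finset.mem_image.1 hv
    exact hfar a ha b hb fun e => huv (e ▸ rfl)

theorem approximation_guarantee : ∃ c : ℝ, 0 < c ∧
    ∀ (V : Type u) [Fintype V] [MetricSpace V] [Nonempty V] (m : ℕ) (I : Problem V m)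
      (τ : ℝ) (T : ℕ), 0 < τ → I.k ≤ m →
      (∃ O : Finset V, I.Feasible O ∧ ENNReal.ofReal τ ≤ diversity O) →
      ∀ χ : Choices I,
        ENNReal.ofReal (1 - (2 : ℝ) ^ (-(c * (T : ℝ)))) ≤
          (fmmd I χ (τ / 3) (τ / 3) (Fintype.card V) T).toOuterMeasure
            {S | I.Feasible S ∧
              ENNReal.ofReal (Real.sqrt (Real.log m) * τ / (3 * m)) ≤ diversity S} := by
  obtain ⟨c, hc, hc1, hcq⟩ := exists_const_le_rpow
  -- Division by log 2 turns (1 - c/m)^(Tm) ≤ exp(-cT) into a power of 2.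
  refine ⟨c / Real.log 2, div_pos hc (Real.log_pos one_lt_two), ?_⟩
  intro V _ _ _ m I τ T hτ hkm ⟨O, hO, hdiv⟩ χ
  have hm : 1 ≤ m := (I.color (Classical.arbitrary V)).pos
  have hm' : (0 : ℝ) < m := by exact_mod_cast hm
  have hγ : 0 < τ / 3 := by positivity
  obtain ⟨O', hO'U, hO', hsep⟩ := exists_feasible_subset_prune hτ hO hdiv χ.pick_mem
  obtain ⟨hUsep, -⟩ := prune_spec I χ.pick_mem (P := fun _ _ => True) (fun _ _ _ => trivial) hγ
  rw [fmmd]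
  set U := prune I χ.pick (τ / 3) (Fintype.card V)
  have hq := decompose_covering_ge (m := m) hγ hO'U hsep
    (fun c R hR => card_ball_le hγ hUsep hR c) hm
  have hq' : ENNReal.ofReal (c / m) ≤
      (decompose m U (τ / 3)).toOuterMeasure {D | ∀ o ∈ O', ∃ j, o ∈ D j} :=
    (ENNReal.ofReal_le_ofReal (hcq m O'.card hm (hO'.1.trans_le hkm))).trans hq
  -- Covering `O'` suffices: no cluster contains two of its points, so it gives a flow of value k.
  -- No flow has a larger value, so the rule's maximum flow has value k, too.
  have hfeas : ∀ r, ENNReal.ofReal (c / m) ≤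
      (decompose m U (τ / 3)).toOuterMeasure {D | I.Feasible (extract I (χ.rule r) D)} := by
    intro r
    refine hq'.trans (PMF.toOuterMeasure_mono _ ?_)
    rintro D ⟨hD, hDs⟩
    obtain ⟨π, R, hR, rfl⟩ := mem_support_decompose hDs
    have hdisj : ∀ i j v, v ∈ cluster U (nearGraph U (τ / 3 * alpha m)) π R i →
        v ∈ cluster U (nearGraph U (τ / 3 * alpha m)) π R j → i = j := fun i j v =>
      cluster_disjoint
    refine (feasible_extract_iff _ hdisj hO.sum_lower_le hO.lower_le_upper).2 ?_
    obtain ⟨f, hf, hfk⟩ := exists_flow_of_feasible hO' hD hdisj (fun i u hu v hv hui hvi => by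
      by_contra hne
      exact (hsep u hu v hv hne).not_gt (dist_lt_of_mem_ball hγ hR (cluster_subset_ball hui)
        (cluster_subset_ball hvi)))
    exact le_antisymm (((χ.rule r).isFlow _).value_le hO.sum_lower_le)
      (hfk ▸ ((χ.rule r).isMaxFlow_solve _).2 f hf)
  have hbad := repeatLoop_compl_le hfeas (Good := {S | I.Feasible S ∧
      ENNReal.ofReal (Real.sqrt (Real.log m) * τ / (3 * m)) ≤ diversity S}) (by
    intro r D hDs hDf
    refine ⟨hDf, ?_⟩
    obtain ⟨π, R, hR, rfl⟩ := mem_support_decompose hDs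
    have h1 : Real.sqrt (Real.log m) * τ / (3 * m) = τ / 3 * alpha m := by
      rw [alpha]; ring
    rw [h1]
    exact le_diversity_extract _ fun i j hij u hu v hv => le_dist_of_mem_cluster hij hu hv)
    (T * m) ∅
  have hcm : c / m ≤ 1 := by
    rw [div_le_one hm']
    exact hc1.trans (by exact_mod_cast hm)
  have hpow : (1 - c / m) ^ (T * m) ≤ (2 : ℝ) ^ (-(c / Real.log 2 * (T : ℝ))) := by
    rw [Real.rpow_def_of_pos two_pos]
    have hl : Real.log 2 ≠ 0 := (Real.log_pos one_lt_two).ne'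
    have h1 : Real.log 2 * -(c / Real.log 2 * T) = ((T * m : ℕ) : ℝ) * (-(c / m)) := by
      push_cast; field_simp
    rw [h1, Real.exp_nat_mul]
    refine pow_le_pow_left₀ (by linarith) ?_ _
    have := Real.add_one_le_exp (-(c / m))
    linarith
  have h2 : (1 - ENNReal.ofReal (c / m)) ^ (T * m) = ENNReal.ofReal ((1 - c / m) ^ (T * m)) := by
    rw [ENNReal.ofReal_pow (by linarith), ENNReal.ofReal_sub _ (by positivity),
      ENNReal.ofReal_one]
  rw [h2] at hbad
  have hsum := toOuterMeasure_add_compl (repeatLoop I χ.rule U (τ / 3) (T * m) ∅)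
    {S | I.Feasible S ∧ ENNReal.ofReal (Real.sqrt (Real.log m) * τ / (3 * m)) ≤ diversity S}
  rw [ENNReal.ofReal_sub _ (by positivity), ENNReal.ofReal_one, ← hsum, tsub_le_iff_right]
  exact add_le_add_right (hbad.trans (ENNReal.ofReal_le_ofReal hpow)) _


/-! ## Deterministic programs -/

section Store

variable (s : Store)

@[simp] theorem Store.tick_num (t : ℕ) : (s.tick t).num = s.num := rfl
@[simp] theorem Store.tick_arr (t : ℕ) : (s.tick t).arr = s.arr := rfl
@[simp] theorem Store.tick_real (t : ℕ) : (s.tick t).real = s.real := rfl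
@[simp] theorem Store.setNum_num (x v y : ℕ) :
    (s.setNum x v).num y = if y = x then v else s.num y := Function.update_apply _ _ _ _
@[simp] theorem Store.setNum_arr (x v : ℕ) : (s.setNum x v).arr = s.arr := rfl
@[simp] theorem Store.setNum_real (x v : ℕ) : (s.setNum x v).real = s.real := rfl
@[simp] theorem Store.setArr_num (a i v : ℕ) : (s.setArr a i v).num = s.num := rfl
@[simp] theorem Store.setArr_arr (a i v b : ℕ) : (s.setArr a i v).arr b =
    if b = a then Function.update (s.arr a) i v else s.arr b := Function.update_apply _ _ _ _
@[simp] theorem Store.setArr_real (a i v : ℕ) : (s.setArr a i v).real = s.real := rfl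
@[simp] theorem Store.setReal_num (x : ℕ) (v : ℝ) : (s.setReal x v).num = s.num := rfl
@[simp] theorem Store.setReal_arr (x : ℕ) (v : ℝ) : (s.setReal x v).arr = s.arr := rfl
@[simp] theorem Store.setReal_real (x : ℕ) (v : ℝ) (y : ℕ) : (s.setReal x v).real y =
    if y = x then v else s.real y := Function.update_apply _ _ _ _

end Store

attribute [simp] NatExpr.eval RealExpr.eval Test.Holds

/-- The first `N` rounds of a deterministic loop. -/
def roundsDet (x : ℕ) (body : Store → Store) : ℕ → Store → Store
  | 0, s => s
  | N + 1, s => body (((roundsDet x body N s).setNum x N).tick 1)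

open Classical in
/-- The effect of a deterministic program. -/
noncomputable def Prog.run (δ : ℕ → ℕ → ℝ) : Prog → Store → Store
  | skip => fun s => s.tick 1
  | setNum x e => fun s => (s.setNum x (e.eval s)).tick (e.cost + 1)
  | setArr a i e => fun s => (s.setArr a (i.eval s) (e.eval s)).tick (i.cost + e.cost + 1)
  | setReal x e => fun s => (s.setReal x (e.eval δ s)).tick (e.cost + 1)
  -- Dummy values, since deterministic programs contain neither of the two random commands.
  | rand _ _ => id
  | shuffle _ _ => id
  | seq p q => fun s => q.run δ (p.run δ s)
  | ite b p q => fun s =>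
      if b.Holds δ s then p.run δ (s.tick (b.cost + 1)) else q.run δ (s.tick (b.cost + 1))
  | loop x e p => fun s => roundsDet x (p.run δ) (e.eval s) (s.tick (e.cost + 1))

/-- The program draws no random numbers. -/
def Prog.det : Prog → Bool
  | rand _ _ => false
  | shuffle _ _ => false
  | seq p q => p.det && q.det
  | ite _ p q => p.det && q.det
  | loop _ _ p => p.det
  | _ => true

theorem Prog.exec_eq_pure (δ : ℕ → ℕ → ℝ) : ∀ p : Prog, p.det = true →
    ∀ s, p.exec δ s = PMF.pure (p.run δ s)
  | skip, _, s => rfl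
  | setNum _ _, _, s => rfl
  | setArr _ _ _, _, s => rfl
  | setReal _ _, _, s => rfl
  | seq p q, h, s => by
    rw [det, Bool.and_eq_true] at h
    change (p.exec δ s).bind (q.exec δ) = _
    rw [exec_eq_pure δ p h.1, PMF.pure_bind, exec_eq_pure δ q h.2]
    rfl
  | ite b p q, h, s => by
    rw [det, Bool.and_eq_true] at h
    simp only [exec, run, exec_eq_pure δ p h.1, exec_eq_pure δ q h.2]
    split_ifs <;> rfl
  | loop x e p, h, s => by
    have : ∀ N s, iterRounds x (p.exec δ) N s = PMF.pure (roundsDet x (p.run δ) N s) := by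
      intro N
      induction N with
      | zero => intro s; rfl
      | succ N ih =>
        intro s
        rw [iterRounds, ih, PMF.pure_bind, exec_eq_pure δ p h, roundsDet]
    exact this _ _

section RunLemmas

variable (δ : ℕ → ℕ → ℝ) (s : Store)

@[simp] theorem Prog.run_skip : skip.run δ s = s.tick 1 := rfl
@[simp] theorem Prog.run_setNum (x : ℕ) (e : NatExpr) :
    (setNum x e).run δ s = (s.setNum x (e.eval s)).tick (e.cost + 1) := rfl
@[simp] theorem Prog.run_setArr (a : ℕ) (i e : NatExpr) : (setArr a i e).run δ s =
    (s.setArr a (i.eval s) (e.eval s)).tick (i.cost + e.cost + 1) := rfl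
@[simp] theorem Prog.run_setReal (x : ℕ) (e : RealExpr) :
    (setReal x e).run δ s = (s.setReal x (e.eval δ s)).tick (e.cost + 1) := rfl
@[simp] theorem Prog.run_seq (p q : Prog) : (seq p q).run δ s = q.run δ (p.run δ s) := rfl
theorem Prog.run_ite_pos {b : Test} (p q : Prog) (h : b.Holds δ s) :
    (ite b p q).run δ s = p.run δ (s.tick (b.cost + 1)) := if_pos h
theorem Prog.run_ite_neg {b : Test} (p q : Prog) (h : ¬ b.Holds δ s) :
    (ite b p q).run δ s = q.run δ (s.tick (b.cost + 1)) := if_neg h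

theorem Prog.exec_ite_pos {b : Test} (p q : Prog) (h : b.Holds δ s) :
    (ite b p q).exec δ s = p.exec δ (s.tick (b.cost + 1)) := if_pos h
theorem Prog.exec_ite_neg {b : Test} (p q : Prog) (h : ¬ b.Holds δ s) :
    (ite b p q).exec δ s = q.exec δ (s.tick (b.cost + 1)) := if_neg h

end RunLemmas

/-! ### Variables that a program leaves alone -/

/-- `x` is a number variable to which the program may assign. -/
def Prog.writesNum : Prog → ℕ → Bool
  | setNum y _, x => x == y
  | rand y _, x => x == y
  | seq p q, x => p.writesNum x || q.writesNum x
  | ite _ p q, x => p.writesNum x || q.writesNum x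
  | loop y _ p, x => x == y || p.writesNum x
  | _, _ => false

/-- `a` is an array to which the program may assign. -/
def Prog.writesArr : Prog → ℕ → Bool
  | setArr b _ _, a => a == b
  | shuffle b _, a => a == b
  | seq p q, a => p.writesArr a || q.writesArr a
  | ite _ p q, a => p.writesArr a || q.writesArr a
  | loop _ _ p, a => p.writesArr a
  | _, _ => false

/-- `x` is a real variable to which the program may assign. -/
def Prog.writesReal : Prog → ℕ → Bool
  | setReal y _, x => x == y
  | seq p q, x => p.writesReal x || q.writesReal x
  | ite _ p q, x => p.writesReal x || q.writesReal x
  | loop _ _ p, x => p.writesReal x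
  | _, _ => false

/-- The two stores agree on the variables to which `p` does not assign. -/
structure Frame (p : Prog) (s s' : Store) : Prop where
  num : ∀ x, p.writesNum x = false → s'.num x = s.num x
  arr : ∀ a, p.writesArr a = false → s'.arr a = s.arr a
  real : ∀ x, p.writesReal x = false → s'.real x = s.real x

theorem frame_roundsDet {δ : ℕ → ℕ → ℝ} {x : ℕ} {e : NatExpr} {p : Prog}
    (hp : ∀ s, Frame p s (p.run δ s)) (s : Store) (t : ℕ) :
    ∀ N, Frame (.loop x e p) s (roundsDet x (p.run δ) N (s.tick t))
  | 0 => ⟨fun _ _ => rfl, fun _ _ => rfl, fun _ _ => rfl⟩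
  | N + 1 => by
    have ih := frame_roundsDet (x := x) (e := e) hp s t N
    have hs := hp (((roundsDet x (p.run δ) N (s.tick t)).setNum x N).tick 1)
    refine ⟨fun y hy => ?_, fun a ha => ?_, fun y hy => ?_⟩
    · have hy' := hy
      simp only [Prog.writesNum, Bool.or_eq_false_iff, beq_eq_false_iff_ne] at hy
      rw [← ih.num y hy', roundsDet, hs.num y hy.2]
      simp [hy.1]
    · rw [← ih.arr a ha, roundsDet, hs.arr a ha]
      rfl
    · rw [← ih.real y hy, roundsDet, hs.real y hy]
      rfl

/-- Whether a concrete program writes a given variable is settled by evaluation, so `rfl` proves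
that it is kept. With this, loop invariants need to mention only what the loop changes. -/
theorem Prog.frame (δ : ℕ → ℕ → ℝ) : ∀ (p : Prog) (s : Store), Frame p s (p.run δ s)
  | skip, s => ⟨fun _ _ => rfl, fun _ _ => rfl, fun _ _ => rfl⟩
  | rand _ _, s => ⟨fun _ _ => rfl, fun _ _ => rfl, fun _ _ => rfl⟩
  | shuffle _ _, s => ⟨fun _ _ => rfl, fun _ _ => rfl, fun _ _ => rfl⟩
  | setNum x e, s => ⟨fun y hy => by
      simp only [writesNum, beq_eq_false_iff_ne] at hy
      simp [hy], fun _ _ => rfl, fun _ _ => rfl⟩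
  | setArr a i e, s => ⟨fun _ _ => rfl, fun b hb => by
      simp only [writesArr, beq_eq_false_iff_ne] at hb
      simp [hb], fun _ _ => rfl⟩
  | setReal x e, s => ⟨fun _ _ => rfl, fun _ _ => rfl, fun y hy => by
      simp only [writesReal, beq_eq_false_iff_ne] at hy
      simp [hy]⟩
  | seq p q, s => by
    have hp := frame δ p s
    have hq := frame δ q (p.run δ s)
    refine ⟨fun y hy => ?_, fun a ha => ?_, fun y hy => ?_⟩
    · simp only [writesNum, Bool.or_eq_false_iff] at hy
      rw [run_seq, hq.num y hy.2, hp.num y hy.1]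
    · simp only [writesArr, Bool.or_eq_false_iff] at ha
      rw [run_seq, hq.arr a ha.2, hp.arr a ha.1]
    · simp only [writesReal, Bool.or_eq_false_iff] at hy
      rw [run_seq, hq.real y hy.2, hp.real y hy.1]
  | ite b p q, s => by
    have hp := frame δ p (s.tick (b.cost + 1))
    have hq := frame δ q (s.tick (b.cost + 1))
    by_cases h : b.Holds δ s
    · rw [run_ite_pos δ s p q h]
      refine ⟨fun y hy => ?_, fun a ha => ?_, fun y hy => ?_⟩
      · simp only [writesNum, Bool.or_eq_false_iff] at hy
        exact hp.num y hy.1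
      · simp only [writesArr, Bool.or_eq_false_iff] at ha
        exact hp.arr a ha.1
      · simp only [writesReal, Bool.or_eq_false_iff] at hy
        exact hp.real y hy.1
    · rw [run_ite_neg δ s p q h]
      refine ⟨fun y hy => ?_, fun a ha => ?_, fun y hy => ?_⟩
      · simp only [writesNum, Bool.or_eq_false_iff] at hy
        exact hq.num y hy.2
      · simp only [writesArr, Bool.or_eq_false_iff] at ha
        exact hq.arr a ha.2
      · simp only [writesReal, Bool.or_eq_false_iff] at hy
        exact hq.real y hy.2
  | loop x e p, s => frame_roundsDet (frame δ p) s _ _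

/-- The invariant rule for loops. -/
theorem Prog.run_loop {δ : ℕ → ℕ → ℝ} {x : ℕ} {e : NatExpr} {p : Prog} {s : Store}
    (Inv : ℕ → Store → Prop) (N : ℕ) (hN : e.eval s = N) (h0 : Inv 0 (s.tick (e.cost + 1)))
    (hstep : ∀ i < N, ∀ s', Frame (loop x e p) s s' → Inv i s' →
      Inv (i + 1) (p.run δ ((s'.setNum x i).tick 1))) :
    Inv N ((loop x e p).run δ s) := by
  subst hN
  have : ∀ M ≤ e.eval s, Inv M (roundsDet x (p.run δ) M (s.tick (e.cost + 1))) := by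
    intro M
    induction M with
    | zero => exact fun _ => h0
    | succ M ih =>
      intro hM
      exact hstep M hM _ (frame_roundsDet (p.frame δ) s _ M) (ih (by omega))
  exact this _ le_rfl

/-! ### Noninterference -/

/-- The expression only reads variables in `X` and arrays in `Y`. -/
def NatExpr.readsIn (X Y : ℕ → Bool) : NatExpr → Bool
  | lit _ => true
  | var x => X x
  | get a i => Y a && i.readsIn X Y
  | add e f => e.readsIn X Y && f.readsIn X Y
  | sub e f => e.readsIn X Y && f.readsIn X Y

/-- The test only reads variables in `X` and arrays in `Y`, and no real numbers. -/
def Test.readsIn (X Y : ℕ → Bool) : Test → Bool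
  | lt e f => e.readsIn X Y && f.readsIn X Y
  | eq e f => e.readsIn X Y && f.readsIn X Y
  | ltReal _ _ => false
  | neg b => b.readsIn X Y
  | conj b c => b.readsIn X Y && c.readsIn X Y

/-- The program is deterministic and only reads variables in `X` and arrays in `Y`. -/
def Prog.readsIn (X Y : ℕ → Bool) : Prog → Bool
  | skip => true
  | setNum _ e => e.readsIn X Y
  | setArr _ i e => i.readsIn X Y && e.readsIn X Y
  | setReal _ _ => true
  | rand _ _ => false
  | shuffle _ _ => false
  | seq p q => p.readsIn X Y && q.readsIn X Y
  | ite b p q => b.readsIn X Y && p.readsIn X Y && q.readsIn X Y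
  | loop _ e p => e.readsIn X Y && p.readsIn X Y

/-- The two stores agree on the variables in `X` and the arrays in `Y`. -/
structure Agree (X Y : ℕ → Bool) (s s' : Store) : Prop where
  num : ∀ x, X x = true → s.num x = s'.num x
  arr : ∀ a, Y a = true → s.arr a = s'.arr a

section Agree

variable {X Y : ℕ → Bool} {s s' : Store}

theorem Agree.tick (h : Agree X Y s s') (t t' : ℕ) : Agree X Y (s.tick t) (s'.tick t') :=
  ⟨h.num, h.arr⟩

theorem Agree.setNum (h : Agree X Y s s') (x v : ℕ) : Agree X Y (s.setNum x v) (s'.setNum x v) :=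
  ⟨fun y hy => by simp [h.num y hy], h.arr⟩

theorem Agree.setArr (h : Agree X Y s s') (a i v : ℕ) :
    Agree X Y (s.setArr a i v) (s'.setArr a i v) :=
  ⟨h.num, fun b hb => by
    by_cases hba : b = a
    · subst hba; simp [h.arr b hb]
    · simp [h.arr b hb, hba]⟩

theorem Agree.setReal (h : Agree X Y s s') (x : ℕ) (v v' : ℝ) :
    Agree X Y (s.setReal x v) (s'.setReal x v') := ⟨h.num, h.arr⟩

theorem NatExpr.eval_eq (h : Agree X Y s s') : ∀ e : NatExpr, e.readsIn X Y = true →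
    e.eval s = e.eval s'
  | lit _, _ => rfl
  | var x, he => h.num x he
  | get a i, he => by
    rw [readsIn, Bool.and_eq_true] at he
    rw [eval, eval, h.arr a he.1, eval_eq h i he.2]
  | add e f, he => by
    rw [readsIn, Bool.and_eq_true] at he
    rw [eval, eval, eval_eq h e he.1, eval_eq h f he.2]
  | sub e f, he => by
    rw [readsIn, Bool.and_eq_true] at he
    rw [eval, eval, eval_eq h e he.1, eval_eq h f he.2]

theorem Test.holds_iff {δ : ℕ → ℕ → ℝ} (h : Agree X Y s s') : ∀ b : Test, b.readsIn X Y = true →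
    (b.Holds δ s ↔ b.Holds δ s')
  | lt e f, hb => by
    rw [readsIn, Bool.and_eq_true] at hb
    rw [Holds, Holds, e.eval_eq h hb.1, f.eval_eq h hb.2]
  | eq e f, hb => by
    rw [readsIn, Bool.and_eq_true] at hb
    rw [Holds, Holds, e.eval_eq h hb.1, f.eval_eq h hb.2]
  | ltReal _ _, hb => by simp [readsIn] at hb
  | neg b, hb => by rw [Holds, Holds, holds_iff h b hb]
  | conj b c, hb => by
    rw [readsIn, Bool.and_eq_true] at hb
    rw [Holds, Holds, holds_iff h b hb.1, holds_iff h c hb.2]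

/-- This is used to show that the assignment step depends on the input and the clusters alone, not
on what earlier repetitions left in memory. Real variables need not agree, because tests on them are
excluded and nothing else carries them into numbers or arrays. -/
theorem Prog.run_agree (δ : ℕ → ℕ → ℝ) : ∀ (p : Prog), p.readsIn X Y = true →
    ∀ {s s' : Store}, Agree X Y s s' → Agree X Y (p.run δ s) (p.run δ s')
  | skip, _, _, _, h => h.tick _ _
  | rand _ _, hp, _, _, _ => by simp [readsIn] at hp
  | shuffle _ _, hp, _, _, _ => by simp [readsIn] at hp
  | setNum x e, hp, s, s', h => by
    rw [run_setNum, run_setNum, e.eval_eq h hp]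
    exact (h.setNum _ _).tick _ _
  | setArr a i e, hp, s, s', h => by
    rw [readsIn, Bool.and_eq_true] at hp
    rw [run_setArr, run_setArr, i.eval_eq h hp.1, e.eval_eq h hp.2]
    exact (h.setArr _ _ _).tick _ _
  | setReal x e, _, s, s', h => (h.setReal _ _ _).tick _ _
  | seq p q, hp, s, s', h => by
    rw [readsIn, Bool.and_eq_true] at hp
    exact run_agree δ q hp.2 (run_agree δ p hp.1 h)
  | ite b p q, hp, s, s', h => by
    rw [readsIn, Bool.and_eq_true, Bool.and_eq_true] at hp
    by_cases hb : b.Holds δ s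
    · rw [run_ite_pos δ s p q hb, run_ite_pos δ s' p q ((b.holds_iff h hp.1.1).1 hb)]
      exact run_agree δ p hp.1.2 (h.tick _ _)
    · rw [run_ite_neg δ s p q hb, run_ite_neg δ s' p q fun hb' => hb ((b.holds_iff h hp.1.1).2 hb')]
      exact run_agree δ q hp.2 (h.tick _ _)
  | loop x e p, hp, s, s', h => by
    rw [readsIn, Bool.and_eq_true] at hp
    have : ∀ N {s s' : Store}, Agree X Y s s' →
        Agree X Y (roundsDet x (p.run δ) N s) (roundsDet x (p.run δ) N s') := by
      intro N
      induction N with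
      | zero => intro s s' h; exact h
      | succ N ih =>
        intro s s' h
        exact run_agree δ p hp.2 (((ih h).setNum _ _).tick _ _)
    simp only [run]
    rw [e.eval_eq h hp.1]
    exact this _ (h.tick _ _)

end Agree

/-! ### Running times -/

/-- With `n`, `m`, `T` in the variables `0`, `1`, `4`, the program takes `O(n ^ a * m ^ b * T ^ c)`
steps and keeps these variables. -/
def Takes (p : Prog) (a b c : ℕ) : Prop :=
  ∃ C : ℕ, ∀ (δ : ℕ → ℕ → ℝ) (s : Store), 0 < s.num 0 → 0 < s.num 1 → 0 < s.num 4 →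
    ∀ s' ∈ (p.exec δ s).support,
      (s'.num 0 = s.num 0 ∧ s'.num 1 = s.num 1 ∧ s'.num 4 = s.num 4) ∧
      s'.time ≤ s.time + C * (s.num 0 ^ a * s.num 1 ^ b * s.num 4 ^ c)

section Takes

variable {a b c : ℕ}

/-- As n, m and T are positive, every monomial absorbs constant costs, so an elementary command fits
any exponents. -/
theorem one_le_monomial {x y z : ℕ} (hx : 0 < x) (hy : 0 < y) (hz : 0 < z) :
    1 ≤ x ^ a * y ^ b * z ^ c :=
  Nat.succ_le_of_lt (Nat.mul_pos (Nat.mul_pos (Nat.pow_pos hx) (Nat.pow_pos hy)) (Nat.pow_pos hz))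

theorem takes_skip : Takes .skip a b c := by
  refine ⟨1, fun δ s hn hm hT s' hs' => ?_⟩
  simp only [Prog.exec, PMF.support_pure, Set.mem_singleton_iff] at hs'
  subst hs'
  have := one_le_monomial (a := a) (b := b) (c := c) hn hm hT
  exact ⟨⟨rfl, rfl, rfl⟩, by simp only [Store.tick]; omega⟩

theorem takes_setNum {x : ℕ} {e : NatExpr} (h : x ≠ 0 ∧ x ≠ 1 ∧ x ≠ 4) :
    Takes (.setNum x e) a b c := by
  refine ⟨e.cost + 1, fun δ s hn hm hT s' hs' => ?_⟩
  simp only [Prog.exec, PMF.support_pure, Set.mem_singleton_iff] at hs'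
  subst hs'
  have := one_le_monomial (a := a) (b := b) (c := c) hn hm hT
  refine ⟨⟨?_, ?_, ?_⟩, ?_⟩
  · simp [h.1.symm]
  · simp [h.2.1.symm]
  · simp [h.2.2.symm]
  · exact Nat.add_le_add_left (Nat.le_mul_of_pos_right _ this) _

theorem takes_setArr {x : ℕ} {i e : NatExpr} : Takes (.setArr x i e) a b c := by
  refine ⟨i.cost + e.cost + 1, fun δ s hn hm hT s' hs' => ?_⟩
  simp only [Prog.exec, PMF.support_pure, Set.mem_singleton_iff] at hs'
  subst hs'
  have := one_le_monomial (a := a) (b := b) (c := c) hn hm hT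
  exact ⟨⟨rfl, rfl, rfl⟩, Nat.add_le_add_left (Nat.le_mul_of_pos_right _ this) _⟩

theorem takes_setReal {x : ℕ} {e : RealExpr} : Takes (.setReal x e) a b c := by
  refine ⟨e.cost + 1, fun δ s hn hm hT s' hs' => ?_⟩
  simp only [Prog.exec, PMF.support_pure, Set.mem_singleton_iff] at hs'
  subst hs'
  have := one_le_monomial (a := a) (b := b) (c := c) hn hm hT
  exact ⟨⟨rfl, rfl, rfl⟩, Nat.add_le_add_left (Nat.le_mul_of_pos_right _ this) _⟩

theorem takes_rand {x : ℕ} {e : NatExpr} (h : x ≠ 0 ∧ x ≠ 1 ∧ x ≠ 4) :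
    Takes (.rand x e) a b c := by
  refine ⟨e.cost + 1, fun δ s hn hm hT s' hs' => ?_⟩
  simp only [Prog.exec, PMF.support_map, Set.mem_image] at hs'
  obtain ⟨v, -, rfl⟩ := hs'
  have := one_le_monomial (a := a) (b := b) (c := c) hn hm hT
  refine ⟨⟨?_, ?_, ?_⟩, ?_⟩
  · simp [h.1.symm]
  · simp [h.2.1.symm]
  · simp [h.2.2.symm]
  · exact Nat.add_le_add_left (Nat.le_mul_of_pos_right _ this) _

theorem takes_seq {p q : Prog} (hp : Takes p a b c) (hq : Takes q a b c) :
    Takes (.seq p q) a b c := by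
  obtain ⟨C, hC⟩ := hp
  obtain ⟨C', hC'⟩ := hq
  refine ⟨C + C', fun δ s hn hm hT s' hs' => ?_⟩
  simp only [Prog.exec, PMF.mem_support_bind_iff] at hs'
  obtain ⟨s₁, hs₁, hs'⟩ := hs'
  obtain ⟨⟨h0, h1, h4⟩, ht⟩ := hC δ s hn hm hT s₁ hs₁
  obtain ⟨⟨h0', h1', h4'⟩, ht'⟩ := hC' δ s₁ (by omega) (by omega) (by omega) s' hs'
  rw [h0, h1, h4] at ht'
  refine ⟨⟨h0'.trans h0, h1'.trans h1, h4'.trans h4⟩, ?_⟩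
  rw [add_mul]
  omega

theorem takes_ite {t : Test} {p q : Prog} (hp : Takes p a b c) (hq : Takes q a b c) :
    Takes (.ite t p q) a b c := by
  obtain ⟨C, hC⟩ := hp
  obtain ⟨C', hC'⟩ := hq
  refine ⟨t.cost + 1 + C + C', fun δ s hn hm hT s' hs' => ?_⟩
  have h1 := one_le_monomial (a := a) (b := b) (c := c) hn hm hT
  have h2 : t.cost + 1 ≤ (t.cost + 1) * (s.num 0 ^ a * s.num 1 ^ b * s.num 4 ^ c) :=
    Nat.le_mul_of_pos_right _ h1
  rw [add_mul, add_mul]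
  simp only [Prog.exec] at hs'
  split_ifs at hs'
  · obtain ⟨h3, h4⟩ := hC δ (s.tick (t.cost + 1)) hn hm hT s' hs'
    refine ⟨h3, ?_⟩
    simp only [Store.tick] at h4 ⊢
    omega
  · obtain ⟨h3, h4⟩ := hC' δ (s.tick (t.cost + 1)) hn hm hT s' hs'
    refine ⟨h3, ?_⟩
    simp only [Store.tick] at h4 ⊢
    omega

/-- The exponents of the number of rounds and of the body add up. `Takes` speaks of all stores with
positive n, m, T, so no correctness statement enters the time analysis. -/
theorem takes_loop {x : ℕ} {e : NatExpr} {p : Prog} {a' b' c' : ℕ} (hx : x ≠ 0 ∧ x ≠ 1 ∧ x ≠ 4)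
    (d : ℕ) (he : ∀ s : Store, 0 < s.num 0 → 0 < s.num 1 → 0 < s.num 4 →
      e.eval s ≤ d * (s.num 0 ^ a' * s.num 1 ^ b' * s.num 4 ^ c'))
    (hp : Takes p a b c) : Takes (.loop x e p) (a + a') (b + b') (c + c') := by
  obtain ⟨C, hC⟩ := hp
  refine ⟨e.cost + 1 + d * (1 + C), fun δ s hn hm hT s' hs' => ?_⟩
  have hM := one_le_monomial (a := a) (b := b) (c := c) hn hm hT
  have hM' := one_le_monomial (a := a') (b := b') (c := c') hn hm hT
  have hprod : s.num 0 ^ (a + a') * s.num 1 ^ (b + b') * s.num 4 ^ (c + c') =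
      (s.num 0 ^ a * s.num 1 ^ b * s.num 4 ^ c) *
        (s.num 0 ^ a' * s.num 1 ^ b' * s.num 4 ^ c') := by ring
  have he' := he s hn hm hT
  rw [hprod]
  set M := s.num 0 ^ a * s.num 1 ^ b * s.num 4 ^ c with hMdef
  set M' := s.num 0 ^ a' * s.num 1 ^ b' * s.num 4 ^ c'
  have key : ∀ N, ∀ s' ∈ (iterRounds x (p.exec δ) N (s.tick (e.cost + 1))).support,
      (s'.num 0 = s.num 0 ∧ s'.num 1 = s.num 1 ∧ s'.num 4 = s.num 4) ∧
      s'.time ≤ s.time + (e.cost + 1) + N * (1 + C * M) := by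
    intro N
    induction N with
    | zero =>
      intro s' hs'
      simp only [iterRounds, PMF.support_pure, Set.mem_singleton_iff] at hs'
      subst hs'
      exact ⟨⟨rfl, rfl, rfl⟩, by simp [Store.tick]⟩
    | succ N ih =>
      intro s' hs'
      simp only [iterRounds, PMF.mem_support_bind_iff] at hs'
      obtain ⟨s₁, hs₁, hs'⟩ := hs'
      obtain ⟨⟨h0, h1, h4⟩, ht⟩ := ih s₁ hs₁
      have e0 : ((s₁.setNum x N).tick 1).num 0 = s.num 0 := by simp [hx.1.symm, h0]
      have e1 : ((s₁.setNum x N).tick 1).num 1 = s.num 1 := by simp [hx.2.1.symm, h1]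
      have e4 : ((s₁.setNum x N).tick 1).num 4 = s.num 4 := by simp [hx.2.2.symm, h4]
      have et : ((s₁.setNum x N).tick 1).time = s₁.time + 1 := rfl
      obtain ⟨⟨h0', h1', h4'⟩, ht'⟩ := hC δ ((s₁.setNum x N).tick 1)
        (e0 ▸ hn) (e1 ▸ hm) (e4 ▸ hT) s' hs'
      rw [e0, e1, e4, et, ← hMdef] at ht'
      refine ⟨⟨h0'.trans e0, h1'.trans e1, h4'.trans e4⟩, ?_⟩
      rw [add_mul]
      omega
  obtain ⟨h1, h2⟩ := key _ s' hs'
  refine ⟨h1, h2.trans ?_⟩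
  rw [add_assoc]
  refine Nat.add_le_add_left ?_ _
  calc e.cost + 1 + e.eval s * (1 + C * M)
      ≤ (e.cost + 1) * (M * M') + (d * M') * (M + C * M) :=
        Nat.add_le_add (Nat.le_mul_of_pos_right _ (Nat.mul_pos hM hM'))
          (Nat.mul_le_mul he' (Nat.add_le_add_right hM _))
    _ = (e.cost + 1 + d * (1 + C)) * (M * M') := by ring

theorem takes_loop_n {x : ℕ} {p : Prog} (hx : x ≠ 0 ∧ x ≠ 1 ∧ x ≠ 4) (hp : Takes p a b c) :
    Takes (.loop x (.var 0) p) (a + 1) b c :=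
  takes_loop (a' := 1) (b' := 0) (c' := 0) hx 1 (fun s _ _ _ => by simp) hp

theorem takes_loop_succ_n {x : ℕ} {p : Prog} (hx : x ≠ 0 ∧ x ≠ 1 ∧ x ≠ 4) (hp : Takes p a b c) :
    Takes (.loop x (.add (.var 0) (.lit 1)) p) (a + 1) b c :=
  takes_loop (a' := 1) (b' := 0) (c' := 0) hx 2 (fun s _ _ _ => by simp; omega) hp

theorem takes_loop_m {x : ℕ} {p : Prog} (hx : x ≠ 0 ∧ x ≠ 1 ∧ x ≠ 4) (hp : Takes p a b c) :
    Takes (.loop x (.var 1) p) a (b + 1) c :=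
  takes_loop (a' := 0) (b' := 1) (c' := 0) hx 1 (fun s _ _ _ => by simp) hp

theorem takes_loop_T {x : ℕ} {p : Prog} (hx : x ≠ 0 ∧ x ≠ 1 ∧ x ≠ 4) (hp : Takes p a b c) :
    Takes (.loop x (.var 4) p) a b (c + 1) :=
  takes_loop (a' := 0) (b' := 0) (c' := 1) hx 1 (fun s _ _ _ => by simp) hp

/-- A shuffle of at most `n` objects. -/
theorem takes_shuffle {x y : ℕ} :
    Takes (.ite (.lt (.var y) (.add (.var 0) (.lit 1))) (.shuffle x (.var y)) .skip) (a + 1) b c := by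
  refine ⟨9, fun δ s hn hm hT s' hs' => ?_⟩
  have h1 : s.num 0 ≤ s.num 0 ^ (a + 1) * s.num 1 ^ b * s.num 4 ^ c := by
    have := one_le_monomial (a := a) (b := b) (c := c) hn hm hT
    calc s.num 0 ≤ s.num 0 * (s.num 0 ^ a * s.num 1 ^ b * s.num 4 ^ c) :=
          Nat.le_mul_of_pos_right _ this
      _ = _ := by ring
  -- The guard bounds the cost of the shuffle in every store, without knowing that the variable
  -- holds |U|.
  by_cases h : s.num y < s.num 0 + 1
  · rw [Prog.exec_ite_pos δ s _ _ (by simpa using h), Prog.exec, PMF.mem_support_map_iff] at hs'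
    obtain ⟨σ, -, rfl⟩ := hs'
    refine ⟨⟨rfl, rfl, rfl⟩, ?_⟩
    simp only [Store.tick, Test.cost, NatExpr.cost, NatExpr.eval]
    omega
  · rw [Prog.exec_ite_neg δ s _ _ (by simpa using h), Prog.exec, PMF.support_pure,
      Set.mem_singleton_iff] at hs'
    subst hs'
    refine ⟨⟨rfl, rfl, rfl⟩, ?_⟩
    simp only [Store.tick, Test.cost, NatExpr.cost]
    omega

end Takes


/-! ## The program

Number variables: `0, …, 4` input, `6` the size of `U`, `7`, `8` the bounds `Δ₁`, `Δ₂`, `9` whether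
a feasible set was found, `14` the radius; the others are local. Arrays: `0, 1, 2` input, `3` output,
`4` marks, `5` membership in `U`, `6` the list of `U`, `7` permutation, `8` distances (plus one),
`9` queue, `10` cells, `11` clusters, `12` colors assigned to the clusters, `13` their numbers,
`14` and `15` the time and the point at which the search reached a color. Objects that may be absent
are stored plus one. -/

infixr:60 " ;; " => Prog.seq

/-- Greedy pruning in the order of the numbers of the points. -/
def pruneProg : Prog :=
  .loop 10 (.var 0) (.ite (.eq (.get 4 (.var 10)) (.lit 0))
    (.setArr 5 (.var 10) (.lit 1) ;; .setArr 6 (.var 6) (.var 10) ;;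
      .setNum 6 (.add (.var 6) (.lit 1)) ;;
      .loop 11 (.var 0)
        (.ite (.conj (.eq (.get 0 (.var 11)) (.get 0 (.var 10)))
            (.ltReal (.dist (.var 11) (.var 10)) (.var 0)))
          (.setArr 4 (.var 11) (.lit 1)) .skip)) .skip)

/-- Round the real variable `x` down, if it is at most `m`. -/
def floorProg (x y : ℕ) : Prog :=
  .setNum y (.lit 0) ;;
  .loop 10 (.var 1) (.ite (.ltReal (.var x) (.ofNat (.add (.var 10) (.lit 1)))) .skip
    (.setNum y (.add (.var 10) (.lit 1))))

/-- Compute `Δ₁`, `Δ₂` and the threshold `γ₂ * α`. -/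
def radiiProg : Prog :=
  .setReal 4 (.div (.sqrt (.log (.ofNat (.var 1)))) (.ofNat (.var 1))) ;;
  .setReal 2 (.div (.ofNat (.lit 1)) (.mul (.ofNat (.lit 4)) (.var 4))) ;;
  floorProg 2 7 ;;
  .ite (.eq (.var 7) (.lit 0)) (.setNum 7 (.lit 1)) .skip ;;
  .setReal 2 (.div (.ofNat (.lit 1)) (.mul (.ofNat (.lit 2)) (.var 4))) ;;
  floorProg 2 8 ;;
  .ite (.lt (.var 8) (.var 7)) (.setNum 8 (.var 7)) .skip ;;
  .setReal 3 (.mul (.var 1) (.var 4))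

section Prune

/-- The state of the greedy pruning after the first `i` points. -/
structure PruneInv (δ : ℕ → ℕ → ℝ) (γ : ℝ) (n : ℕ) (col : ℕ → ℕ) (i : ℕ) (s : Store) : Prop where
  marked : ∀ w < n, s.arr 4 w ≠ 0 ↔ ∃ v < i, s.arr 5 v ≠ 0 ∧ col w = col v ∧ δ w v < γ
  chosen : ∀ v < i, s.arr 5 v ≠ 0 ↔ ¬ ∃ w < v, s.arr 5 w ≠ 0 ∧ col v = col w ∧ δ v w < γ
  rest : ∀ v, i ≤ v → s.arr 5 v = 0
  list_mem : ∀ t < s.num 6, s.arr 6 t < i ∧ s.arr 5 (s.arr 6 t) ≠ 0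
  list_inj : ∀ t < s.num 6, ∀ t' < s.num 6, s.arr 6 t = s.arr 6 t' → t = t'
  list_surj : ∀ v < i, s.arr 5 v ≠ 0 → ∃ t < s.num 6, s.arr 6 t = v

/-- All colors can be treated in a single pass, because a selected point marks only points of its
own color. The field `chosen` describes the selection recursively: a point is taken unless an
earlier selected point of its color is close. -/
theorem pruneProg_run {δ : ℕ → ℕ → ℝ} {s : Store} (h4 : ∀ i, s.arr 4 i = 0)
    (h5 : ∀ i, s.arr 5 i = 0) (h6 : s.num 6 = 0) :
    PruneInv δ (s.real 0) (s.num 0) (s.arr 0) (s.num 0) (pruneProg.run δ s) := by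
  refine Prog.run_loop (fun i s' => PruneInv δ (s.real 0) (s.num 0) (s.arr 0) i s') (s.num 0) rfl
    ?_ ?_
  · constructor <;> simp [h4, h5, h6]
  · intro i hi s' hF hI
    have e0 : s'.num 0 = s.num 0 := hF.num 0 rfl
    have ea : s'.arr 0 = s.arr 0 := hF.arr 0 rfl
    have er : s'.real 0 = s.real 0 := hF.real 0 rfl
    have hmi := hI.marked i hi
    by_cases hm : s'.arr 4 i = 0
    · rw [Prog.run_ite_pos _ _ _ _ (by simpa using hm)]
      simp only [Prog.run_seq]
      generalize hs1 : Prog.run δ (.setNum 6 (.add (.var 6) (.lit 1))) _ = s1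
      have f4 : s1.arr 4 = s'.arr 4 := by rw [← hs1]; simp
      have f5 : s1.arr 5 = Function.update (s'.arr 5) i 1 := by rw [← hs1]; simp
      have f6 : s1.arr 6 = Function.update (s'.arr 6) (s'.num 6) i := by rw [← hs1]; simp
      have g6 : s1.num 6 = s'.num 6 + 1 := by rw [← hs1]; simp
      have g10 : s1.num 10 = i := by rw [← hs1]; simp
      have g0 : s1.num 0 = s.num 0 := by rw [← hs1]; simp [e0]
      have ga : s1.arr 0 = s.arr 0 := by rw [← hs1]; simp [ea]
      have gr : s1.real 0 = s.real 0 := by rw [← hs1]; simp [er]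
      clear hs1
      have hnot : ¬ ∃ w < i, s'.arr 5 w ≠ 0 ∧ s.arr 0 i = s.arr 0 w ∧ δ i w < s.real 0 :=
        fun h => (hmi.2 h) hm
      have hinner := Prog.run_loop (δ := δ) (x := 11) (e := .var 0)
        (p := .ite (.conj (.eq (.get 0 (.var 11)) (.get 0 (.var 10)))
            (.ltReal (.dist (.var 11) (.var 10)) (.var 0)))
          (.setArr 4 (.var 11) (.lit 1)) .skip) (s := s1)
        (fun j s2 => ∀ x, s2.arr 4 x ≠ 0 ↔
          s1.arr 4 x ≠ 0 ∨ (x < j ∧ s.arr 0 x = s.arr 0 i ∧ δ x i < s.real 0)) (s.num 0) g0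
        (by simp) (by
          intro j hj s2 hF2 hI2
          have a0 : s2.arr 0 = s.arr 0 := (hF2.arr 0 rfl).trans ga
          have a10 : s2.num 10 = i := (hF2.num 10 rfl).trans g10
          have ar : s2.real 0 = s.real 0 := (hF2.real 0 rfl).trans gr
          by_cases hc : s.arr 0 j = s.arr 0 i ∧ δ j i < s.real 0
          · rw [Prog.run_ite_pos _ _ _ _ (by simpa [a0, a10, ar] using hc)]
            intro x
            by_cases hx : x = j
            · subst hx; simp [hc]
            · have : x < j + 1 ↔ x < j := by omega
              simp [hx, hI2 x, this]
          · rw [Prog.run_ite_neg _ _ _ _ (by simpa [a0, a10, ar] using hc)]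
            intro x
            by_cases hx : x = j
            · subst hx; simp only [Prog.run_skip, Store.tick_arr, Store.setNum_arr, hI2 x]
              tauto
            · have : x < j + 1 ↔ x < j := by omega
              simp [hI2 x, this])
      have hF3 := Prog.frame δ (.loop 11 (.var 0)
        (.ite (.conj (.eq (.get 0 (.var 11)) (.get 0 (.var 10)))
            (.ltReal (.dist (.var 11) (.var 10)) (.var 0)))
          (.setArr 4 (.var 11) (.lit 1)) .skip)) s1
      generalize Prog.run δ (.loop 11 _ _) s1 = s3 at hinner hF3 ⊢
      have k5 := (hF3.arr 5 rfl).trans f5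
      have k6 := (hF3.arr 6 rfl).trans f6
      have kn := (hF3.num 6 rfl).trans g6
      have hold : ∀ w < i, s3.arr 5 w = s'.arr 5 w := fun w hw => by
        rw [k5, Function.update_of_ne (by omega)]
      have hnew : s3.arr 5 i ≠ 0 := by rw [k5]; simp
      constructor
      · intro w hw
        rw [hinner w, f4, hI.marked w hw]
        constructor
        · rintro (⟨v, hv, hv5, h⟩ | ⟨-, h⟩)
          · exact ⟨v, by omega, by rw [hold v hv]; exact hv5, h⟩
          · exact ⟨i, by omega, hnew, h⟩
        · rintro ⟨v, hv, hv5, h⟩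
          rcases Nat.lt_succ_iff_lt_or_eq.1 hv with hv' | rfl
          · exact Or.inl ⟨v, hv', by rwa [hold v hv'] at hv5, h⟩
          · exact Or.inr ⟨hw, h⟩
      · intro v hv
        have hex : (∃ w < v, s3.arr 5 w ≠ 0 ∧ s.arr 0 v = s.arr 0 w ∧ δ v w < s.real 0) ↔
            ∃ w < v, s'.arr 5 w ≠ 0 ∧ s.arr 0 v = s.arr 0 w ∧ δ v w < s.real 0 := by
          refine exists_congr fun w => and_congr_right fun hw => ?_
          rw [hold w (by omega)]
        rw [hex]
        rcases Nat.lt_succ_iff_lt_or_eq.1 hv with hv' | rfl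
        · rw [hold v hv']
          exact hI.chosen v hv'
        · exact iff_of_true hnew hnot
      · intro v hv
        rw [k5, Function.update_of_ne (by omega)]
        exact hI.rest v (by omega)
      · intro t ht
        rw [kn] at ht
        rcases Nat.lt_succ_iff_lt_or_eq.1 ht with ht' | rfl
        · rw [k6, Function.update_of_ne (by omega)]
          have := hI.list_mem t ht'
          exact ⟨by omega, by rw [hold _ this.1]; exact this.2⟩
        · rw [k6, Function.update_self]
          exact ⟨by omega, hnew⟩
      · intro t ht t' ht' h
        rw [kn] at ht ht'
        rw [k6] at h
        rcases Nat.lt_succ_iff_lt_or_eq.1 ht with h1 | rfl <;>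
          rcases Nat.lt_succ_iff_lt_or_eq.1 ht' with h2 | rfl
        · rw [Function.update_of_ne (by omega), Function.update_of_ne (by omega)] at h
          exact hI.list_inj t h1 t' h2 h
        · rw [Function.update_of_ne (by omega), Function.update_self] at h
          have := (hI.list_mem t h1).1
          omega
        · rw [Function.update_self, Function.update_of_ne (by omega)] at h
          have := (hI.list_mem t' h2).1
          omega
        · rfl
      · intro v hv hv5
        rcases Nat.lt_succ_iff_lt_or_eq.1 hv with hv' | rfl
        · rw [hold v hv'] at hv5
          obtain ⟨t, ht, htv⟩ := hI.list_surj v hv' hv5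
          exact ⟨t, by omega, by rw [k6, Function.update_of_ne (by omega), htv]⟩
        · exact ⟨s'.num 6, by omega, by rw [k6, Function.update_self]⟩
    · rw [Prog.run_ite_neg _ _ _ _ (by simpa using hm)]
      have hi0 : s'.arr 5 i = 0 := hI.rest i le_rfl
      constructor
      · intro w hw
        simp only [Prog.run_skip, Store.tick_arr, Store.setNum_arr]
        rw [hI.marked w hw]
        constructor
        · rintro ⟨v, hv, h⟩; exact ⟨v, by omega, h⟩
        · rintro ⟨v, hv, hv5, h⟩
          rcases Nat.lt_succ_iff_lt_or_eq.1 hv with hv' | rfl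
          · exact ⟨v, hv', hv5, h⟩
          · exact absurd hi0 hv5
      · intro v hv
        simp only [Prog.run_skip, Store.tick_arr, Store.setNum_arr]
        rcases Nat.lt_succ_iff_lt_or_eq.1 hv with hv' | rfl
        · exact hI.chosen v hv'
        · exact iff_of_false (fun h => h hi0) (fun h => h (hmi.1 hm))
      · intro v hv
        exact hI.rest v (by omega)
      · intro t ht
        have := hI.list_mem t ht
        exact ⟨Nat.lt_succ_of_lt this.1, this.2⟩
      · exact hI.list_inj
      · intro v hv hv5
        rcases Nat.lt_succ_iff_lt_or_eq.1 hv with hv' | rfl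
        · exact hI.list_surj v hv' hv5
        · exact absurd hi0 hv5

end Prune

/-! ### The radii -/

/-- The machine cannot round, so it counts upwards: after i rounds the variable holds min(i, ⌊x⌋).
Running m rounds is enough by `hle`. -/
theorem floorProg_run {δ : ℕ → ℕ → ℝ} {s : Store} {x y : ℕ} (hy : y ≠ 10 ∧ y ≠ 1)
    (hx : 0 ≤ s.real x) (hle : ⌊s.real x⌋₊ ≤ s.num 1) :
    ((floorProg x y).run δ s).num y = ⌊s.real x⌋₊ := by
  have := Prog.run_loop (δ := δ) (x := 10) (e := .var 1)
    (p := .ite (.ltReal (.var x) (.ofNat (.add (.var 10) (.lit 1)))) .skip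
      (.setNum y (.add (.var 10) (.lit 1)))) (s := Prog.run δ (.setNum y (.lit 0)) s)
    (fun i s' => s'.num y = min i ⌊s.real x⌋₊) (s.num 1) (by simp [hy.2.symm]) (by simp) (by
      intro i hi s' hF hI
      have er : s'.real x = s.real x := hF.real x rfl
      by_cases h : s.real x < (i : ℝ) + 1
      · rw [Prog.run_ite_pos _ _ _ _ (by simpa [er] using h)]
        have : ⌊s.real x⌋₊ < i + 1 := (Nat.floor_lt hx).2 (by push_cast; exact h)
        simp only [Prog.run_skip, Store.tick_num, Store.setNum_num, if_neg hy.1, hI]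
        omega
      · rw [Prog.run_ite_neg _ _ _ _ (by simpa [er] using h)]
        have : i + 1 ≤ ⌊s.real x⌋₊ := Nat.le_floor (by push_cast; exact not_lt.1 h)
        simp [this])
  rw [min_eq_right hle] at this
  exact this

/-- 1/(cα) = m/(c√(log m)), and √(log m) ≥ 1/2 for m ≥ 2. For m < 2 the quotient by zero counts as
0. -/
theorem floor_le_self {m : ℕ} {c : ℝ} (hc : 2 ≤ c) : ⌊1 / (c * alpha m)⌋₊ ≤ m := by
  by_cases h2 : 2 ≤ m
  · refine Nat.floor_le_of_le ?_
    have hs := sqrt_log_pos h2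
    have : (1 / 2 : ℝ) ≤ Real.sqrt (Real.log m) := by
      apply Real.le_sqrt_of_sq_le
      have h3 : Real.log 2 ≤ Real.log m := Real.log_le_log (by norm_num) (by exact_mod_cast h2)
      have := Real.log_two_gt_d9
      norm_num at *
      linarith
    have hm' : (0 : ℝ) < m := by positivity
    have hα := alpha_pos h2
    rw [div_le_iff₀ (by positivity), alpha]
    field_simp
    nlinarith
  · simp [alpha_eq_zero (not_le.1 h2)]

/-- The two conditional assignments compute the maxima in Δ₁ and Δ₂. Division by zero for m = 1
gives 0 on the machine as in the definitions, so this case needs no special treatment. -/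
theorem radiiProg_run {δ : ℕ → ℕ → ℝ} {s : Store} :
    (radiiProg.run δ s).num 7 = Δ₁ (s.num 1) ∧ (radiiProg.run δ s).num 8 = Δ₂ (s.num 1) ∧
    (radiiProg.run δ s).real 3 = s.real 1 * alpha (s.num 1) := by
  have hα := alpha_nonneg (s.num 1)
  unfold radiiProg
  simp only [Prog.run_seq]
  generalize h1 : Prog.run δ (.setReal 2 (.div (.ofNat (.lit 1)) (.mul (.ofNat (.lit 4)) (.var 4))))
    _ = s1
  have a2 : s1.real 2 = 1 / (4 * alpha (s.num 1)) := by rw [← h1]; simp [alpha]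
  have a4 : s1.real 4 = alpha (s.num 1) := by rw [← h1]; simp [alpha]
  have a1 : s1.real 1 = s.real 1 := by rw [← h1]; simp
  have an : s1.num 1 = s.num 1 := by rw [← h1]; simp
  clear h1
  have b7 := floorProg_run (δ := δ) (s := s1) (x := 2) (y := 7) (by decide)
    (by rw [a2]; positivity) (by rw [a2, an]; exact floor_le_self (by norm_num))
  have hF := Prog.frame δ (floorProg 2 7) s1
  generalize Prog.run δ (floorProg 2 7) s1 = s2 at b7 hF ⊢
  have b4 := (hF.real 4 rfl).trans a4
  have b1 := (hF.real 1 rfl).trans a1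
  have bn := (hF.num 1 rfl).trans an
  rw [a2] at b7
  clear hF
  have c7 : ((Prog.ite (.eq (.var 7) (.lit 0)) (.setNum 7 (.lit 1)) .skip).run δ s2).num 7 =
      Δ₁ (s.num 1) := by
    rw [Δ₁]
    by_cases h : s2.num 7 = 0
    · rw [Prog.run_ite_pos _ _ _ _ (by simpa using h)]
      rw [b7] at h
      rw [h]
      simp
    · rw [Prog.run_ite_neg _ _ _ _ (by simpa using h)]
      rw [b7] at h
      simp only [Prog.run_skip, Store.tick_num, b7]
      omega
  have hF := Prog.frame δ (.ite (.eq (.var 7) (.lit 0)) (.setNum 7 (.lit 1)) .skip) s2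
  generalize Prog.run δ (.ite (.eq (.var 7) (.lit 0)) (.setNum 7 (.lit 1)) .skip) s2 = s3
    at c7 hF ⊢
  have c4 := (hF.real 4 rfl).trans b4
  have c1 := (hF.real 1 rfl).trans b1
  have cn := (hF.num 1 rfl).trans bn
  clear hF
  generalize h1 : Prog.run δ (.setReal 2 (.div (.ofNat (.lit 1)) (.mul (.ofNat (.lit 2)) (.var 4))))
    s3 = s4
  have d2 : s4.real 2 = 1 / (2 * alpha (s.num 1)) := by rw [← h1]; simp [c4]
  have d4 : s4.real 4 = alpha (s.num 1) := by rw [← h1]; simp [c4]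
  have d1 : s4.real 1 = s.real 1 := by rw [← h1]; simp [c1]
  have dn : s4.num 1 = s.num 1 := by rw [← h1]; simp [cn]
  have d7 : s4.num 7 = Δ₁ (s.num 1) := by rw [← h1]; simp [c7]
  clear h1
  have e8 := floorProg_run (δ := δ) (s := s4) (x := 2) (y := 8) (by decide)
    (by rw [d2]; positivity) (by rw [d2, dn]; exact floor_le_self le_rfl)
  have hF := Prog.frame δ (floorProg 2 8) s4
  generalize Prog.run δ (floorProg 2 8) s4 = s5 at e8 hF ⊢
  have e4 := (hF.real 4 rfl).trans d4
  have e1 := (hF.real 1 rfl).trans d1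
  have e7 := (hF.num 7 rfl).trans d7
  rw [d2] at e8
  clear hF
  by_cases h : s5.num 8 < s5.num 7
  · rw [Prog.run_ite_pos _ _ _ _ (by simpa using h)]
    rw [e8, e7] at h
    rw [Δ₂, max_eq_right h.le]
    simp [e7, e4, e1]
  · rw [Prog.run_ite_neg _ _ _ _ (by simpa using h)]
    rw [e8, e7] at h
    rw [Δ₂, max_eq_left (not_lt.1 h), ← e8]
    simp [e7, e4, e1]

/-! ### The pruned set -/

section Greedy

/-- A rule that picks the point of least number. -/
theorem exists_pick_min {V : Type u} [Fintype V] [Nonempty V] (e : V ≃ Fin (Fintype.card V)) :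
    ∃ pick : Finset V → V, (∀ A : Finset V, A.Nonempty → pick A ∈ A) ∧
      ∀ A : Finset V, ∀ v ∈ A, (e (pick A) : ℕ) ≤ e v := by
  classical
  have : ∀ A : Finset V, ∃ p, A.Nonempty → p ∈ A ∧ ∀ v ∈ A, (e p : ℕ) ≤ e v := fun A => by
    by_cases hA : A.Nonempty
    · obtain ⟨p, hp, h⟩ := A.exists_min_image (fun v => (e v : ℕ)) hA
      exact ⟨p, fun _ => ⟨hp, h⟩⟩
    · exact ⟨Classical.arbitrary V, fun h => absurd h hA⟩
  choose pick hpick using this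
  exact ⟨pick, fun A hA => (hpick A hA).1, fun A v hv => (hpick A ⟨v, hv⟩).2 v hv⟩

variable {V : Type u} [Fintype V] [MetricSpace V] {m : ℕ}

theorem distByIndex_apply (e : V ≃ Fin (Fintype.card V)) (u v : V) :
    distByIndex e (e u) (e v) = dist u v := by
  simp [distByIndex]

/-- The greedy selection is the pruned set. -/
theorem mem_prune_iff (I : Problem V m) (e : V ≃ Fin (Fintype.card V)) {γ : ℝ} (hγ : 0 < γ)
    {pick : Finset V → V} (hpick : ∀ A : Finset V, A.Nonempty → pick A ∈ A)
    (hmin : ∀ A : Finset V, ∀ v ∈ A, (e (pick A) : ℕ) ≤ e v) {sel : ℕ → ℕ}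
    (hsel : ∀ v : V, sel (e v) ≠ 0 ↔
      ¬ ∃ w : V, e w < e v ∧ sel (e w) ≠ 0 ∧ I.color v = I.color w ∧ dist v w < γ) (v : V) :
    v ∈ prune I pick γ (Fintype.card V) ↔ sel (e v) ≠ 0 := by
  obtain ⟨hsep, hcov⟩ := prune_spec I hpick (P := fun w v => (e w : ℕ) ≤ e v) hmin hγ
  suffices ∀ N, ∀ v, (e v : ℕ) = N → (v ∈ prune I pick γ (Fintype.card V) ↔ sel (e v) ≠ 0) from
    this _ v rfl
  intro N
  induction N using Nat.strong_induction_on with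
  | _ N ih =>
    intro v hv
    rw [hsel]
    constructor
    · rintro hvU ⟨w, hw, hwsel, hc, hd⟩
      have hwU := (ih (e w) (hv ▸ hw) w rfl).2 hwsel
      exact (hsep v hvU w hwU hc (fun h => by simp [h] at hw)).not_gt hd
    · intro h
      -- The pruned point `w` that covers `v` was picked no later than `v`. If it came earlier, it
      -- would be a selected point that rules out `v`; so it is `v` itself.
      obtain ⟨w, hwU, hc, hle, hd⟩ := hcov v
      rcases hle.lt_or_eq with hlt | heq
      · exact absurd ⟨w, hlt, (ih (e w) (hv ▸ hlt) w rfl).1 hwU, hc.symm, hd⟩ h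
      · obtain rfl : w = v := e.injective (Fin.ext heq)
        exact hwU

end Greedy


/-! ### Breadth first search -/

/-- An index bound that covers points, clusters and colors. -/
def boundExpr : NatExpr := .add (.add (.var 0) (.var 1)) (.lit 2)

/-- `a[i] := e`, if `i` is in the range of interest. -/
def guardedSet (a : ℕ) (i e : NatExpr) : Prog := .ite (.lt i boundExpr) (.setArr a i e) .skip

/-- `a[0], …, a[n + m + 1] := 0`. -/
def clearProg (a : ℕ) : Prog := .loop 10 boundExpr (guardedSet a (.var 10) (.lit 0))

/-- Look for unvisited neighbors of the point in variable `19`. -/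
def scanProg : Prog :=
  .loop 11 (.var 0)
    (.ite (.conj (.neg (.eq (.get 5 (.var 11)) (.lit 0)))
        (.conj (.eq (.get 8 (.var 11)) (.lit 0)) (.ltReal (.dist (.var 19) (.var 11)) (.var 3))))
      (.setArr 8 (.var 11) (.add (.get 8 (.var 19)) (.lit 1)) ;;
        .setArr 9 (.var 18) (.var 11) ;; .setNum 18 (.add (.var 18) (.lit 1)))
      .skip)

/-- Compute the distances, up to the radius, from the point in variable `16`. The queue has at most
`m` entries, because balls have at most `m` points. -/
def bfsProg : Prog :=
  .loop 10 (.var 0) (.setArr 8 (.var 10) (.lit 0)) ;;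
  .setArr 8 (.var 16) (.lit 1) ;; .setArr 9 (.lit 0) (.var 16) ;; .setNum 18 (.lit 1) ;;
  .loop 17 (.var 1) (.ite (.lt (.var 17) (.var 18))
    (.setNum 19 (.get 9 (.var 17)) ;;
      .ite (.lt (.get 8 (.var 19)) (.add (.var 14) (.lit 1))) scanProg .skip)
    .skip)

/-- `E` gives the distances from `c` in the graph on numbers below `n` with adjacency `A`. -/
structure IsDistFrom (n : ℕ) (A : ℕ → ℕ → Prop) (c : ℕ) (E : ℕ → ℕ∞) : Prop where
  lt : c < n
  zero : ∀ w < n, E w = 0 ↔ w = c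
  le : ∀ v < n, ∀ w < n, A v w → E w ≤ E v + 1
  exists_pred : ∀ w < n, ∀ d : ℕ, E w = ((d + 1 : ℕ) : ℕ∞) → ∃ v < n, A v w ∧ E v = (d : ℕ∞)

/-- The state of the search when the first `h` entries of the queue `q` have been processed. The
entries of `dd` are the distances found, plus one. -/
structure BfsInv (n R c : ℕ) (A : ℕ → ℕ → Prop) (P : ℕ → Prop) (E : ℕ → ℕ∞) (h tail : ℕ)
    (dd q : ℕ → ℕ) : Prop where
  queue : ∀ t < tail, q t < n ∧ dd (q t) ≠ 0 ∧ P (q t)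
  inj : ∀ t < tail, ∀ t' < tail, q t = q t' → t = t'
  reached : ∀ w < n, dd w ≠ 0 → (∃ t < tail, q t = w) ∧ E w + 1 ≤ dd w ∧ dd w ≤ R + 1
  mono : ∀ t t', t ≤ t' → t' < tail → dd (q t) ≤ dd (q t')
  bound : h < tail → ∀ t < tail, dd (q t) ≤ dd (q h) + 1
  processed : ∀ t < h, t < tail → dd (q t) ≤ R →
    ∀ w < n, A (q t) w → dd w ≠ 0 ∧ dd w ≤ dd (q t) + 1
  start : dd c = 1

section Bfs

variable {n R c : ℕ} {A : ℕ → ℕ → Prop} {P : ℕ → Prop} {E : ℕ → ℕ∞} {h tail : ℕ} {dd q : ℕ → ℕ}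

/-- The new label exceeds that of the entry being processed by one. By `bound` no label in the queue
is larger, so appending keeps the labels monotone. -/
theorem BfsInv.push (hI : BfsInv n R c A P E h tail dd q) (hE : IsDistFrom n A c E)
    (hh : h < tail) (hd : dd (q h) ≤ R) {w : ℕ} (hw : w < n) (hP : P w) (hA : A (q h) w)
    (h0 : dd w = 0) :
    BfsInv n R c A P E h (tail + 1) (Function.update dd w (dd (q h) + 1))
      (Function.update q tail w) := by
  have hq : ∀ t < tail, Function.update q tail w t = q t := fun t ht =>
    Function.update_of_ne (by omega) _ _
  have hqw : ∀ t < tail, q t ≠ w := fun t ht e => (hI.queue t ht).2.1 (e ▸ h0)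
  have hdd : ∀ t < tail, Function.update dd w (dd (q h) + 1) (q t) = dd (q t) := fun t ht =>
    Function.update_of_ne (hqw t ht) _ _
  have hddw : ∀ x, dd x ≠ 0 → Function.update dd w (dd (q h) + 1) x = dd x := fun x hx =>
    Function.update_of_ne (fun e : x = w => hx (e ▸ h0)) _ _
  constructor
  · intro t ht
    rcases Nat.lt_succ_iff_lt_or_eq.1 ht with ht' | rfl
    · rw [hq t ht', hdd t ht']; exact hI.queue t ht'
    · simp [hw, hP]
  · intro t ht t' ht' e
    rcases Nat.lt_succ_iff_lt_or_eq.1 ht with h1 | h1 <;>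
      rcases Nat.lt_succ_iff_lt_or_eq.1 ht' with h2 | h2
    · rw [hq t h1, hq t' h2] at e; exact hI.inj t h1 t' h2 e
    · rw [hq t h1, h2, Function.update_self] at e; exact absurd e (hqw t h1)
    · rw [hq t' h2, h1, Function.update_self] at e; exact absurd e.symm (hqw t' h2)
    · rw [h1, h2]
  · intro x hx hx0
    by_cases hxw : x = w
    · subst hxw
      refine ⟨⟨tail, by omega, by simp⟩, ?_, by simp [hd]⟩
      have h1 := ((hI.reached (q h) (hI.queue h hh).1 (hI.queue h hh).2.1).2.1)
      have h2 := hE.le (q h) (hI.queue h hh).1 x hx hA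
      rw [Function.update_self, Nat.cast_add, Nat.cast_one]
      exact add_le_add_left (h2.trans h1) 1
    · rw [Function.update_of_ne hxw] at hx0 ⊢
      obtain ⟨⟨t, ht, htx⟩, h1⟩ := hI.reached x hx hx0
      exact ⟨⟨t, by omega, by rw [hq t ht, htx]⟩, h1⟩
  · intro t t' htt ht'
    rcases Nat.lt_succ_iff_lt_or_eq.1 ht' with h2 | h2
    · rw [hq t (by omega), hq t' h2, hdd t (by omega), hdd t' h2]
      exact hI.mono t t' htt h2
    · rcases Nat.lt_or_ge t tail with h1 | h1
      · rw [hq t h1, hdd t h1, h2, Function.update_self, Function.update_self]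
        exact hI.bound hh t h1
      · rw [show t = t' by omega]
  · intro _ t ht
    rw [hq h hh, hdd h hh]
    rcases Nat.lt_succ_iff_lt_or_eq.1 ht with h1 | h1
    · rw [hq t h1, hdd t h1]; exact hI.bound hh t h1
    · rw [h1, Function.update_self, Function.update_self]
  · intro t ht _ hR x hx hAx
    rw [hq t (by omega), hdd t (by omega)] at hR ⊢
    rw [hq t (by omega)] at hAx
    obtain ⟨h1, h2⟩ := hI.processed t ht (by omega) hR x hx hAx
    rw [hddw x h1]
    exact ⟨h1, h2⟩
  · rw [hddw c (by rw [hI.start]; exact one_ne_zero)]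
    exact hI.start

theorem BfsInv.next (hI : BfsInv n R c A P E h tail dd q)
    (hnew : h < tail → dd (q h) ≤ R → ∀ w < n, A (q h) w → dd w ≠ 0 ∧ dd w ≤ dd (q h) + 1) :
    BfsInv n R c A P E (h + 1) tail dd q := by
  refine ⟨hI.queue, hI.inj, hI.reached, hI.mono, ?_, ?_, hI.start⟩
  · intro hh t ht
    have h1 := hI.bound (by omega) t ht
    have h2 := hI.mono h (h + 1) (by omega) hh
    omega
  · intro t ht ht' hR
    rcases Nat.lt_succ_iff_lt_or_eq.1 ht with h1 | rfl
    · exact hI.processed t h1 ht' hR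
    · exact hnew ht' hR

open Classical in
-- Labels bound distances from above, so every queued point lies in the ball of radius R, which has
-- at most m points. Hence the queue has at most m entries and m rounds have processed all of it.
-- That all points of the ball were found, with the right labels, follows by induction on the
-- distance.
theorem BfsInv.final {m : ℕ} (hI : BfsInv n R c A P E m tail dd q) (hE : IsDistFrom n A c E)
    (hcard : ((Finset.range n).filter fun w => E w ≤ R).card ≤ m) {w : ℕ} (hw : w < n) :
    (dd w ≠ 0 ↔ E w ≤ R) ∧ (dd w ≠ 0 → E w + 1 = dd w) := by
  have hsound : ∀ x < n, dd x ≠ 0 → E x ≤ R := fun x hx hx0 => by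
    obtain ⟨-, h1, h2⟩ := hI.reached x hx hx0
    have h3 : E x + 1 ≤ (R : ℕ∞) + 1 := h1.trans (by exact_mod_cast h2)
    exact (ENat.add_le_add_iff_right (by simp)).1 h3
  have htail : tail ≤ m := by
    refine le_trans ?_ hcard
    have := Finset.card_le_card_of_injOn (s := Finset.range tail)
      (t := (Finset.range n).filter fun w => E w ≤ R) q (fun t ht => by
        have ht' := Finset.mem_range.1 (Finset.mem_coe.1 ht)
        have := hI.queue t ht'
        exact Finset.mem_coe.2 (Finset.mem_filter.2
          ⟨Finset.mem_range.2 this.1, hsound _ this.1 this.2.1⟩))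
      (fun t ht t' ht' e => hI.inj t (Finset.mem_range.1 (Finset.mem_coe.1 ht)) t'
        (Finset.mem_range.1 (Finset.mem_coe.1 ht')) e)
    simpa using this
  have hcomplete : ∀ d : ℕ, d ≤ R → ∀ x < n, E x = (d : ℕ∞) → dd x ≠ 0 ∧ dd x ≤ d + 1 := by
    intro d
    induction d with
    | zero =>
      intro _ x hx h0
      rw [(hE.zero x hx).1 (by simpa using h0), hI.start]
      simp
    | succ d ih =>
      intro hd x hx h1
      obtain ⟨v, hv, hA, hvd⟩ := hE.exists_pred x hx d h1
      obtain ⟨h2, h3⟩ := ih (by omega) v hv hvd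
      obtain ⟨⟨t, ht, rfl⟩, -⟩ := hI.reached v hv h2
      obtain ⟨h4, h5⟩ := hI.processed t (by omega) ht (by omega) x hx hA
      exact ⟨h4, by omega⟩
  have hcomplete' : E w ≤ R → dd w ≠ 0 ∧ (dd w : ℕ∞) ≤ E w + 1 := fun h => by
    obtain ⟨d, hd⟩ := ENat.ne_top_iff_exists.1 (ne_top_of_le_ne_top (ENat.natCast_ne_top R) h)
    rw [← hd, Nat.cast_le] at h
    obtain ⟨h1, h2⟩ := hcomplete d h w hw hd.symm
    refine ⟨h1, ?_⟩
    rw [← hd]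
    exact_mod_cast h2
  exact ⟨⟨hsound w hw, fun h => (hcomplete' h).1⟩, fun h =>
    le_antisymm (hI.reached w hw h).2.1 (hcomplete' (hsound w hw h)).2⟩

theorem scanProg_run {δ : ℕ → ℕ → ℝ} {s : Store} (hE : IsDistFrom (s.num 0) A c E)
    (hA : ∀ v < s.num 0, ∀ w < s.num 0,
      A v w ↔ s.arr 5 v ≠ 0 ∧ s.arr 5 w ≠ 0 ∧ δ v w < s.real 3)
    (hI : BfsInv (s.num 0) R c A (fun v => s.arr 5 v ≠ 0) E h (s.num 18) (s.arr 8) (s.arr 9))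
    (hh : h < s.num 18) (hv : s.num 19 = s.arr 9 h) (hd : s.arr 8 (s.num 19) ≤ R) :
    BfsInv (s.num 0) R c A (fun v => s.arr 5 v ≠ 0) E (h + 1) ((scanProg.run δ s).num 18)
      ((scanProg.run δ s).arr 8) ((scanProg.run δ s).arr 9) := by
  unfold scanProg
  have key := Prog.run_loop (δ := δ) (x := 11) (e := .var 0)
    (p := .ite (.conj (.neg (.eq (.get 5 (.var 11)) (.lit 0)))
        (.conj (.eq (.get 8 (.var 11)) (.lit 0)) (.ltReal (.dist (.var 19) (.var 11)) (.var 3))))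
      (.setArr 8 (.var 11) (.add (.get 8 (.var 19)) (.lit 1)) ;;
        .setArr 9 (.var 18) (.var 11) ;; .setNum 18 (.add (.var 18) (.lit 1)))
      .skip) (s := s)
    (fun j s' => BfsInv (s.num 0) R c A (fun v => s.arr 5 v ≠ 0) E h (s'.num 18) (s'.arr 8)
        (s'.arr 9) ∧ h < s'.num 18 ∧ s'.arr 9 h = s.num 19 ∧ s'.arr 8 (s.num 19) ≤ R ∧
      ∀ w < j, w < s.num 0 → A (s.num 19) w →
        s'.arr 8 w ≠ 0 ∧ s'.arr 8 w ≤ s'.arr 8 (s.num 19) + 1)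
    (s.num 0) rfl ⟨hI, hh, hv.symm, hd, by simp⟩ (by
      rintro j hj s' hF ⟨hI', hh', hv', hd', hnb⟩
      have e5 : s'.arr 5 = s.arr 5 := hF.arr 5 rfl
      have e19 : s'.num 19 = s.num 19 := hF.num 19 rfl
      have e3 : s'.real 3 = s.real 3 := hF.real 3 rfl
      have hvn : s.num 19 < s.num 0 ∧ s'.arr 8 (s.num 19) ≠ 0 ∧ s.arr 5 (s.num 19) ≠ 0 :=
        hv' ▸ hI'.queue h hh'
      by_cases hc : s.arr 5 j ≠ 0 ∧ s'.arr 8 j = 0 ∧ δ (s.num 19) j < s.real 3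
      · rw [Prog.run_ite_pos _ _ _ _ (by simpa [e5, e19, e3] using hc)]
        have hAj : A (s.num 19) j := (hA _ hvn.1 j hj).2 ⟨hvn.2.2, hc.1, hc.2.2⟩
        have hpush := hI'.push hE hh' (by rw [hv']; exact hd') hj hc.1 (by rw [hv']; exact hAj)
          hc.2.1
        rw [hv'] at hpush
        have hjv : s.num 19 ≠ j := fun e => hvn.2.1 (e ▸ hc.2.1)
        simp only [Prog.run_seq, Prog.run_setArr, Prog.run_setNum, NatExpr.eval, Store.tick_num,
          Store.tick_arr, Store.setArr_num, Store.setArr_arr, Store.setNum_num, Store.setNum_arr,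
          e19]
        simp only [Nat.reduceEqDiff, ↓reduceIte]
        refine ⟨hpush, by omega, ?_, ?_, ?_⟩
        · rw [Function.update_of_ne (by omega)]; exact hv'
        · rw [Function.update_of_ne hjv]; exact hd'
        · intro w hw hwn hAw
          rw [Function.update_of_ne hjv]
          rcases Nat.lt_succ_iff_lt_or_eq.1 hw with h1 | rfl
          · obtain ⟨h2, h3⟩ := hnb w h1 hwn hAw
            rw [Function.update_of_ne (fun e : w = j => h2 (e ▸ hc.2.1))]
            exact ⟨h2, h3⟩
          · simp
      · rw [Prog.run_ite_neg _ _ _ _ (by simpa [e5, e19, e3] using hc)]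
        simp only [Prog.run_skip, Store.tick_num, Store.tick_arr, Store.setNum_num,
          Store.setNum_arr]
        refine ⟨hI', hh', hv', hd', ?_⟩
        intro w hw hwn hAw
        rcases Nat.lt_succ_iff_lt_or_eq.1 hw with h1 | rfl
        · exact hnb w h1 hwn hAw
        · have h2 := (hA _ hvn.1 w hwn).1 hAw
          have h3 : s'.arr 8 w ≠ 0 := fun h0 => hc ⟨h2.2.1, h0, h2.2.2⟩
          -- A neighbor that already has a label sits in the queue, so `bound` limits its label.
          obtain ⟨⟨t, ht, rfl⟩, -⟩ := hI'.reached w hwn h3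
          have := hI'.bound hh' t ht
          rw [hv'] at this
          exact ⟨h3, this⟩)
  obtain ⟨hI', hh', hv', -, hnb⟩ := key
  refine hI'.next fun _ _ w hw hAw => ?_
  rw [hv'] at hAw ⊢
  exact hnb w hw hw hAw

open Classical in
theorem bfsProg_run {δ : ℕ → ℕ → ℝ} {s : Store} (hE : IsDistFrom (s.num 0) A (s.num 16) E)
    (hA : ∀ v < s.num 0, ∀ w < s.num 0,
      A v w ↔ s.arr 5 v ≠ 0 ∧ s.arr 5 w ≠ 0 ∧ δ v w < s.real 3)
    (hc : s.arr 5 (s.num 16) ≠ 0)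
    (hcard : ((Finset.range (s.num 0)).filter fun w => E w ≤ s.num 14).card ≤ s.num 1)
    {w : ℕ} (hw : w < s.num 0) :
    ((bfsProg.run δ s).arr 8 w ≠ 0 ↔ E w ≤ s.num 14) ∧
      ((bfsProg.run δ s).arr 8 w ≠ 0 → E w + 1 = (bfsProg.run δ s).arr 8 w) := by
  have hclear := Prog.run_loop (δ := δ) (x := 10) (e := .var 0)
    (p := .setArr 8 (.var 10) (.lit 0)) (s := s) (fun i s' => ∀ x < i, s'.arr 8 x = 0)
    (s.num 0) rfl (by simp) (by
      intro i hi s' hF hI x hx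
      by_cases hxi : x = i
      · simp [hxi]
      · simp [hxi, hI x (by omega)])
  have hF := Prog.frame δ (.loop 10 (.var 0) (.setArr 8 (.var 10) (.lit 0))) s
  unfold bfsProg
  simp only [Prog.run_seq]
  generalize Prog.run δ (.loop 10 (.var 0) (.setArr 8 (.var 10) (.lit 0))) s = s1 at hclear hF ⊢
  generalize hs2 : Prog.run δ (.setNum 18 (.lit 1)) _ = s2
  have a0 : s2.num 0 = s.num 0 := by rw [← hs2]; simp [hF.num 0 rfl]
  have a1 : s2.num 1 = s.num 1 := by rw [← hs2]; simp [hF.num 1 rfl]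
  have a14 : s2.num 14 = s.num 14 := by rw [← hs2]; simp [hF.num 14 rfl]
  have a18 : s2.num 18 = 1 := by rw [← hs2]; simp
  have a5 : s2.arr 5 = s.arr 5 := by rw [← hs2]; simp [hF.arr 5 rfl]
  have a3 : s2.real 3 = s.real 3 := by rw [← hs2]; simp [hF.real 3 rfl]
  have a8 : s2.arr 8 = Function.update (s1.arr 8) (s.num 16) 1 := by
    rw [← hs2]; simp [hF.num 16 rfl]
  have a9 : s2.arr 9 0 = s.num 16 := by rw [← hs2]; simp [hF.num 16 rfl]
  clear hs2 hF
  have hc0 : ∀ x < s.num 0, x ≠ s.num 16 → s2.arr 8 x = 0 := fun x hx hne => by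
    rw [a8, Function.update_of_ne hne]; exact hclear x hx
  have hc1 : s2.arr 8 (s.num 16) = 1 := by rw [a8, Function.update_self]
  have key := Prog.run_loop (δ := δ) (x := 17) (e := .var 1)
    (p := .ite (.lt (.var 17) (.var 18))
      (.setNum 19 (.get 9 (.var 17)) ;;
        .ite (.lt (.get 8 (.var 19)) (.add (.var 14) (.lit 1))) scanProg .skip)
      .skip) (s := s2)
    (fun i s' => BfsInv (s.num 0) (s.num 14) (s.num 16) A (fun v => s.arr 5 v ≠ 0) E i (s'.num 18)
      (s'.arr 8) (s'.arr 9)) (s.num 1) a1 (by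
      simp only [Store.tick_num, Store.tick_arr, a18]
      refine ⟨?_, ?_, ?_, ?_, ?_, ?_, hc1⟩
      · intro t ht
        obtain rfl : t = 0 := by omega
        rw [a9, hc1]
        exact ⟨hE.lt, one_ne_zero, hc⟩
      · intro t ht t' ht' _; omega
      · intro x hx hx0
        have hxc : x = s.num 16 := by
          by_contra hne; exact hx0 (hc0 x hx hne)
        refine ⟨⟨0, one_pos, by rw [a9, hxc]⟩, ?_, ?_⟩
        · rw [hxc, hc1, (hE.zero _ hE.lt).2 rfl]; simp
        · rw [hxc, hc1]; omega
      · intro t t' htt ht'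
        rw [show t = t' by omega]
      · intro _ t ht
        rw [show t = 0 by omega]; omega
      · intro t ht; omega) (by
      intro i hi s' hF hI
      have b0 : s'.num 0 = s.num 0 := (hF.num 0 rfl).trans a0
      have b14 : s'.num 14 = s.num 14 := (hF.num 14 rfl).trans a14
      have b5 : s'.arr 5 = s.arr 5 := (hF.arr 5 rfl).trans a5
      have b3 : s'.real 3 = s.real 3 := (hF.real 3 rfl).trans a3
      by_cases h1 : i < s'.num 18
      · rw [Prog.run_ite_pos _ _ _ _ (by simpa using h1), Prog.run_seq]
        generalize hs3 : Prog.run δ (.setNum 19 (.get 9 (.var 17))) _ = s3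
        have c0 : s3.num 0 = s.num 0 := by rw [← hs3]; simp [b0]
        have c14 : s3.num 14 = s.num 14 := by rw [← hs3]; simp [b14]
        have c5 : s3.arr 5 = s.arr 5 := by rw [← hs3]; simp [b5]
        have c3 : s3.real 3 = s.real 3 := by rw [← hs3]; simp [b3]
        have c18 : s3.num 18 = s'.num 18 := by rw [← hs3]; simp
        have c19 : s3.num 19 = s'.arr 9 i := by rw [← hs3]; simp
        have c8 : s3.arr 8 = s'.arr 8 := by rw [← hs3]; simp
        have c9 : s3.arr 9 = s'.arr 9 := by rw [← hs3]; simp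
        clear hs3
        by_cases h2 : s3.arr 8 (s3.num 19) < s.num 14 + 1
        · rw [Prog.run_ite_pos _ _ _ _ (by simpa [c14] using h2)]
          have := scanProg_run (R := s.num 14) (h := i) (δ := δ) (s := s3.tick
            ((Test.lt (.get 8 (.var 19)) (.add (.var 14) (.lit 1))).cost + 1)) (A := A) (E := E)
            (c := s.num 16)
            (by simpa [c0] using hE) (by simpa [c0, c5, c3] using hA)
            (by simpa [c0, c5, c18, c8, c9] using hI) (by simpa [c18] using h1)
            (by simp [c19, c9]) (by simp only [Store.tick_arr, Store.tick_num]; omega)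
          simpa [c0, c5] using this
        -- The label of this entry exceeds R, so `processed` demands nothing of it and it need not
        -- be expanded.
        · rw [Prog.run_ite_neg _ _ _ _ (by simpa [c14] using h2)]
          simp only [Prog.run_skip, Store.tick_num, Store.tick_arr, c18, c8, c9]
          rw [c8, c19] at h2
          exact hI.next fun _ h3 => absurd h3 (by omega)
      · rw [Prog.run_ite_neg _ _ _ _ (by simpa using h1)]
        simp only [Prog.run_skip, Store.tick_num, Store.tick_arr, Store.setNum_num,
          Store.setNum_arr]
        exact hI.next fun h2 => absurd h2 (by simpa using h1))
  exact key.final hE hcard hw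

end Bfs


/-! ### The clusters -/

/-- Give the unclaimed points of the ball just computed to the center of number `15`. -/
def claimProg : Prog :=
  .loop 10 (.var 0)
    (.ite (.conj (.neg (.eq (.get 8 (.var 10)) (.lit 0))) (.eq (.get 10 (.var 10)) (.lit 0)))
      (.setArr 10 (.var 10) (.lit 1) ;;
        .ite (.lt (.get 8 (.var 10)) (.add (.var 14) (.lit 1)))
          (.setArr 11 (.var 10) (.add (.var 15) (.lit 1))) .skip)
      .skip)

/-- Treat the center of number `15`. -/
def centerProg : Prog := .setNum 16 (.get 6 (.get 7 (.var 15))) ;; bfsProg ;; claimProg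

/-- Compute the clusters for the permutation in array `7` and the radius in variable `14`. -/
def decomposeProg : Prog :=
  .loop 10 (.var 0) (.setArr 10 (.var 10) (.lit 0) ;; .setArr 11 (.var 10) (.lit 0)) ;;
  .loop 15 (.var 0) (.ite (.lt (.var 15) (.var 6))
    centerProg .skip)

/-- Array 10 records that a point belongs to some cell, array 11 the number of its cluster. Points
at distance exactly R have label R + 1; they are claimed without entering a cluster. -/
theorem claimProg_run {δ : ℕ → ℕ → ℝ} {s : Store} :
    (∀ v < s.num 0, ((claimProg.run δ s).arr 10 v ≠ 0 ↔ s.arr 10 v ≠ 0 ∨ s.arr 8 v ≠ 0) ∧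
      ((s.arr 8 v ≠ 0 ∧ s.arr 10 v = 0 ∧ s.arr 8 v ≤ s.num 14) →
        (claimProg.run δ s).arr 11 v = s.num 15 + 1) ∧
      (¬ (s.arr 8 v ≠ 0 ∧ s.arr 10 v = 0 ∧ s.arr 8 v ≤ s.num 14) →
        (claimProg.run δ s).arr 11 v = s.arr 11 v)) ∧
    ∀ v, s.num 0 ≤ v → (claimProg.run δ s).arr 11 v = s.arr 11 v := by
  have key := Prog.run_loop (δ := δ) (x := 10) (e := .var 0)
    (p := .ite (.conj (.neg (.eq (.get 8 (.var 10)) (.lit 0))) (.eq (.get 10 (.var 10)) (.lit 0)))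
      (.setArr 10 (.var 10) (.lit 1) ;;
        .ite (.lt (.get 8 (.var 10)) (.add (.var 14) (.lit 1)))
          (.setArr 11 (.var 10) (.add (.var 15) (.lit 1))) .skip)
      .skip) (s := s)
    (fun i s' => (∀ v < i, (s'.arr 10 v ≠ 0 ↔ s.arr 10 v ≠ 0 ∨ s.arr 8 v ≠ 0) ∧
      ((s.arr 8 v ≠ 0 ∧ s.arr 10 v = 0 ∧ s.arr 8 v ≤ s.num 14) → s'.arr 11 v = s.num 15 + 1) ∧
      (¬ (s.arr 8 v ≠ 0 ∧ s.arr 10 v = 0 ∧ s.arr 8 v ≤ s.num 14) → s'.arr 11 v = s.arr 11 v)) ∧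
      ∀ v, i ≤ v → s'.arr 10 v = s.arr 10 v ∧ s'.arr 11 v = s.arr 11 v)
    (s.num 0) rfl (by simp) (by
      intro i hi s' hF ⟨hI1, hI2⟩
      have e8 : s'.arr 8 = s.arr 8 := hF.arr 8 rfl
      have e14 : s'.num 14 = s.num 14 := hF.num 14 rfl
      have e15 : s'.num 15 = s.num 15 := hF.num 15 rfl
      obtain ⟨hi10, hi11⟩ := hI2 i le_rfl
      by_cases hc : s.arr 8 i ≠ 0 ∧ s.arr 10 i = 0
      · rw [Prog.run_ite_pos _ _ _ _ (by simpa [e8, hi10] using hc), Prog.run_seq]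
        by_cases hd : s.arr 8 i < s.num 14 + 1
        · rw [Prog.run_ite_pos _ _ _ _ (by simpa [e8, e14] using hd)]
          refine ⟨fun v hv => ?_, fun v hv => ?_⟩
          · by_cases hvi : v = i
            · subst hvi
              simp [hc, e15, Nat.lt_succ_iff.1 hd]
            · simpa [hvi] using hI1 v (by omega)
          · have hvi : v ≠ i := by omega
            simpa [hvi] using hI2 v (by omega)
        · rw [Prog.run_ite_neg _ _ _ _ (by simpa [e8, e14] using hd)]
          refine ⟨fun v hv => ?_, fun v hv => ?_⟩
          · by_cases hvi : v = i
            · subst hvi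
              have : ¬ s.arr 8 v ≤ s.num 14 := by omega
              simp [hc, hi11, this]
            · simpa [hvi] using hI1 v (by omega)
          · have hvi : v ≠ i := by omega
            simpa [hvi] using hI2 v (by omega)
      · rw [Prog.run_ite_neg _ _ _ _ (by simpa [e8, hi10] using hc)]
        refine ⟨fun v hv => ?_, fun v hv => hI2 v (by omega)⟩
        simp only [Prog.run_skip, Store.tick_arr, Store.setNum_arr]
        rcases Nat.lt_succ_iff_lt_or_eq.1 hv with h | rfl
        · exact hI1 v h
        · rw [hi10, hi11]
          refine ⟨?_, fun h => absurd ⟨h.1, h.2.1⟩ hc, fun _ => rfl⟩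
          constructor
          · exact Or.inl
          · rintro (h | h)
            · exact h
            · exact fun h0 => hc ⟨h, h0⟩)
  exact ⟨key.1, fun v hv => (key.2 v hv).2⟩

open Classical in
theorem centerProg_run {δ : ℕ → ℕ → ℝ} {s : Store} {A : ℕ → ℕ → Prop} {E : ℕ → ℕ∞}
    (hE : IsDistFrom (s.num 0) A (s.arr 6 (s.arr 7 (s.num 15))) E)
    (hA : ∀ v < s.num 0, ∀ w < s.num 0,
      A v w ↔ s.arr 5 v ≠ 0 ∧ s.arr 5 w ≠ 0 ∧ δ v w < s.real 3)
    (hc : s.arr 5 (s.arr 6 (s.arr 7 (s.num 15))) ≠ 0)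
    (hcard : ((Finset.range (s.num 0)).filter fun w => E w ≤ s.num 14).card ≤ s.num 1) :
    (∀ v < s.num 0, ((centerProg.run δ s).arr 10 v ≠ 0 ↔ s.arr 10 v ≠ 0 ∨ E v ≤ s.num 14) ∧
      ((s.arr 10 v = 0 ∧ E v < s.num 14) → (centerProg.run δ s).arr 11 v = s.num 15 + 1) ∧
      (¬ (s.arr 10 v = 0 ∧ E v < s.num 14) → (centerProg.run δ s).arr 11 v = s.arr 11 v)) ∧
    ∀ v, s.num 0 ≤ v → (centerProg.run δ s).arr 11 v = s.arr 11 v := by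
  unfold centerProg
  rw [Prog.run_seq, Prog.run_seq]
  generalize hs2 : Prog.run δ (.setNum 16 (.get 6 (.get 7 (.var 15)))) _ = s2
  have c0 : s2.num 0 = s.num 0 := by rw [← hs2]; simp
  have c1 : s2.num 1 = s.num 1 := by rw [← hs2]; simp
  have c14 : s2.num 14 = s.num 14 := by rw [← hs2]; simp
  have c15 : s2.num 15 = s.num 15 := by rw [← hs2]; simp
  have c16 : s2.num 16 = s.arr 6 (s.arr 7 (s.num 15)) := by rw [← hs2]; simp
  have c5 : s2.arr 5 = s.arr 5 := by rw [← hs2]; simp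
  have c10 : s2.arr 10 = s.arr 10 := by rw [← hs2]; simp
  have c11 : s2.arr 11 = s.arr 11 := by rw [← hs2]; simp
  have cr3 : s2.real 3 = s.real 3 := by rw [← hs2]; simp
  clear hs2
  have hbfs := fun v (hv : v < s.num 0) => bfsProg_run (δ := δ) (s := s2) (A := A)
    (E := E) (by rw [c0, c16]; exact hE) (by rw [c0, c5, cr3]; exact hA)
    (by rw [c5, c16]; exact hc) (by rw [c0, c1, c14]; exact hcard) (w := v)
    (by rw [c0]; exact hv)
  have hF2 := Prog.frame δ bfsProg s2
  generalize Prog.run δ bfsProg s2 = s3 at hbfs hF2 ⊢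
  have d0 : s3.num 0 = s.num 0 := (hF2.num 0 rfl).trans c0
  have d14 : s3.num 14 = s.num 14 := (hF2.num 14 rfl).trans c14
  have d15 : s3.num 15 = s.num 15 := (hF2.num 15 rfl).trans c15
  have d10 : s3.arr 10 = s.arr 10 := (hF2.arr 10 rfl).trans c10
  have d11 : s3.arr 11 = s.arr 11 := (hF2.arr 11 rfl).trans c11
  clear hF2
  obtain ⟨hcl, hcl'⟩ := claimProg_run (δ := δ) (s := s3)
  generalize Prog.run δ claimProg s3 = s4 at hcl hcl' ⊢
  rw [d0] at hcl hcl'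
  simp only [d10, d11, d14, d15, c14] at hcl hcl' hbfs
  refine ⟨fun v hv => ?_, hcl'⟩
  obtain ⟨g1, g2, g3⟩ := hcl v hv
  obtain ⟨k1, k2⟩ := hbfs v hv
  -- Labels are distances plus one, and 0 marks a point that was not reached.
  have h8 : (s3.arr 8 v ≠ 0 ∧ s3.arr 8 v ≤ s.num 14) ↔ E v < s.num 14 := by
    constructor
    · rintro ⟨h1, h2⟩
      rw [← ENat.add_lt_add_iff_right (k := 1) (by simp), k2 h1]
      exact_mod_cast Nat.lt_succ_of_le h2
    · intro h
      have h1 := k1.2 h.le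
      refine ⟨h1, ?_⟩
      rw [← ENat.add_lt_add_iff_right (k := 1) (by simp), k2 h1] at h
      exact Nat.lt_succ_iff.1 (by exact_mod_cast h)
  refine ⟨by rw [g1, k1], fun h => g2 ?_, fun h => g3 ?_⟩
  · have := h8.2 h.2
    exact ⟨this.1, h.1, this.2⟩
  · exact fun h' => h ⟨h'.2.1, h8.1 ⟨h'.1, h'.2.2⟩⟩

open Classical in
-- The loop over centers makes n rounds, of which only the first |U| act. That array 11 vanishes
-- from n on makes it a function of the decomposition alone.
theorem decomposeProg_run {δ : ℕ → ℕ → ℝ} {s : Store} {A : ℕ → ℕ → Prop} {E : ℕ → ℕ → ℕ∞}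
    (hN : s.num 6 ≤ s.num 0)
    (hE : ∀ j < s.num 6, IsDistFrom (s.num 0) A (s.arr 6 (s.arr 7 j)) (E j))
    (hA : ∀ v < s.num 0, ∀ w < s.num 0,
      A v w ↔ s.arr 5 v ≠ 0 ∧ s.arr 5 w ≠ 0 ∧ δ v w < s.real 3)
    (hc : ∀ j < s.num 6, s.arr 5 (s.arr 6 (s.arr 7 j)) ≠ 0)
    (hcard : ∀ j < s.num 6,
      ((Finset.range (s.num 0)).filter fun w => E j w ≤ s.num 14).card ≤ s.num 1)
    (h11 : ∀ v, s.num 0 ≤ v → s.arr 11 v = 0) :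
    (∀ v < s.num 0, ∀ t, (decomposeProg.run δ s).arr 11 v = t + 1 ↔
      t < s.num 6 ∧ E t v < s.num 14 ∧ ∀ t' < t, ¬ E t' v ≤ s.num 14) ∧
    ∀ v, s.num 0 ≤ v → (decomposeProg.run δ s).arr 11 v = 0 := by
  have hclear := Prog.run_loop (δ := δ) (x := 10) (e := .var 0)
    (p := .setArr 10 (.var 10) (.lit 0) ;; .setArr 11 (.var 10) (.lit 0)) (s := s)
    (fun i s' => (∀ v < i, s'.arr 10 v = 0 ∧ s'.arr 11 v = 0) ∧
      ∀ v, s.num 0 ≤ v → s'.arr 11 v = 0)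
    (s.num 0) rfl (by simpa using h11) (by
      intro i hi s' hF hI
      refine ⟨fun x hx => ?_, fun x hx => ?_⟩
      · by_cases hxi : x = i
        · simp [hxi]
        · simpa [hxi] using hI.1 x (by omega)
      · have hxi : x ≠ i := by omega
        simpa [hxi] using hI.2 x hx)
  have hF := Prog.frame δ
    (.loop 10 (.var 0) (.setArr 10 (.var 10) (.lit 0) ;; .setArr 11 (.var 10) (.lit 0))) s
  unfold decomposeProg
  rw [Prog.run_seq]
  generalize Prog.run δ
    (.loop 10 (.var 0) (.setArr 10 (.var 10) (.lit 0) ;; .setArr 11 (.var 10) (.lit 0))) s = s1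
    at hclear hF ⊢
  have a0 : s1.num 0 = s.num 0 := hF.num 0 rfl
  have a1 : s1.num 1 = s.num 1 := hF.num 1 rfl
  have a6 : s1.num 6 = s.num 6 := hF.num 6 rfl
  have a14 : s1.num 14 = s.num 14 := hF.num 14 rfl
  have aa5 : s1.arr 5 = s.arr 5 := hF.arr 5 rfl
  have aa6 : s1.arr 6 = s.arr 6 := hF.arr 6 rfl
  have aa7 : s1.arr 7 = s.arr 7 := hF.arr 7 rfl
  have ar3 : s1.real 3 = s.real 3 := hF.real 3 rfl
  clear hF
  have key := Prog.run_loop (δ := δ) (x := 15) (e := .var 0)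
    (p := .ite (.lt (.var 15) (.var 6))
      centerProg .skip) (s := s1)
    (fun i s' => (∀ v < s.num 0,
        (s'.arr 10 v ≠ 0 ↔ ∃ t < i, t < s.num 6 ∧ E t v ≤ s.num 14) ∧
        ∀ t, s'.arr 11 v = t + 1 ↔
          t < i ∧ t < s.num 6 ∧ E t v < s.num 14 ∧ ∀ t' < t, ¬ E t' v ≤ s.num 14) ∧
      ∀ v, s.num 0 ≤ v → s'.arr 11 v = 0)
    (s.num 0) a0 (by
      refine ⟨fun v hv => ?_, hclear.2⟩
      simp [hclear.1 v hv]) (by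
      intro i hi s' hF ⟨hI1, hI2⟩
      have b0 : s'.num 0 = s.num 0 := (hF.num 0 rfl).trans a0
      have b1 : s'.num 1 = s.num 1 := (hF.num 1 rfl).trans a1
      have b6 : s'.num 6 = s.num 6 := (hF.num 6 rfl).trans a6
      have b14 : s'.num 14 = s.num 14 := (hF.num 14 rfl).trans a14
      have ba5 : s'.arr 5 = s.arr 5 := (hF.arr 5 rfl).trans aa5
      have ba6 : s'.arr 6 = s.arr 6 := (hF.arr 6 rfl).trans aa6
      have ba7 : s'.arr 7 = s.arr 7 := (hF.arr 7 rfl).trans aa7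
      have br3 : s'.real 3 = s.real 3 := (hF.real 3 rfl).trans ar3
      by_cases hiN : i < s.num 6
      · rw [Prog.run_ite_pos _ _ _ _ (by simpa [b6] using hiN)]
        generalize hs2 : Store.tick _ _ = s2
        have c0 : s2.num 0 = s.num 0 := by rw [← hs2]; simp [b0]
        have c1 : s2.num 1 = s.num 1 := by rw [← hs2]; simp [b1]
        have c14 : s2.num 14 = s.num 14 := by rw [← hs2]; simp [b14]
        have c15 : s2.num 15 = i := by rw [← hs2]; simp
        have c5 : s2.arr 5 = s.arr 5 := by rw [← hs2]; simp [ba5]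
        have c6 : s2.arr 6 = s.arr 6 := by rw [← hs2]; simp [ba6]
        have c7 : s2.arr 7 = s.arr 7 := by rw [← hs2]; simp [ba7]
        have c10 : s2.arr 10 = s'.arr 10 := by rw [← hs2]; simp
        have c11 : s2.arr 11 = s'.arr 11 := by rw [← hs2]; simp
        have cr3 : s2.real 3 = s.real 3 := by rw [← hs2]; simp [br3]
        clear hs2
        obtain ⟨hcl, hcl'⟩ := centerProg_run (δ := δ) (s := s2) (A := A) (E := E i)
          (by rw [c0, c6, c7, c15]; exact hE i hiN) (by rw [c0, c5, cr3]; exact hA)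
          (by rw [c5, c6, c7, c15]; exact hc i hiN) (by rw [c0, c1, c14]; exact hcard i hiN)
        generalize Prog.run δ centerProg s2 = s4 at hcl hcl' ⊢
        rw [c0] at hcl hcl'
        simp only [c10, c11, c14, c15] at hcl hcl'
        refine ⟨fun v hv => ?_, fun v hv => (hcl' v hv).trans (hI2 v hv)⟩
        obtain ⟨g1, g2, g3⟩ := hcl v hv
        obtain ⟨l1, l2⟩ := hI1 v hv
        refine ⟨?_, fun t => ?_⟩
        · rw [g1, l1]
          constructor
          · rintro (⟨t, ht, h⟩ | h)
            · exact ⟨t, by omega, h⟩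
            · exact ⟨i, by omega, hiN, h⟩
          · rintro ⟨t, ht, h⟩
            rcases Nat.lt_succ_iff_lt_or_eq.1 ht with h1 | rfl
            · exact Or.inl ⟨t, h1, h⟩
            · exact Or.inr h.2
        · have h10 : s'.arr 10 v = 0 ↔ ∀ t' < i, ¬ E t' v ≤ s.num 14 := by
            rw [← not_iff_not, ← ne_eq, l1]
            push Not
            exact ⟨fun ⟨t, h1, _, h2⟩ => ⟨t, h1, h2⟩, fun ⟨t, h1, h2⟩ => ⟨t, h1, by omega, h2⟩⟩
          rw [h10] at g2 g3
          by_cases hcnd : (∀ t' < i, ¬ E t' v ≤ s.num 14) ∧ E i v < s.num 14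
          · rw [g2 hcnd]
            constructor
            · intro h
              obtain rfl : i = t := by omega
              exact ⟨by omega, hiN, hcnd.2, hcnd.1⟩
            · rintro ⟨h1, -, h2, h3⟩
              rcases Nat.lt_succ_iff_lt_or_eq.1 h1 with h4 | rfl
              · exact absurd h2.le (hcnd.1 t h4)
              · rfl
          · rw [g3 hcnd, l2]
            constructor
            · rintro ⟨h1, h2⟩; exact ⟨by omega, h2⟩
            · rintro ⟨h1, h2⟩
              rcases Nat.lt_succ_iff_lt_or_eq.1 h1 with h4 | rfl
              · exact ⟨h4, h2⟩
              · exact absurd ⟨h2.2.2, h2.2.1⟩ hcnd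
      · rw [Prog.run_ite_neg _ _ _ _ (by simpa [b6] using hiN)]
        simp only [Prog.run_skip, Store.tick_arr, Store.setNum_arr]
        refine ⟨fun v hv => ?_, hI2⟩
        obtain ⟨l1, l2⟩ := hI1 v hv
        refine ⟨l1.trans ?_, fun t => (l2 t).trans ?_⟩
        · exact exists_congr fun t => ⟨fun h => ⟨by omega, h.2⟩, fun h => ⟨by omega, h.2⟩⟩
        · exact ⟨fun h => ⟨by omega, h.2⟩, fun h => ⟨by omega, h.2⟩⟩)
  refine ⟨fun v hv t => ((key.1 v hv).2 t).trans ⟨fun h => h.2, fun h => ⟨by omega, h⟩⟩, key.2⟩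


/-! ### Augmenting paths -/

/-- Extend the set of colors reached once, by looking at all points. -/
def sweepProg : Prog :=
  .loop 10 (.var 0)
    (.ite (.conj (.neg (.eq (.get 11 (.var 10)) (.lit 0)))
        (.conj (.neg (.conj (.neg (.eq (.get 12 (.get 11 (.var 10))) (.lit 0)))
            (.eq (.get 14 (.sub (.get 12 (.get 11 (.var 10))) (.lit 1))) (.lit 0))))
          (.eq (.get 14 (.get 0 (.var 10))) (.lit 0))))
      (.setNum 25 (.add (.var 25) (.lit 1)) ;; guardedSet 14 (.get 0 (.var 10)) (.var 25) ;;
        guardedSet 15 (.get 0 (.var 10)) (.var 10))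
      .skip)

/-- Find all colors that can be reached from unassigned clusters. -/
def searchProg : Prog :=
  .loop 10 (.var 1) (guardedSet 14 (.var 10) (.lit 0)) ;; .setNum 25 (.lit 0) ;;
  .loop 24 (.var 1) sweepProg

/-- Find a color that was reached and whose capacity, in array `cap`, is not exhausted. -/
def targetProg (cap : ℕ) : Prog :=
  .setNum 26 (.lit 0) ;;
  .loop 10 (.var 1)
    (.ite (.conj (.neg (.eq (.get 14 (.var 10)) (.lit 0)))
        (.lt (.get 13 (.var 10)) (.get cap (.var 10))))
      (.setNum 26 (.add (.var 10) (.lit 1))) .skip)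

/-- Reassign the clusters along the path to the color in variable `27`. -/
def flipProg : Prog :=
  .loop 28 (.var 1)
    (.ite (.neg (.eq (.var 27) (.lit 0)))
      (.setNum 30 (.get 11 (.get 15 (.sub (.var 27) (.lit 1)))) ;; .setNum 31 (.get 12 (.var 30)) ;;
        guardedSet 12 (.var 30) (.var 27) ;; .setNum 27 (.var 31))
      .skip)

/-- Increase the assignment by one cluster, or find that this is impossible. -/
def roundProg (cap : ℕ) : Prog :=
  searchProg ;; targetProg cap ;;
  .ite (.eq (.var 26) (.lit 0)) (.setNum 22 (.lit 1))
    (.setNum 27 (.var 26) ;; flipProg ;;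
      guardedSet 13 (.sub (.var 26) (.lit 1)) (.add (.get 13 (.sub (.var 26) (.lit 1))) (.lit 1)) ;;
      .setNum 20 (.add (.var 20) (.lit 1)))

/-- Increase the assignment as long as possible, but not beyond the number in variable `21`. -/
def phaseProg (cap : ℕ) : Prog :=
  .setNum 22 (.lit 0) ;;
  .loop 23 (.add (.var 0) (.lit 1))
    (.ite (.conj (.eq (.var 22) (.lit 0)) (.lt (.var 20) (.var 21))) (roundProg cap) .skip)

section GuardedSet

variable {δ : ℕ → ℕ → ℝ} {s : Store} {a : ℕ} {i e : NatExpr}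

theorem boundExpr_eval : boundExpr.eval s = s.num 0 + s.num 1 + 2 := rfl

@[simp] theorem guardedSet_num : ((guardedSet a i e).run δ s).num = s.num := by
  unfold guardedSet
  by_cases h : i.eval s < boundExpr.eval s
  · rw [Prog.run_ite_pos _ _ _ _ (show Test.Holds δ s (.lt i boundExpr) from h)]; rfl
  · rw [Prog.run_ite_neg _ _ _ _ (show ¬ Test.Holds δ s (.lt i boundExpr) from h)]; rfl

theorem NatExpr.eval_tick (e : NatExpr) (t : ℕ) : e.eval (s.tick t) = e.eval s := by
  induction e with
  | lit c => rfl
  | var x => rfl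
  | get a i ih => rw [eval, eval, ih]; rfl
  | add e f he hf => rw [eval, eval, he, hf]
  | sub e f he hf => rw [eval, eval, he, hf]

theorem guardedSet_arr (h : i.eval s < s.num 0 + s.num 1 + 2) (b : ℕ) :
    ((guardedSet a i e).run δ s).arr b =
      if b = a then Function.update (s.arr a) (i.eval s) (e.eval s) else s.arr b := by
  unfold guardedSet
  rw [Prog.run_ite_pos _ _ _ _ (show Test.Holds δ s (.lt i boundExpr) from h)]
  simp [NatExpr.eval_tick]

end GuardedSet

/-- The point `v` shows that its color is reachable, too. -/
def Extends (col cl a stamp : ℕ → ℕ) (v : ℕ) : Prop :=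
  cl v ≠ 0 ∧ (a (cl v) = 0 ∨ stamp (a (cl v) - 1) ≠ 0) ∧ stamp (col v) = 0

/-- The entry of color `j` in the search leads back to an unassigned cluster, or to a cluster that
is assigned to a color reached earlier. -/
def Linked (n : ℕ) (col cl a stamp par : ℕ → ℕ) (j : ℕ) : Prop :=
  par j < n ∧ cl (par j) ≠ 0 ∧ col (par j) = j ∧
    (a (cl (par j)) = 0 ∨ stamp (a (cl (par j)) - 1) ≠ 0 ∧ stamp (a (cl (par j)) - 1) < stamp j)

/-- The state of the search. -/
structure SearchInv (n m : ℕ) (col cl a stamp par : ℕ → ℕ) (ctr : ℕ) : Prop where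
  linked : ∀ j < m, stamp j ≠ 0 → stamp j ≤ ctr ∧ Linked n col cl a stamp par j
  count : ctr = ((Finset.range m).filter fun j => stamp j ≠ 0).card

/-- The assignment of colors to the clusters `1, …, n`; the entries of `a` are the colors
plus one. -/
structure MatchInv (n m : ℕ) (col cl a cnt : ℕ → ℕ) (count : ℕ) : Prop where
  mem : ∀ i, a i ≠ 0 → i ≠ 0 ∧ i ≤ n ∧ ∃ v < n, cl v = i ∧ a i = col v + 1
  cnt_eq : ∀ j < m, cnt j = ((Finset.range (n + 1)).filter fun i => a i = j + 1).card
  count_eq : count = ∑ j ∈ Finset.range m, cnt j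

/-- No assigned number can be increased within the capacities, as a set `Z` of saturated colors
shows. -/
def Stuck (n m : ℕ) (col cl a cnt cap : ℕ → ℕ) : Prop :=
  ∃ Z : ℕ → Prop, (∀ v < n, cl v ≠ 0 → (a (cl v) = 0 ∨ Z (a (cl v) - 1)) → Z (col v)) ∧
    ∀ j < m, Z j → cap j ≤ cnt j

/-! ### Colors reachable by alternating paths -/

section Search

variable {n m : ℕ} {col cl a stamp par cnt : ℕ → ℕ} {ctr count : ℕ}

/-- The new color gets the latest stamp, so its link leads to an unassigned cluster or to a color
with a smaller stamp. Links therefore never run in circles. -/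
theorem SearchInv.push (hI : SearchInv n m col cl a stamp par ctr) (hcol : ∀ v < n, col v < m)
    (ha : ∀ i, a i ≤ m) {v : ℕ} (hv : v < n) (hx : Extends col cl a stamp v) :
    SearchInv n m col cl a (Function.update stamp (col v) (ctr + 1))
      (Function.update par (col v) v) (ctr + 1) := by
  obtain ⟨h1, h2, h3⟩ := hx
  have hne : ∀ x, stamp x ≠ 0 → x ≠ col v := fun x hx e => hx (e ▸ h3)
  constructor
  · intro j hj hj0
    by_cases hjv : j = col v
    · subst hjv
      refine ⟨by simp, ?_⟩
      unfold Linked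
      simp only [Function.update_self]
      refine ⟨hv, h1, trivial, h2.imp_right fun h => ?_⟩
      rw [Function.update_of_ne (hne _ h)]
      refine ⟨h, ?_⟩
      by_cases h0 : a (cl v) = 0
      · rw [h0] at h ⊢
        by_cases hm : 0 < m
        · exact Nat.lt_succ_of_le (hI.linked 0 hm h).1
        · omega
      · have := ha (cl v)
        exact Nat.lt_succ_of_le (hI.linked _ (by omega) h).1
    · rw [Function.update_of_ne hjv] at hj0
      obtain ⟨g1, g2, g3, g4, g5⟩ := hI.linked j hj hj0
      refine ⟨by rw [Function.update_of_ne hjv]; omega, ?_⟩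
      unfold Linked
      rw [Function.update_of_ne hjv, Function.update_of_ne hjv]
      refine ⟨g2, g3, g4, g5.imp_right fun h => ?_⟩
      rw [Function.update_of_ne (hne _ h.1)]
      exact h
  · have : ((Finset.range m).filter fun j => Function.update stamp (col v) (ctr + 1) j ≠ 0) =
        insert (col v) ((Finset.range m).filter fun j => stamp j ≠ 0) := by
      ext j
      by_cases hjv : j = col v
      · subst hjv; simp [hcol v hv]
      · simp [hjv]
    rw [this, Finset.card_insert_of_notMem (by simp [h3]), ← hI.count]

/-- A sweep either stamps at least one color or finds the reached set closed. The first alternative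
also records that the set was not closed before, so a closed set stays as it is. -/
theorem sweepProg_run {δ : ℕ → ℕ → ℝ} {s : Store} (hcol : ∀ v < s.num 0, s.arr 0 v < s.num 1)
    (ha : ∀ i, s.arr 12 i ≤ s.num 1)
    (hI : SearchInv (s.num 0) (s.num 1) (s.arr 0) (s.arr 11) (s.arr 12) (s.arr 14) (s.arr 15)
      (s.num 25)) :
    SearchInv (s.num 0) (s.num 1) (s.arr 0) (s.arr 11) (s.arr 12) ((sweepProg.run δ s).arr 14)
      ((sweepProg.run δ s).arr 15) ((sweepProg.run δ s).num 25) ∧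
    ((s.num 25 + 1 ≤ (sweepProg.run δ s).num 25 ∧
        ¬ ∀ v < s.num 0, ¬ Extends (s.arr 0) (s.arr 11) (s.arr 12) (s.arr 14) v) ∨
      ∀ v < s.num 0, ¬ Extends (s.arr 0) (s.arr 11) (s.arr 12) ((sweepProg.run δ s).arr 14) v) := by
  unfold sweepProg
  have key := Prog.run_loop (δ := δ) (x := 10) (e := .var 0)
    (p := .ite (.conj (.neg (.eq (.get 11 (.var 10)) (.lit 0)))
        (.conj (.neg (.conj (.neg (.eq (.get 12 (.get 11 (.var 10))) (.lit 0)))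
            (.eq (.get 14 (.sub (.get 12 (.get 11 (.var 10))) (.lit 1))) (.lit 0))))
          (.eq (.get 14 (.get 0 (.var 10))) (.lit 0))))
      (.setNum 25 (.add (.var 25) (.lit 1)) ;; guardedSet 14 (.get 0 (.var 10)) (.var 25) ;;
        guardedSet 15 (.get 0 (.var 10)) (.var 10))
      .skip) (s := s)
    (fun i s' => SearchInv (s.num 0) (s.num 1) (s.arr 0) (s.arr 11) (s.arr 12) (s'.arr 14)
      (s'.arr 15) (s'.num 25) ∧
      ((s.num 25 + 1 ≤ s'.num 25 ∧
          ¬ ∀ v < s.num 0, ¬ Extends (s.arr 0) (s.arr 11) (s.arr 12) (s.arr 14) v) ∨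
        (s'.arr 14 = s.arr 14 ∧ s'.num 25 = s.num 25 ∧
          ∀ v < i, ¬ Extends (s.arr 0) (s.arr 11) (s.arr 12) (s.arr 14) v)))
    (s.num 0) rfl ⟨hI, Or.inr ⟨rfl, rfl, by simp⟩⟩ (by
      intro i hi s' hF ⟨hS, hP⟩
      have e0 : s'.num 0 = s.num 0 := hF.num 0 rfl
      have e1 : s'.num 1 = s.num 1 := hF.num 1 rfl
      have ea0 : s'.arr 0 = s.arr 0 := hF.arr 0 rfl
      have ea11 : s'.arr 11 = s.arr 11 := hF.arr 11 rfl
      have ea12 : s'.arr 12 = s.arr 12 := hF.arr 12 rfl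
      by_cases hx : Extends (s.arr 0) (s.arr 11) (s.arr 12) (s'.arr 14) i
      · have hci := hcol i hi
        rw [Prog.run_ite_pos _ _ _ _ (by
          unfold Extends at hx
          simp only [Test.Holds, NatExpr.eval, Store.tick_arr, Store.tick_num, Store.setNum_arr,
            Store.setNum_num, ↓reduceIte, ea0, ea11, ea12]
          tauto), Prog.run_seq, Prog.run_seq]
        generalize hs2 : Prog.run δ (.setNum 25 (.add (.var 25) (.lit 1))) _ = s2
        have c0 : s2.num 0 = s.num 0 := by rw [← hs2]; simp [e0]
        have c1 : s2.num 1 = s.num 1 := by rw [← hs2]; simp [e1]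
        have c10 : s2.num 10 = i := by rw [← hs2]; simp
        have c25 : s2.num 25 = s'.num 25 + 1 := by rw [← hs2]; simp
        have ca0 : s2.arr 0 = s.arr 0 := by rw [← hs2]; simp [ea0]
        have c14 : s2.arr 14 = s'.arr 14 := by rw [← hs2]; simp
        have c15 : s2.arr 15 = s'.arr 15 := by rw [← hs2]; simp
        clear hs2
        have hg : (NatExpr.get 0 (.var 10)).eval s2 < s2.num 0 + s2.num 1 + 2 := by
          simp only [NatExpr.eval, c10, ca0, c0, c1]; omega
        have hp := hS.push hcol ha hi hx
        have hne : ¬ ∀ v < s.num 0, ¬ Extends (s.arr 0) (s.arr 11) (s.arr 12) (s.arr 14) v := by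
          rcases hP with h | h
          · exact h.2
          · rw [h.1] at hx
            exact fun hall => hall i hi hx
        have hle : s.num 25 ≤ s'.num 25 := by
          rcases hP with h | h
          · omega
          · exact h.2.1.ge
        have q3 := fun b => guardedSet_arr (δ := δ) (a := 14) (e := .var 25) hg b
        have n3 : (Prog.run δ (guardedSet 14 (.get 0 (.var 10)) (.var 25)) s2).num = s2.num :=
          guardedSet_num
        generalize Prog.run δ (guardedSet 14 (.get 0 (.var 10)) (.var 25)) s2 = s3 at q3 n3 ⊢
        have d0 : s3.arr 0 = s.arr 0 := by rw [q3]; simpa using ca0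
        have d14 : s3.arr 14 = Function.update (s'.arr 14) (s.arr 0 i) (s'.num 25 + 1) := by
          rw [q3]; simp [c10, c25, ca0, c14]
        have d15 : s3.arr 15 = s'.arr 15 := by rw [q3]; simpa using c15
        have hg' : (NatExpr.get 0 (.var 10)).eval s3 < s3.num 0 + s3.num 1 + 2 := by
          simp only [NatExpr.eval, n3, c10, d0, c0, c1]; omega
        rw [guardedSet_arr hg', guardedSet_arr hg']
        simp only [guardedSet_num, NatExpr.eval, n3, c10, c25, d0, d14, d15,
          Nat.reduceEqDiff, ↓reduceIte]
        exact ⟨hp, Or.inl ⟨by omega, hne⟩⟩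
      · rw [Prog.run_ite_neg _ _ _ _ (by
          unfold Extends at hx
          simp only [Test.Holds, NatExpr.eval, Store.tick_arr, Store.tick_num, Store.setNum_arr,
            Store.setNum_num, ↓reduceIte, ea0, ea11, ea12]
          tauto)]
        refine ⟨hS, hP.imp_right fun h => ⟨h.1, h.2.1, fun v hv => ?_⟩⟩
        rcases Nat.lt_succ_iff_lt_or_eq.1 hv with h1 | rfl
        · exact h.2.2 v h1
        · rw [h.1] at hx; exact hx)
  refine ⟨key.1, key.2.imp_right fun h => ?_⟩
  rw [h.1]
  exact h.2.2

theorem searchProg_run {δ : ℕ → ℕ → ℝ} {s : Store} (hcol : ∀ v < s.num 0, s.arr 0 v < s.num 1)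
    (ha : ∀ i, s.arr 12 i ≤ s.num 1) :
    SearchInv (s.num 0) (s.num 1) (s.arr 0) (s.arr 11) (s.arr 12) ((searchProg.run δ s).arr 14)
      ((searchProg.run δ s).arr 15) ((searchProg.run δ s).num 25) ∧
    ∀ v < s.num 0, ¬ Extends (s.arr 0) (s.arr 11) (s.arr 12) ((searchProg.run δ s).arr 14) v := by
  have hclear := Prog.run_loop (δ := δ) (x := 10) (e := .var 1)
    (p := guardedSet 14 (.var 10) (.lit 0)) (s := s) (fun i s' => ∀ x < i, s'.arr 14 x = 0)
    (s.num 1) rfl (by simp) (by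
      intro i hi s' hF hI x hx
      have e0 : s'.num 0 = s.num 0 := hF.num 0 rfl
      have e1 : s'.num 1 = s.num 1 := hF.num 1 rfl
      rw [guardedSet_arr (by simp [e1]; omega)]
      by_cases hxi : x = i
      · simp [hxi]
      · simp [hxi, hI x (by omega)])
  have hF := Prog.frame δ (.loop 10 (.var 1) (guardedSet 14 (.var 10) (.lit 0))) s
  unfold searchProg
  rw [Prog.run_seq, Prog.run_seq]
  generalize Prog.run δ (.loop 10 (.var 1) (guardedSet 14 (.var 10) (.lit 0))) s = s1
    at hclear hF ⊢
  generalize hs2 : Prog.run δ (.setNum 25 (.lit 0)) s1 = s2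
  have c0 : s2.num 0 = s.num 0 := by rw [← hs2]; simp [hF.num 0 rfl]
  have c1 : s2.num 1 = s.num 1 := by rw [← hs2]; simp [hF.num 1 rfl]
  have c25 : s2.num 25 = 0 := by rw [← hs2]; simp
  have ca0 : s2.arr 0 = s.arr 0 := by rw [← hs2]; simp [hF.arr 0 rfl]
  have ca11 : s2.arr 11 = s.arr 11 := by rw [← hs2]; simp [hF.arr 11 rfl]
  have ca12 : s2.arr 12 = s.arr 12 := by rw [← hs2]; simp [hF.arr 12 rfl]
  have c14 : ∀ x < s.num 1, s2.arr 14 x = 0 := by rw [← hs2]; simpa using hclear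
  clear hs2 hF hclear
  have key := Prog.run_loop (δ := δ) (x := 24) (e := .var 1) (p := sweepProg) (s := s2)
    (fun i s' => SearchInv (s.num 0) (s.num 1) (s.arr 0) (s.arr 11) (s.arr 12) (s'.arr 14)
      (s'.arr 15) (s'.num 25) ∧ (i ≤ s'.num 25 ∨
      ∀ v < s.num 0, ¬ Extends (s.arr 0) (s.arr 11) (s.arr 12) (s'.arr 14) v))
    (s.num 1) c1 (by
      refine ⟨⟨fun j hj h => absurd (c14 j hj) h, ?_⟩, Or.inl (Nat.zero_le _)⟩
      rw [Store.tick_num, c25]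
      refine (Finset.card_eq_zero.2 (Finset.filter_eq_empty_iff.2 fun j hj => ?_)).symm
      simpa using c14 j (Finset.mem_range.1 hj)) (by
      intro i hi s' hF ⟨hS, hP⟩
      have e0 : s'.num 0 = s.num 0 := (hF.num 0 rfl).trans c0
      have e1 : s'.num 1 = s.num 1 := (hF.num 1 rfl).trans c1
      have ea0 : s'.arr 0 = s.arr 0 := (hF.arr 0 rfl).trans ca0
      have ea11 : s'.arr 11 = s.arr 11 := (hF.arr 11 rfl).trans ca11
      have ea12 : s'.arr 12 = s.arr 12 := (hF.arr 12 rfl).trans ca12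
      have h := sweepProg_run (δ := δ) (s := (s'.setNum 24 i).tick 1)
        (by simpa [e0, e1, ea0] using hcol) (by simpa [e1, ea12] using ha)
        (by simpa [e0, e1, ea0, ea11, ea12] using hS)
      generalize Prog.run δ sweepProg _ = s3 at h ⊢
      simp only [Store.tick_num, Store.setNum_num, Store.tick_arr, Store.setNum_arr,
        OfNat.zero_ne_ofNat, OfNat.one_ne_ofNat, Nat.reduceEqDiff, ↓reduceIte, e0, e1, ea0, ea11,
        ea12] at h
      refine ⟨h.1, ?_⟩
      rcases h.2 with h2 | h2
      · rcases hP with h3 | h3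
        · exact Or.inl (by omega)
        · exact absurd h3 h2.2
      · exact Or.inr h2)
  refine ⟨key.1, ?_⟩
  rcases key.2 with h | h
  -- After m sweeps that each stamped a color, all m colors are stamped, so nothing can be extended.
  · intro v hv hx
    rw [key.1.count] at h
    have hall : ((Finset.range (s.num 1)).filter fun j => ((Prog.run δ
        (.loop 24 (.var 1) sweepProg) s2).arr 14 j ≠ 0)) = Finset.range (s.num 1) :=
      Finset.eq_of_subset_of_card_le (Finset.filter_subset _ _) (by simpa using h)
    have := (Finset.filter_eq_self.1 hall) (s.arr 0 v) (Finset.mem_range.2 (hcol v hv))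
    exact this hx.2.2
  · exact h

theorem targetProg_run {δ : ℕ → ℕ → ℝ} {s : Store} {cap : ℕ} :
    ((targetProg cap).run δ s).num 26 ≠ 0 →
      (((targetProg cap).run δ s).num 26 ≤ s.num 1 ∧
        s.arr 14 (((targetProg cap).run δ s).num 26 - 1) ≠ 0 ∧
        s.arr 13 (((targetProg cap).run δ s).num 26 - 1) <
          s.arr cap (((targetProg cap).run δ s).num 26 - 1)) := by
  have key := Prog.run_loop (δ := δ) (x := 10) (e := .var 1)
    (p := .ite (.conj (.neg (.eq (.get 14 (.var 10)) (.lit 0)))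
        (.lt (.get 13 (.var 10)) (.get cap (.var 10))))
      (.setNum 26 (.add (.var 10) (.lit 1))) .skip)
    (s := Prog.run δ (.setNum 26 (.lit 0)) s)
    (fun i s' => s'.num 26 ≠ 0 → (s'.num 26 ≤ s.num 1 ∧ s.arr 14 (s'.num 26 - 1) ≠ 0 ∧
        s.arr 13 (s'.num 26 - 1) < s.arr cap (s'.num 26 - 1)))
    (s.num 1) (by simp) (by simp) (by
      intro i hi s' hF hI
      have e13 : s'.arr 13 = s.arr 13 := hF.arr 13 rfl
      have e14 : s'.arr 14 = s.arr 14 := hF.arr 14 rfl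
      have ec : s'.arr cap = s.arr cap := hF.arr cap rfl
      by_cases hc : s.arr 14 i ≠ 0 ∧ s.arr 13 i < s.arr cap i
      · rw [Prog.run_ite_pos _ _ _ _ (by simpa [e13, e14, ec] using hc)]
        intro _
        simpa using ⟨by omega, hc⟩
      · rw [Prog.run_ite_neg _ _ _ _ (by simpa [e13, e14, ec] using hc)]
        exact hI)
  exact key

theorem targetProg_run_eq_zero {δ : ℕ → ℕ → ℝ} {s : Store} {cap : ℕ}
    (h : ((targetProg cap).run δ s).num 26 = 0) :
    ∀ j < s.num 1, s.arr 14 j ≠ 0 → s.arr cap j ≤ s.arr 13 j := by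
  have key := Prog.run_loop (δ := δ) (x := 10) (e := .var 1)
    (p := .ite (.conj (.neg (.eq (.get 14 (.var 10)) (.lit 0)))
        (.lt (.get 13 (.var 10)) (.get cap (.var 10))))
      (.setNum 26 (.add (.var 10) (.lit 1))) .skip)
    (s := Prog.run δ (.setNum 26 (.lit 0)) s)
    (fun i s' => s'.num 26 = 0 → ∀ j < i, s.arr 14 j ≠ 0 → s.arr cap j ≤ s.arr 13 j)
    (s.num 1) (by simp) (by simp) (by
      intro i hi s' hF hI
      have e13 : s'.arr 13 = s.arr 13 := hF.arr 13 rfl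
      have e14 : s'.arr 14 = s.arr 14 := hF.arr 14 rfl
      have ec : s'.arr cap = s.arr cap := hF.arr cap rfl
      by_cases hc : s.arr 14 i ≠ 0 ∧ s.arr 13 i < s.arr cap i
      · rw [Prog.run_ite_pos _ _ _ _ (by simpa [e13, e14, ec] using hc)]
        simp
      · rw [Prog.run_ite_neg _ _ _ _ (by simpa [e13, e14, ec] using hc)]
        intro h0 j hj hj14
        rcases Nat.lt_succ_iff_lt_or_eq.1 hj with h1 | rfl
        · exact hI (by simpa using h0) j h1 hj14
        · by_contra hcon
          exact hc ⟨hj14, not_le.1 hcon⟩)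
  exact key h

end Search


/-! ### Reassignment along an alternating path -/

section Flip

variable {n m : ℕ} {col cl a stamp par cnt : ℕ → ℕ} {ctr count : ℕ}

/-- Changing the entry of `i` from `a i` to `c'` moves one unit between the classes. -/
theorem card_update_add {i : ℕ} (hi : i ≤ n) (c c' : ℕ) :
    ((Finset.range (n + 1)).filter fun x => Function.update a i c' x = c).card +
      (if a i = c then 1 else 0) =
    ((Finset.range (n + 1)).filter fun x => a x = c).card + if c' = c then 1 else 0 := by
  have hmem : i ∈ Finset.range (n + 1) := Finset.mem_range.2 (by omega)
  rw [Finset.card_filter, Finset.card_filter, ← Finset.add_sum_erase _ _ hmem,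
    ← Finset.add_sum_erase _ (fun x => if a x = c then 1 else 0) hmem]
  have : ∑ x ∈ (Finset.range (n + 1)).erase i, (if Function.update a i c' x = c then 1 else 0) =
      ∑ x ∈ (Finset.range (n + 1)).erase i, if a x = c then 1 else 0 :=
    Finset.sum_congr rfl fun x hx => by rw [Function.update_of_ne (Finset.ne_of_mem_erase hx)]
  rw [this, Function.update_self]
  omega

/-- The state while the clusters along the path to color `t - 1` are reassigned: color `cur - 1` is
the one that has to get another cluster, unless `cur = 0`. -/
structure FlipInv (n m : ℕ) (col cl stamp par cnt : ℕ → ℕ) (t : ℕ) (h : ℕ) (a : ℕ → ℕ) (cur : ℕ) :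
    Prop where
  mem : ∀ i, a i ≠ 0 → i ≠ 0 ∧ i ≤ n ∧ ∃ v < n, cl v = i ∧ a i = col v + 1
  balance : ∀ j < m, ((Finset.range (n + 1)).filter fun i => a i = j + 1).card +
    (if cur = j + 1 then 1 else 0) = cnt j + if t = j + 1 then 1 else 0
  chain : cur ≠ 0 → cur ≤ m ∧ stamp (cur - 1) ≠ 0 ∧ stamp (cur - 1) + h ≤ m ∧
    ∀ j < m, stamp j ≠ 0 → stamp j ≤ stamp (cur - 1) → Linked n col cl a stamp par j

/-- The cluster linked to the current color is handed over to it, and the color that loses this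
cluster becomes the current one. Its stamp is strictly smaller, so the path has at most m steps. -/
theorem FlipInv.step {t h cur : ℕ} (hI : FlipInv n m col cl stamp par cnt t h a cur)
    (hcol : ∀ v < n, col v < m) (hcl : ∀ v < n, cl v ≤ n) (hcur : cur ≠ 0) :
    FlipInv n m col cl stamp par cnt t (h + 1) (Function.update a (cl (par (cur - 1))) cur)
      (a (cl (par (cur - 1)))) := by
  obtain ⟨h1, h2, h3, h4⟩ := hI.chain hcur
  obtain ⟨l1, l2, l3, l4⟩ := h4 (cur - 1) (by omega) h2 le_rfl
  set i := cl (par (cur - 1)) with hi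
  have hin : i ≤ n := hcl _ l1
  constructor
  · intro x hx
    by_cases hxi : x = i
    · subst hxi
      refine ⟨l2, hin, par (cur - 1), l1, rfl, ?_⟩
      rw [Function.update_self, l3]
      omega
    · rw [Function.update_of_ne hxi] at hx ⊢
      exact hI.mem x hx
  · intro j hj
    rw [card_update_add hin]
    exact hI.balance j hj
  · intro hp
    obtain ⟨-, -, v, hv, -, hav⟩ := hI.mem i hp
    have hvm := hcol v hv
    obtain ⟨l5, l6⟩ := l4.resolve_left hp
    refine ⟨by omega, l5, by omega, fun j hj hj0 hjs => ?_⟩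
    obtain ⟨k1, k2, k3, k4⟩ := h4 j hj hj0 (by omega)
    -- A color still to be visited cannot be linked through the reassigned cluster: its stamp would
    -- exceed that of the cluster's former color, yet only stamps up to that one matter from now on.
    have hne : cl (par j) ≠ i := by
      intro e
      rw [e] at k4
      rcases k4 with k4 | k4
      · exact hp k4
      · omega
    refine ⟨k1, k2, k3, ?_⟩
    rw [Function.update_of_ne hne]
    exact k4

theorem flipProg_run {δ : ℕ → ℕ → ℝ} {s : Store} {cnt : ℕ → ℕ} {t : ℕ}
    (hcol : ∀ v < s.num 0, s.arr 0 v < s.num 1) (hcl : ∀ v < s.num 0, s.arr 11 v ≤ s.num 0)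
    (hI : FlipInv (s.num 0) (s.num 1) (s.arr 0) (s.arr 11) (s.arr 14) (s.arr 15) cnt t 0
      (s.arr 12) (s.num 27)) :
    FlipInv (s.num 0) (s.num 1) (s.arr 0) (s.arr 11) (s.arr 14) (s.arr 15) cnt t (s.num 1)
      ((flipProg.run δ s).arr 12) 0 := by
  have key := Prog.run_loop (δ := δ) (x := 28) (e := .var 1)
    (p := .ite (.neg (.eq (.var 27) (.lit 0)))
      (.setNum 30 (.get 11 (.get 15 (.sub (.var 27) (.lit 1)))) ;; .setNum 31 (.get 12 (.var 30)) ;;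
        guardedSet 12 (.var 30) (.var 27) ;; .setNum 27 (.var 31))
      .skip) (s := s)
    (fun i s' => FlipInv (s.num 0) (s.num 1) (s.arr 0) (s.arr 11) (s.arr 14) (s.arr 15) cnt t i
      (s'.arr 12) (s'.num 27)) (s.num 1) rfl hI (by
      intro i hi s' hF hI'
      have e0 : s'.num 0 = s.num 0 := hF.num 0 rfl
      have e1 : s'.num 1 = s.num 1 := hF.num 1 rfl
      have e11 : s'.arr 11 = s.arr 11 := hF.arr 11 rfl
      have e15 : s'.arr 15 = s.arr 15 := hF.arr 15 rfl
      by_cases h0 : s'.num 27 = 0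
      · rw [Prog.run_ite_neg _ _ _ _ (by simpa using h0)]
        simp only [Prog.run_skip, Store.tick_num, Store.tick_arr, Store.setNum_num,
          Store.setNum_arr, Nat.reduceEqDiff, ↓reduceIte]
        refine ⟨hI'.mem, hI'.balance, fun h => absurd h0 h⟩
      · rw [Prog.run_ite_pos _ _ _ _ (by simpa using h0), Prog.run_seq, Prog.run_seq, Prog.run_seq]
        generalize hs2 : Prog.run δ (.setNum 31 (.get 12 (.var 30))) _ = s2
        have c0 : s2.num 0 = s.num 0 := by rw [← hs2]; simp [e0]
        have c1 : s2.num 1 = s.num 1 := by rw [← hs2]; simp [e1]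
        have c27 : s2.num 27 = s'.num 27 := by rw [← hs2]; simp
        have c30 : s2.num 30 = s.arr 11 (s.arr 15 (s'.num 27 - 1)) := by
          rw [← hs2]; simp [e11, e15]
        have c31 : s2.num 31 = s'.arr 12 (s.arr 11 (s.arr 15 (s'.num 27 - 1))) := by
          rw [← hs2]; simp [e11, e15]
        have c12 : s2.arr 12 = s'.arr 12 := by rw [← hs2]; simp
        clear hs2
        obtain ⟨h1, h2, h3, h4⟩ := hI'.chain h0
        have hlt := hcl _ (h4 (s'.num 27 - 1) (by omega) h2 le_rfl).1
        have hg : (NatExpr.var 30).eval s2 < s2.num 0 + s2.num 1 + 2 := by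
          rw [NatExpr.eval, c30, c0]; omega
        have := hI'.step hcol hcl h0
        simp only [Prog.run_setNum, Store.tick_num, Store.tick_arr, Store.setNum_num,
          Store.setNum_arr, guardedSet_arr hg, guardedSet_num, NatExpr.eval, c27, c30, c31, c12,
          ↓reduceIte]
        exact this)
  -- After m steps a current color would have a positive stamp whose sum with m is at most m.
  have h0 : ((flipProg.run δ s).num 27) = 0 := by
    by_contra h
    obtain ⟨-, h2, h3, -⟩ := key.chain h
    exact h2 (Nat.le_zero.1 (by omega))
  change FlipInv _ _ _ _ _ _ _ _ _ ((flipProg.run δ s).arr 12) ((flipProg.run δ s).num 27) at key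
  rwa [h0] at key

theorem MatchInv.le (hM : MatchInv n m col cl a cnt count) (hcol : ∀ v < n, col v < m) (i : ℕ) :
    a i ≤ m := by
  by_cases h : a i = 0
  · omega
  · obtain ⟨-, -, v, hv, -, h1⟩ := hM.mem i h
    have := hcol v hv
    omega

theorem MatchInv.count_eq_card (hM : MatchInv n m col cl a cnt count)
    (hcol : ∀ v < n, col v < m) :
    count = ((Finset.range (n + 1)).filter fun i => a i ≠ 0).card := by
  rw [hM.count_eq, Finset.card_eq_sum_card_fiberwise (f := fun i => a i - 1)
    (t := Finset.range m)]
  · refine Finset.sum_congr rfl fun j hj => ?_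
    rw [hM.cnt_eq j (Finset.mem_range.1 hj), Finset.filter_filter]
    congr 1
    refine Finset.filter_congr fun i _ => ?_
    omega
  · intro i hi
    have hi' := (Finset.mem_filter.1 (Finset.mem_coe.1 hi)).2
    have := hM.le hcol i
    refine Finset.mem_coe.2 (Finset.mem_range.2 ?_)
    dsimp only
    omega

theorem MatchInv.count_le (hM : MatchInv n m col cl a cnt count) (hcol : ∀ v < n, col v < m) :
    count ≤ n := by
  rw [hM.count_eq_card hcol]
  have : ((Finset.range (n + 1)).filter fun i => a i ≠ 0) ⊆ (Finset.range (n + 1)).erase 0 := by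
    intro i hi
    rw [Finset.mem_filter] at hi
    exact Finset.mem_erase.2 ⟨(hM.mem i hi.2).1, hi.1⟩
  have := Finset.card_le_card this
  rwa [Finset.card_erase_of_mem (by simp), Finset.card_range, Nat.add_sub_cancel] at this

/-- The effect of one round: nothing is changed and the assignment is stuck, or one color gets an
additional cluster. -/
theorem roundProg_run {δ : ℕ → ℕ → ℝ} {s : Store} {cap : ℕ} (hcap : cap = 1 ∨ cap = 2)
    (hcol : ∀ v < s.num 0, s.arr 0 v < s.num 1) (hcl : ∀ v < s.num 0, s.arr 11 v ≤ s.num 0)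
    (hM : MatchInv (s.num 0) (s.num 1) (s.arr 0) (s.arr 11) (s.arr 12) (s.arr 13) (s.num 20)) :
    MatchInv (s.num 0) (s.num 1) (s.arr 0) (s.arr 11) (((roundProg cap).run δ s).arr 12)
      (((roundProg cap).run δ s).arr 13) (((roundProg cap).run δ s).num 20) ∧
    ((((roundProg cap).run δ s).num 22 = 1 ∧ ((roundProg cap).run δ s).num 20 = s.num 20 ∧
        ((roundProg cap).run δ s).arr 13 = s.arr 13 ∧
        Stuck (s.num 0) (s.num 1) (s.arr 0) (s.arr 11) (((roundProg cap).run δ s).arr 12)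
          (((roundProg cap).run δ s).arr 13) (s.arr cap)) ∨
      (((roundProg cap).run δ s).num 22 = s.num 22 ∧
        ((roundProg cap).run δ s).num 20 = s.num 20 + 1 ∧
        ∃ j < s.num 1, s.arr 13 j < s.arr cap j ∧
          ((roundProg cap).run δ s).arr 13 = Function.update (s.arr 13) j (s.arr 13 j + 1))) := by
  have ha := hM.le hcol
  obtain ⟨hS, hclosed⟩ := searchProg_run (δ := δ) hcol ha
  have hF := Prog.frame δ searchProg s
  unfold roundProg
  simp only [Prog.run_seq]
  generalize Prog.run δ searchProg s = s1 at hS hclosed hF ⊢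
  have a0 : s1.num 0 = s.num 0 := hF.num 0 rfl
  have a1 : s1.num 1 = s.num 1 := hF.num 1 rfl
  have a20 : s1.num 20 = s.num 20 := hF.num 20 rfl
  have a22 : s1.num 22 = s.num 22 := hF.num 22 rfl
  have aa0 : s1.arr 0 = s.arr 0 := hF.arr 0 rfl
  have aa11 : s1.arr 11 = s.arr 11 := hF.arr 11 rfl
  have aa12 : s1.arr 12 = s.arr 12 := hF.arr 12 rfl
  have aa13 : s1.arr 13 = s.arr 13 := hF.arr 13 rfl
  have aac : s1.arr cap = s.arr cap := by rcases hcap with rfl | rfl <;> exact hF.arr _ rfl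
  clear hF
  have ht := targetProg_run (δ := δ) (s := s1) (cap := cap)
  have ht0 := targetProg_run_eq_zero (δ := δ) (s := s1) (cap := cap)
  have hF := Prog.frame δ (targetProg cap) s1
  generalize Prog.run δ (targetProg cap) s1 = s2 at ht ht0 hF ⊢
  rw [aac, aa13, a1] at ht ht0
  have b0 : s2.num 0 = s.num 0 := (hF.num 0 rfl).trans a0
  have b1 : s2.num 1 = s.num 1 := (hF.num 1 rfl).trans a1
  have b20 : s2.num 20 = s.num 20 := (hF.num 20 rfl).trans a20
  have b22 : s2.num 22 = s.num 22 := (hF.num 22 rfl).trans a22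
  have ba0 : s2.arr 0 = s.arr 0 := (hF.arr 0 rfl).trans aa0
  have ba11 : s2.arr 11 = s.arr 11 := (hF.arr 11 rfl).trans aa11
  have ba12 : s2.arr 12 = s.arr 12 := (hF.arr 12 rfl).trans aa12
  have ba13 : s2.arr 13 = s.arr 13 := (hF.arr 13 rfl).trans aa13
  have ba14 : s2.arr 14 = s1.arr 14 := hF.arr 14 rfl
  have ba15 : s2.arr 15 = s1.arr 15 := hF.arr 15 rfl
  clear hF
  by_cases h0 : s2.num 26 = 0
  · rw [Prog.run_ite_pos _ _ _ _ (by simpa using h0)]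
    simp only [Prog.run_setNum, Store.tick_num, Store.tick_arr, Store.setNum_num,
      Store.setNum_arr, ba12, ba13, b20, NatExpr.eval, Nat.reduceEqDiff, ↓reduceIte]
    refine ⟨hM, Or.inl ⟨trivial, trivial, trivial, fun j => s1.arr 14 j ≠ 0, ?_, ht0 h0⟩⟩
    intro v hv hv1 hv2 hv3
    exact hclosed v hv ⟨hv1, hv2, hv3⟩
  · obtain ⟨t1, t2, t3⟩ := ht h0
    rw [Prog.run_ite_neg _ _ _ _ (by simpa using h0), Prog.run_seq, Prog.run_seq, Prog.run_seq]
    generalize hs3 : Prog.run δ (.setNum 27 (.var 26)) _ = s3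
    have c0 : s3.num 0 = s.num 0 := by rw [← hs3]; simp [b0]
    have c1 : s3.num 1 = s.num 1 := by rw [← hs3]; simp [b1]
    have c20 : s3.num 20 = s.num 20 := by rw [← hs3]; simp [b20]
    have c22 : s3.num 22 = s.num 22 := by rw [← hs3]; simp [b22]
    have c26 : s3.num 26 = s2.num 26 := by rw [← hs3]; simp
    have c27 : s3.num 27 = s2.num 26 := by rw [← hs3]; simp
    have ca0 : s3.arr 0 = s.arr 0 := by rw [← hs3]; simp [ba0]
    have ca11 : s3.arr 11 = s.arr 11 := by rw [← hs3]; simp [ba11]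
    have ca12 : s3.arr 12 = s.arr 12 := by rw [← hs3]; simp [ba12]
    have ca13 : s3.arr 13 = s.arr 13 := by rw [← hs3]; simp [ba13]
    have ca14 : s3.arr 14 = s1.arr 14 := by rw [← hs3]; simp [ba14]
    have ca15 : s3.arr 15 = s1.arr 15 := by rw [← hs3]; simp [ba15]
    clear hs3
    have hflip := flipProg_run (δ := δ) (s := s3) (cnt := s.arr 13) (t := s2.num 26)
      (by simpa [c0, c1, ca0] using hcol) (by simpa [c0, ca11] using hcl) (by
        rw [c0, c1, c27, ca0, ca11, ca12, ca14, ca15]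
        refine ⟨hM.mem, fun j hj => by rw [hM.cnt_eq j hj], fun _ => ?_⟩
        refine ⟨t1, t2, ?_, fun j hj hj0 _ => (hS.linked j hj hj0).2⟩
        have h1 := (hS.linked (s2.num 26 - 1) (by omega) t2).1
        have h2 : s1.num 25 ≤ s.num 1 := by
          rw [hS.count]
          exact (Finset.card_filter_le _ _).trans (by simp)
        omega)
    have hF := Prog.frame δ flipProg s3
    generalize Prog.run δ flipProg s3 = s4 at hflip hF ⊢
    have d0 : s4.num 0 = s.num 0 := (hF.num 0 rfl).trans c0
    have d1 : s4.num 1 = s.num 1 := (hF.num 1 rfl).trans c1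
    have d20 : s4.num 20 = s.num 20 := (hF.num 20 rfl).trans c20
    have d22 : s4.num 22 = s.num 22 := (hF.num 22 rfl).trans c22
    have d26 : s4.num 26 = s2.num 26 := (hF.num 26 rfl).trans c26
    have d13 : s4.arr 13 = s.arr 13 := (hF.arr 13 rfl).trans ca13
    clear hF
    rw [c0, c1, ca0, ca11] at hflip
    have hg : (NatExpr.sub (.var 26) (.lit 1)).eval s4 < s4.num 0 + s4.num 1 + 2 := by
      simp only [NatExpr.eval, d26, d0, d1]; omega
    simp only [Prog.run_setNum, Store.tick_num, Store.tick_arr, Store.setNum_num,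
      Store.setNum_arr, guardedSet_arr hg, guardedSet_num, NatExpr.eval, d13, d20, d22, d26,
      Nat.reduceEqDiff, ↓reduceIte]
    refine ⟨⟨hflip.mem, fun j hj => ?_, ?_⟩, Or.inr ⟨trivial, trivial, s2.num 26 - 1, by omega, t3, rfl⟩⟩
    · have := hflip.balance j hj
      rw [if_neg (by omega)] at this
      by_cases hjt : j = s2.num 26 - 1
      · rw [if_pos (by omega)] at this
        rw [hjt, Function.update_self, ← hjt]
        omega
      · rw [if_neg (by omega)] at this
        rw [Function.update_of_ne hjt]
        omega
    · have hmem : s2.num 26 - 1 ∈ Finset.range (s.num 1) := Finset.mem_range.2 (by omega)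
      rw [Finset.sum_update_of_mem hmem, hM.count_eq, ← Finset.add_sum_erase _ _ hmem,
        Finset.sdiff_singleton_eq_erase]
      omega

/-- Each successful round assigns one more cluster, and there are at most n. So n + 1 rounds reach
the limit or a stuck assignment. Numbers of clusters per color never decrease, which preserves the
gains of the first phase in the second. -/
theorem phaseProg_run {δ : ℕ → ℕ → ℝ} {s : Store} {cap : ℕ} (hcap : cap = 1 ∨ cap = 2)
    (hcol : ∀ v < s.num 0, s.arr 0 v < s.num 1) (hcl : ∀ v < s.num 0, s.arr 11 v ≤ s.num 0)
    (hM : MatchInv (s.num 0) (s.num 1) (s.arr 0) (s.arr 11) (s.arr 12) (s.arr 13) (s.num 20))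
    (hle : ∀ j < s.num 1, s.arr 13 j ≤ s.arr cap j) (hlim : s.num 20 ≤ s.num 21) :
    MatchInv (s.num 0) (s.num 1) (s.arr 0) (s.arr 11) (((phaseProg cap).run δ s).arr 12)
      (((phaseProg cap).run δ s).arr 13) (((phaseProg cap).run δ s).num 20) ∧
    (∀ j < s.num 1, s.arr 13 j ≤ ((phaseProg cap).run δ s).arr 13 j ∧
      ((phaseProg cap).run δ s).arr 13 j ≤ s.arr cap j) ∧
    ((phaseProg cap).run δ s).num 20 ≤ s.num 21 ∧
    (Stuck (s.num 0) (s.num 1) (s.arr 0) (s.arr 11) (((phaseProg cap).run δ s).arr 12)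
        (((phaseProg cap).run δ s).arr 13) (s.arr cap) ∨
      ((phaseProg cap).run δ s).num 20 = s.num 21) := by
  unfold phaseProg
  rw [Prog.run_seq]
  generalize hs1 : Prog.run δ (.setNum 22 (.lit 0)) s = s1
  have a0 : s1.num 0 = s.num 0 := by rw [← hs1]; simp
  have a1 : s1.num 1 = s.num 1 := by rw [← hs1]; simp
  have a20 : s1.num 20 = s.num 20 := by rw [← hs1]; simp
  have a21 : s1.num 21 = s.num 21 := by rw [← hs1]; simp
  have a22 : s1.num 22 = 0 := by rw [← hs1]; simp
  have aa : s1.arr = s.arr := by rw [← hs1]; simp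
  clear hs1
  have key := Prog.run_loop (δ := δ) (x := 23) (e := .add (.var 0) (.lit 1))
    (p := .ite (.conj (.eq (.var 22) (.lit 0)) (.lt (.var 20) (.var 21))) (roundProg cap) .skip)
    (s := s1)
    (fun r s' => MatchInv (s.num 0) (s.num 1) (s.arr 0) (s.arr 11) (s'.arr 12) (s'.arr 13)
        (s'.num 20) ∧
      (∀ j < s.num 1, s.arr 13 j ≤ s'.arr 13 j ∧ s'.arr 13 j ≤ s.arr cap j) ∧
      s'.num 20 ≤ s.num 21 ∧
      ((s'.num 22 = 1 ∧
          Stuck (s.num 0) (s.num 1) (s.arr 0) (s.arr 11) (s'.arr 12) (s'.arr 13) (s.arr cap)) ∨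
        (s'.num 22 = 0 ∧ (s'.num 20 = s.num 21 ∨ r ≤ s'.num 20))))
    (s.num 0 + 1) (by simp [a0]) (by
      simp only [Store.tick_num, Store.tick_arr, a20, a22, aa]
      exact ⟨hM, fun j hj => ⟨le_rfl, hle j hj⟩, hlim, Or.inr ⟨trivial, Or.inr (Nat.zero_le _)⟩⟩) (by
      intro r hr s' hF ⟨hM', hb, hl, hst⟩
      have e0 : s'.num 0 = s.num 0 := (hF.num 0 rfl).trans a0
      have e1 : s'.num 1 = s.num 1 := (hF.num 1 rfl).trans a1
      have e21 : s'.num 21 = s.num 21 := (hF.num 21 rfl).trans a21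
      have ea0 : s'.arr 0 = s.arr 0 := (hF.arr 0 rfl).trans (by rw [aa])
      have ea11 : s'.arr 11 = s.arr 11 := (hF.arr 11 rfl).trans (by rw [aa])
      have eac : s'.arr cap = s.arr cap := by
        rcases hcap with rfl | rfl <;> exact (hF.arr _ rfl).trans (by rw [aa])
      by_cases hc : s'.num 22 = 0 ∧ s'.num 20 < s.num 21
      · rw [Prog.run_ite_pos _ _ _ _ (by simpa [e21] using hc)]
        generalize hs2 : Store.tick _ _ = s2
        have c0 : s2.num 0 = s.num 0 := by rw [← hs2]; simp [e0]
        have c1 : s2.num 1 = s.num 1 := by rw [← hs2]; simp [e1]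
        have c20 : s2.num 20 = s'.num 20 := by rw [← hs2]; simp
        have c22 : s2.num 22 = s'.num 22 := by rw [← hs2]; simp
        have ca : s2.arr = s'.arr := by rw [← hs2]; simp
        clear hs2
        have hround := roundProg_run (δ := δ) (s := s2) hcap (by rw [c0, c1, ca, ea0]; exact hcol)
          (by rw [c0, ca, ea11]; exact hcl) (by rw [c0, c1, c20, ca, ea0, ea11]; exact hM')
        generalize Prog.run δ (roundProg cap) s2 = s3 at hround ⊢
        rw [c0, c1, c20, c22, ca, ea0, ea11, eac] at hround
        obtain ⟨hM3, h | ⟨h22, h20, j, hj, hjc, h13⟩⟩ := hround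
        · obtain ⟨h22, h20, h13, hstuck⟩ := h
          refine ⟨hM3, by rw [h13]; exact hb, by omega, Or.inl ⟨h22, hstuck⟩⟩
        · refine ⟨hM3, fun l hl => ?_, by omega, Or.inr ⟨by omega, ?_⟩⟩
          · rw [h13]
            have := hb l hl
            by_cases hlj : l = j
            · subst hlj; rw [Function.update_self]; omega
            · rwa [Function.update_of_ne hlj]
          · rcases hst with h | ⟨-, h | h⟩
            · omega
            · omega
            · exact Or.inr (by omega)
      · rw [Prog.run_ite_neg _ _ _ _ (by simpa [e21] using hc)]
        simp only [Prog.run_skip, Store.tick_num, Store.tick_arr, Store.setNum_num,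
          Store.setNum_arr, Nat.reduceEqDiff, ↓reduceIte]
        refine ⟨hM', hb, hl, hst.imp_right fun h => ⟨h.1, Or.inl ?_⟩⟩
        by_contra hne
        exact hc ⟨h.1, by omega⟩)
  obtain ⟨hM', hb, hl, hst⟩ := key
  refine ⟨hM', hb, hl, ?_⟩
  rcases hst with h | ⟨-, h | h⟩
  · exact Or.inl h.2
  · exact Or.inr h
  · have := hM'.count_le hcol
    omega

end Flip


/-! ### The assignment as a maximum flow -/

/-- The flow for an assignment of colors (plus one) to the clusters (numbered from one). -/
def flowOf {V : Type u} {m : ℕ} (I : Problem V m) (N : ℕ) (a : ℕ → ℕ) : EdgeFlow N m where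
  fromSource i := ∑ j : Fin m, if a (i + 1) = (j : ℕ) + 1 then 1 else 0
  assign i j := if a (i + 1) = j + 1 then 1 else 0
  toSink j := min (∑ i : Fin N, if a (i + 1) = (j : ℕ) + 1 then 1 else 0) (I.lower j)
  toSlack j := (∑ i : Fin N, if a (i + 1) = (j : ℕ) + 1 then 1 else 0) - I.lower j
  slackToSink := ∑ j : Fin m, ((∑ i : Fin N, if a (i + 1) = (j : ℕ) + 1 then 1 else 0) - I.lower j)

/-- The arrays `col` and `cl` describe the colors and the clusters. -/
structure Represents {V : Type u} [Fintype V] {m N : ℕ} (I : Problem V m)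
    (e : V ≃ Fin (Fintype.card V)) (D : Fin N → Finset V) (col cl : ℕ → ℕ) : Prop where
  color : ∀ v, col (e v) = I.color v
  cluster : ∀ v t, cl (e v) = t + 1 ↔ ∃ h : t < N, v ∈ D ⟨t, h⟩

/-! ### Optimality certified by saturated colors -/

section Duality

variable {V : Type u} [Fintype V] {m N : ℕ} {I : Problem V m} {e : V ≃ Fin (Fintype.card V)}
  {D : Fin N → Finset V} {col cl a cnt cap : ℕ → ℕ} {count : ℕ}

theorem Represents.col_lt (hR : Represents I e D col cl) (v : ℕ) (hv : v < Fintype.card V) :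
    col v < m := by
  have := hR.color (e.symm ⟨v, hv⟩)
  rw [Equiv.apply_symm_apply] at this
  rw [this]
  exact (I.color _).2

theorem Represents.cl_le (hR : Represents I e D col cl) (v : ℕ) (hv : v < Fintype.card V) :
    cl v ≤ N := by
  rcases Nat.eq_zero_or_pos (cl v) with h | h
  · omega
  · have := (hR.cluster (e.symm ⟨v, hv⟩) (cl v - 1)).1 (by
      rw [Equiv.apply_symm_apply]; exact (Nat.succ_pred_eq_of_pos h).symm)
    obtain ⟨h, -⟩ := this
    omega

theorem MatchInv.cnt_eq_sum (hM : MatchInv (Fintype.card V) m col cl a cnt count)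
    (hR : Represents I e D col cl) (hN : N ≤ Fintype.card V) (j : Fin m) :
    cnt j = ∑ i : Fin N, if a (i + 1) = (j : ℕ) + 1 then 1 else 0 := by
  have himage : ((Finset.range (Fintype.card V + 1)).filter fun i => a i = (j : ℕ) + 1) =
      (Finset.univ.filter fun i : Fin N => a (i + 1) = (j : ℕ) + 1).image
        fun i : Fin N => (i : ℕ) + 1 := by
    ext x
    simp only [Finset.mem_filter, Finset.mem_range, Finset.mem_image, Finset.mem_univ, true_and]
    constructor
    · rintro ⟨-, hx⟩
      obtain ⟨h0, -, v, hv, hcl, -⟩ := hM.mem x (by omega)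
      have := hR.cl_le v hv
      exact ⟨⟨x - 1, by omega⟩, by rwa [Nat.sub_add_cancel (by omega)], by dsimp only; omega⟩
    · rintro ⟨i, hi, rfl⟩
      exact ⟨by omega, hi⟩
  rw [hM.cnt_eq j j.2, himage, Finset.card_image_of_injective, Finset.card_filter]
  intro i i' h
  exact Fin.ext (Nat.succ_injective h)

theorem MatchInv.count_eq_sum (hM : MatchInv (Fintype.card V) m col cl a cnt count) :
    count = ∑ j : Fin m, cnt j := by
  rw [hM.count_eq, Finset.sum_range]

/-- No flow can use the colors more than a stuck assignment does. -/
theorem sum_le_of_stuck (hM : MatchInv (Fintype.card V) m col cl a cnt count)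
    (hR : Represents I e D col cl) (hN : N ≤ Fintype.card V)
    (hS : Stuck (Fintype.card V) m col cl a cnt cap) {g : EdgeFlow N m} (hg : IsFlow I D g)
    {w : Fin m → ℕ} (hw : ∀ j : Fin m, w j ≤ cap j) (hw' : ∀ j, w j ≤ ∑ i, g.assign i j) :
    ∑ j, w j ≤ count := by
  classical
  -- Weak duality for the cut given by Z: colors in Z are filled to capacity. A cluster that sends
  -- flow to a color outside of Z must itself be assigned to a color outside of Z, so these colors
  -- get at least as many clusters as units of flow.
  obtain ⟨Z, hZ, hsat⟩ := hS
  rw [hM.count_eq_sum, ← Finset.sum_filter_add_sum_filter_not Finset.univ (fun j : Fin m => Z j) w,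
    ← Finset.sum_filter_add_sum_filter_not Finset.univ (fun j : Fin m => Z j) fun j => cnt j]
  refine Nat.add_le_add (Finset.sum_le_sum fun j hj => ?_) ?_
  · exact (hw j).trans (hsat j j.2 (Finset.mem_filter.1 hj).2)
  · refine (Finset.sum_le_sum fun j _ => hw' j).trans ?_
    rw [Finset.sum_congr rfl fun j _ => hM.cnt_eq_sum hR hN j, Finset.sum_comm,
      Finset.sum_comm (t := (Finset.univ : Finset (Fin N)))]
    refine Finset.sum_le_sum fun i _ => ?_
    by_cases hex : ∃ j : Fin m, ¬ Z j ∧ 0 < g.assign i j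
    · obtain ⟨j, hjZ, hj⟩ := hex
      have h1 : ∑ l ∈ Finset.univ.filter (fun l : Fin m => ¬ Z l), g.assign i l ≤ 1 :=
        (Finset.sum_le_sum_of_subset (Finset.filter_subset _ _)).trans
          ((hg.conserve_cluster i).symm.trans_le (hg.fromSource_le i))
      obtain ⟨v, hv⟩ := Finset.card_pos.1 (hj.trans_le (hg.assign_le i j))
      rw [Finset.mem_filter] at hv
      have hcl : cl (e v) = i + 1 := (hR.cluster v i).2 ⟨i.2, hv.1⟩
      have hcolv : col (e v) = j := by rw [hR.color, hv.2]
      have hnot := mt (hZ (e v) (e v).2 (by omega)) (by rwa [hcolv])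
      rw [hcl, not_or] at hnot
      have hlt := hM.le hR.col_lt (i + 1)
      refine h1.trans ?_
      refine le_trans (b := if a (i + 1) = (a (i + 1) - 1) + 1 then 1 else 0) ?_
        (Finset.single_le_sum (f := fun l : Fin m => if a (i + 1) = (l : ℕ) + 1 then 1 else 0)
          (fun _ _ => Nat.zero_le _) (Finset.mem_filter.2 ⟨Finset.mem_univ
            (⟨a (i + 1) - 1, by omega⟩ : Fin m), hnot.2⟩))
      rw [if_pos (by omega)]
    · push Not at hex
      rw [Finset.sum_eq_zero fun j hj => Nat.le_zero.1 (hex j (Finset.mem_filter.1 hj).2)]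
      exact Nat.zero_le _

/-- Only the capacity of `z → t` is delicate. Since `cnt₁ j` is at most both ℓ_j and `cnt j`, the
surplus over the lower bounds is at most `count - count₁`, which `hcount` limits. -/
theorem isFlow_flowOf (hM : MatchInv (Fintype.card V) m col cl a cnt count)
    (hR : Represents I e D col cl) (hN : N ≤ Fintype.card V) {cnt₁ : ℕ → ℕ} {count₁ : ℕ}
    (hM₁ : count₁ = ∑ j : Fin m, cnt₁ j)
    (hcnt : ∀ j : Fin m, cnt₁ j ≤ I.lower j ∧ cnt₁ j ≤ cnt j ∧ cnt j ≤ I.upper j)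
    (hcount : count ≤ count₁ + (I.k - ∑ j, I.lower j)) : IsFlow I D (flowOf I N a) := by
  have hsum := hM.cnt_eq_sum hR hN
  refine ⟨fun i => ?_, fun i j => ?_, fun j => min_le_right _ _, fun j => ?_, ?_, fun i => rfl,
    fun j => ?_, rfl⟩
  · rw [flowOf]
    dsimp only
    rw [← Finset.card_filter, Finset.card_le_one]
    intro x hx y hy
    rw [Finset.mem_filter] at hx hy
    exact Fin.ext (by omega)
  · rw [flowOf]
    dsimp only
    split_ifs with h
    · obtain ⟨-, -, v, hv, h1, h2⟩ := hM.mem (i + 1) (by omega)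
      refine Finset.card_pos.2 ⟨e.symm ⟨v, hv⟩, Finset.mem_filter.2 ⟨?_, ?_⟩⟩
      · have := (hR.cluster (e.symm ⟨v, hv⟩) i).1 (by rw [Equiv.apply_symm_apply]; exact h1)
        exact this.2
      · have := hR.color (e.symm ⟨v, hv⟩)
        rw [Equiv.apply_symm_apply] at this
        refine Fin.ext ?_
        rw [← this]
        exact Nat.succ_injective (h2.symm.trans h)
    · exact Nat.zero_le _
  · rw [flowOf]
    dsimp only
    rw [← hsum]
    exact Nat.sub_le_sub_right (hcnt j).2.2 _
  · rw [flowOf]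
    dsimp only
    rw [Finset.sum_congr rfl fun j _ => by rw [← hsum j]]
    have h1 : ∑ j : Fin m, (cnt j - I.lower j) + ∑ j : Fin m, cnt₁ j ≤ ∑ j : Fin m, cnt j := by
      rw [← Finset.sum_add_distrib]
      refine Finset.sum_le_sum fun j _ => ?_
      have := hcnt j
      omega
    rw [← hM.count_eq_sum, ← hM₁] at h1
    omega
  · rw [flowOf]
    dsimp only
    omega

/-- If the second phase is stuck, its cut bounds every flow. Otherwise it was stopped by its limit:
the units of a flow on the edges `c_j → t` respect the lower bounds and number at most `count₁`, as
the first phase was stuck, and the others have to pass through `z → t`. -/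
theorem isMaxFlow_flowOf (hlu : ∀ i, I.lower i ≤ I.upper i)
    (hM : MatchInv (Fintype.card V) m col cl a cnt count)
    (hR : Represents I e D col cl) (hN : N ≤ Fintype.card V) {a₁ cnt₁ : ℕ → ℕ} {count₁ : ℕ}
    (hM₁ : MatchInv (Fintype.card V) m col cl a₁ cnt₁ count₁) {low up : ℕ → ℕ}
    (hlow : ∀ j : Fin m, low j = I.lower j) (hup : ∀ j : Fin m, up j = I.upper j)
    (hS₁ : Stuck (Fintype.card V) m col cl a₁ cnt₁ low)
    (hcnt : ∀ j < m, cnt₁ j ≤ low j ∧ cnt₁ j ≤ cnt j ∧ cnt j ≤ up j)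
    (hcount : count ≤ count₁ + (I.k - ∑ j, I.lower j))
    (hS : Stuck (Fintype.card V) m col cl a cnt up ∨
      count = count₁ + (I.k - ∑ j, I.lower j)) :
    IsMaxFlow I D (flowOf I N a) ∧ (flowOf I N a).value = count := by
  have hf := isFlow_flowOf hM hR hN hM₁.count_eq_sum
    (fun j => by rw [← hlow, ← hup]; exact hcnt j j.2) hcount
  have hval : (flowOf I N a).value = count := by
    rw [hf.value_eq, hM.count_eq_sum]
    exact Finset.sum_congr rfl fun j _ => (hM.cnt_eq_sum hR hN j).symm
  refine ⟨⟨hf, fun g hg => ?_⟩, hval⟩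
  rw [hval]
  rcases hS with h | h
  · rw [hg.value_eq]
    refine sum_le_of_stuck hM hR hN h hg (fun j => ?_) fun j => le_rfl
    have h1 := hg.conserve_color j
    have h2 := hg.toSink_le j
    have h3 := hg.toSlack_le j
    have h4 := hlu j
    rw [hup]
    omega
  · rw [hg.value_eq_sink, h]
    refine Nat.add_le_add (sum_le_of_stuck hM₁ hR hN hS₁ hg (fun j => ?_) fun j => ?_)
      hg.slackToSink_le
    · rw [hlow]; exact hg.toSink_le j
    · rw [hg.conserve_color]; omega

end Duality

/-- Compute the assignment: first as many colors as possible within the lower bounds, then as many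
as possible within the upper bounds, but not more than the capacity of the slack node allows. -/
def coreProg : Prog :=
  .setNum 29 (.lit 0) ;; .loop 10 (.var 1) (.setNum 29 (.add (.var 29) (.get 1 (.var 10)))) ;;
  .setNum 21 (.add (.var 0) (.lit 1)) ;; phaseProg 1 ;;
  .setNum 21 (.add (.var 20) (.sub (.var 2) (.var 29))) ;; phaseProg 2

theorem coreProg_run {δ : ℕ → ℕ → ℝ} {s : Store}
    (hcol : ∀ v < s.num 0, s.arr 0 v < s.num 1) (hcl : ∀ v < s.num 0, s.arr 11 v ≤ s.num 0)
    (hlu : ∀ j < s.num 1, s.arr 1 j ≤ s.arr 2 j)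
    (h12 : ∀ i, s.arr 12 i = 0) (h13 : ∀ i, s.arr 13 i = 0) (h20 : s.num 20 = 0) :
    MatchInv (s.num 0) (s.num 1) (s.arr 0) (s.arr 11) ((coreProg.run δ s).arr 12)
      ((coreProg.run δ s).arr 13) ((coreProg.run δ s).num 20) ∧
    ∃ a₁ cnt₁ count₁, MatchInv (s.num 0) (s.num 1) (s.arr 0) (s.arr 11) a₁ cnt₁ count₁ ∧
      Stuck (s.num 0) (s.num 1) (s.arr 0) (s.arr 11) a₁ cnt₁ (s.arr 1) ∧
      (∀ j < s.num 1, cnt₁ j ≤ s.arr 1 j ∧ cnt₁ j ≤ (coreProg.run δ s).arr 13 j ∧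
        (coreProg.run δ s).arr 13 j ≤ s.arr 2 j) ∧
      (coreProg.run δ s).num 20 ≤
        count₁ + (s.num 2 - ∑ j ∈ Finset.range (s.num 1), s.arr 1 j) ∧
      (Stuck (s.num 0) (s.num 1) (s.arr 0) (s.arr 11) ((coreProg.run δ s).arr 12)
          ((coreProg.run δ s).arr 13) (s.arr 2) ∨
        (coreProg.run δ s).num 20 =
          count₁ + (s.num 2 - ∑ j ∈ Finset.range (s.num 1), s.arr 1 j)) := by
  unfold coreProg
  simp only [Prog.run_seq]
  generalize hs1 : Prog.run δ (.setNum 29 (.lit 0)) s = s1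
  have a0 : s1.num 0 = s.num 0 := by rw [← hs1]; simp
  have a1 : s1.num 1 = s.num 1 := by rw [← hs1]; simp
  have a2 : s1.num 2 = s.num 2 := by rw [← hs1]; simp
  have a20 : s1.num 20 = 0 := by rw [← hs1]; simp [h20]
  have a29 : s1.num 29 = 0 := by rw [← hs1]; simp
  have aa : s1.arr = s.arr := by rw [← hs1]; simp
  clear hs1
  have hsum := Prog.run_loop (δ := δ) (x := 10) (e := .var 1)
    (p := .setNum 29 (.add (.var 29) (.get 1 (.var 10)))) (s := s1)
    (fun i s' => s'.num 29 = ∑ j ∈ Finset.range i, s.arr 1 j) (s.num 1) a1 (by simp [a29]) (by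
      intro i hi s' hF hI
      have e1 : s'.arr 1 = s.arr 1 := (hF.arr 1 rfl).trans (by rw [aa])
      rw [Finset.sum_range_succ, ← hI]
      simp [e1])
  have hF := Prog.frame δ (.loop 10 (.var 1) (.setNum 29 (.add (.var 29) (.get 1 (.var 10))))) s1
  generalize Prog.run δ (.loop 10 (.var 1) (.setNum 29 (.add (.var 29) (.get 1 (.var 10))))) s1 = s2
    at hsum hF ⊢
  generalize hs3 : Prog.run δ (.setNum 21 (.add (.var 0) (.lit 1))) s2 = s3
  have b0 : s3.num 0 = s.num 0 := by rw [← hs3]; simpa [a0] using hF.num 0 rfl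
  have b1 : s3.num 1 = s.num 1 := by rw [← hs3]; simpa [a1] using hF.num 1 rfl
  have b2 : s3.num 2 = s.num 2 := by rw [← hs3]; simpa [a2] using hF.num 2 rfl
  have b20 : s3.num 20 = 0 := by rw [← hs3]; simpa [a20] using hF.num 20 rfl
  have b21 : s3.num 21 = s.num 0 + 1 := by rw [← hs3]; simpa [a0] using hF.num 0 rfl
  have b29 : s3.num 29 = ∑ j ∈ Finset.range (s.num 1), s.arr 1 j := by rw [← hs3]; simpa using hsum
  have ba : s3.arr = s.arr := by
    rw [← hs3]
    funext b
    simpa [aa] using hF.arr b rfl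
  clear hs3 hF hsum
  have hM0 : MatchInv (s.num 0) (s.num 1) (s.arr 0) (s.arr 11) (s.arr 12) (s.arr 13) 0 := by
    refine ⟨fun i hi => absurd (h12 i) hi, fun j _ => ?_, ?_⟩
    · simp [h12, h13]
    · simp [h13]
  have h1 := phaseProg_run (δ := δ) (s := s3) (cap := 1) (Or.inl rfl) (by rwa [b0, b1, ba])
    (by rwa [b0, ba]) (by rw [b0, b1, b20, ba]; exact hM0) (by simp [ba, h13]) (by omega)
  have hF := Prog.frame δ (phaseProg 1) s3
  generalize Prog.run δ (phaseProg 1) s3 = s4 at h1 hF ⊢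
  generalize hs5 : Prog.run δ (.setNum 21 (.add (.var 20) (.sub (.var 2) (.var 29)))) s4 = s5
  rw [b0, b1, b21, ba] at h1
  obtain ⟨hM1, hcnt1, -, hst1⟩ := h1
  have c0 : s5.num 0 = s.num 0 := by rw [← hs5]; simpa [b0] using hF.num 0 rfl
  have c1 : s5.num 1 = s.num 1 := by rw [← hs5]; simpa [b1] using hF.num 1 rfl
  have c20 : s5.num 20 = s4.num 20 := by rw [← hs5]; simp
  have c21 : s5.num 21 = s4.num 20 + (s.num 2 - ∑ j ∈ Finset.range (s.num 1), s.arr 1 j) := by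
    rw [← hs5]
    have e2 : s4.num 2 = s.num 2 := (hF.num 2 rfl).trans b2
    have e29 : s4.num 29 = _ := (hF.num 29 rfl).trans b29
    simp [e2, e29]
  have ca : s5.arr = s4.arr := by rw [← hs5]; simp
  have ca0 : s5.arr 0 = s.arr 0 := by rw [ca, hF.arr 0 rfl, ba]
  have ca2 : s5.arr 2 = s.arr 2 := by rw [ca, hF.arr 2 rfl, ba]
  have ca11 : s5.arr 11 = s.arr 11 := by rw [ca, hF.arr 11 rfl, ba]
  clear hs5 hF
  have h2 := phaseProg_run (δ := δ) (s := s5) (cap := 2) (Or.inr rfl) (by rwa [c0, c1, ca0])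
    (by rwa [c0, ca11]) (by rw [c0, c1, c20, ca0, ca11, ca]; exact hM1)
    (by rw [c1, ca2, ca]; exact fun j hj => (hcnt1 j hj).2.trans (hlu j hj))
    (by rw [c20, c21]; omega)
  generalize Prog.run δ (phaseProg 2) s5 = s6 at h2 ⊢
  rw [c0, c1, c21, ca0, ca2, ca11, ca] at h2
  -- The limit n + 1 of the first phase exceeds every possible number of assigned clusters, so this
  -- phase ends stuck.
  refine ⟨h2.1, s4.arr 12, s4.arr 13, s4.num 20, hM1, hst1.resolve_right fun h => ?_,
    fun j hj => ⟨(hcnt1 j hj).2, h2.2.1 j hj⟩, h2.2.2.1, h2.2.2.2⟩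
  have := hM1.count_le hcol
  omega


/-! ### The assignment step -/

/-- The work arrays of the assignment step vanish outside of the range of interest. -/
def WorkBounded (s : Store) : Prop :=
  ∀ a, 12 ≤ a → a ≤ 15 → ∀ i, s.num 0 + s.num 1 + 2 ≤ i → s.arr a i = 0

/-- The program does not change `n` and `m`, and it leaves the work arrays bounded. -/
def KeepsBounded (p : Prog) : Prop :=
  ∀ (δ : ℕ → ℕ → ℝ) (s : Store), WorkBounded s →
    WorkBounded (p.run δ s) ∧ (p.run δ s).num 0 = s.num 0 ∧ (p.run δ s).num 1 = s.num 1

section KeepsBounded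

variable {p q : Prog} {x a : ℕ} {i e : NatExpr} {b : Test}

theorem keepsBounded_skip : KeepsBounded .skip := fun _ _ h => ⟨h, rfl, rfl⟩

theorem keepsBounded_setNum (hx : x ≠ 0 ∧ x ≠ 1) : KeepsBounded (.setNum x e) := fun δ s h => by
  have h0 : ((Prog.setNum x e).run δ s).num 0 = s.num 0 := by simp [hx.1.symm]
  have h1 : ((Prog.setNum x e).run δ s).num 1 = s.num 1 := by simp [hx.2.symm]
  refine ⟨fun a ha ha' i hi => ?_, h0, h1⟩
  rw [h0, h1] at hi
  exact h a ha ha' i hi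

theorem keepsBounded_setArr (ha : a < 12 ∨ 15 < a) : KeepsBounded (.setArr a i e) :=
  fun δ s h => ⟨fun b hb hb' j hj => by
    have hne : b ≠ a := by omega
    simpa [hne] using h b hb hb' j hj, rfl, rfl⟩

theorem keepsBounded_guardedSet : KeepsBounded (guardedSet a i e) := fun δ s h => by
  refine ⟨fun b hb hb' j hj => ?_, by rw [guardedSet_num], by rw [guardedSet_num]⟩
  rw [guardedSet_num] at hj
  by_cases hi : i.eval s < s.num 0 + s.num 1 + 2
  · rw [guardedSet_arr hi]
    split_ifs with hba
    · subst hba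
      rw [Function.update_of_ne (by omega)]
      exact h b hb hb' j hj
    · exact h b hb hb' j hj
  · unfold guardedSet
    rw [Prog.run_ite_neg _ _ _ _ (show ¬ Test.Holds δ s (.lt i boundExpr) from hi)]
    exact h b hb hb' j hj

theorem keepsBounded_seq (hp : KeepsBounded p) (hq : KeepsBounded q) : KeepsBounded (p ;; q) :=
  fun δ s h => by
    obtain ⟨h1, h2, h3⟩ := hp δ s h
    obtain ⟨h4, h5, h6⟩ := hq δ _ h1
    exact ⟨h4, h5.trans h2, h6.trans h3⟩

theorem keepsBounded_ite (hp : KeepsBounded p) (hq : KeepsBounded q) :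
    KeepsBounded (.ite b p q) := fun δ s h => by
  by_cases hb : b.Holds δ s
  · rw [Prog.run_ite_pos _ _ _ _ hb]; exact hp δ _ h
  · rw [Prog.run_ite_neg _ _ _ _ hb]; exact hq δ _ h

theorem keepsBounded_loop (hx : x ≠ 0 ∧ x ≠ 1) (hp : KeepsBounded p) :
    KeepsBounded (.loop x e p) := fun δ s h => by
  refine Prog.run_loop (fun _ s' => WorkBounded s' ∧ s'.num 0 = s.num 0 ∧ s'.num 1 = s.num 1)
    _ rfl ⟨h, rfl, rfl⟩ fun i _ s' _ ⟨h1, h2, h3⟩ => ?_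
  have h0' : ((s'.setNum x i).tick 1).num 0 = s'.num 0 := by simp [hx.1.symm]
  have h1' : ((s'.setNum x i).tick 1).num 1 = s'.num 1 := by simp [hx.2.symm]
  obtain ⟨h4, h5, h6⟩ := hp δ ((s'.setNum x i).tick 1) (fun a ha ha' j hj => by
    rw [h0', h1'] at hj
    exact h1 a ha ha' j hj)
  exact ⟨h4, (h5.trans h0').trans h2, (h6.trans h1').trans h3⟩

theorem keepsBounded_phaseProg (cap : ℕ) : KeepsBounded (phaseProg cap) := by
  unfold phaseProg roundProg searchProg sweepProg targetProg flipProg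
  repeat' first
    | with_reducible exact keepsBounded_skip
    | with_reducible exact keepsBounded_guardedSet
    | with_reducible exact keepsBounded_setNum (by decide)
    | with_reducible refine keepsBounded_seq ?_ ?_
    | with_reducible refine keepsBounded_ite ?_ ?_
    | with_reducible refine keepsBounded_loop (by decide) ?_

theorem keepsBounded_clearProg : KeepsBounded (clearProg a) :=
  keepsBounded_loop (by decide) keepsBounded_guardedSet

theorem keepsBounded_coreProg : KeepsBounded coreProg := by
  unfold coreProg
  repeat' first
    | with_reducible exact keepsBounded_phaseProg _
    | with_reducible exact keepsBounded_setNum (by decide)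
    | with_reducible refine keepsBounded_seq ?_ ?_
    | with_reducible refine keepsBounded_loop (by decide) ?_

end KeepsBounded

/-- All writes to the work arrays are guarded by the index bound, so clearing a finite range makes
the whole array vanish. `Agree` compares whole arrays. -/
theorem clearProg_run {δ : ℕ → ℕ → ℝ} {s : Store} {a : ℕ} (ha : 12 ≤ a) (ha' : a ≤ 15)
    (hs : WorkBounded s) (i : ℕ) : ((clearProg a).run δ s).arr a i = 0 := by
  have key := Prog.run_loop (δ := δ) (x := 10) (e := boundExpr)
    (p := guardedSet a (.var 10) (.lit 0)) (s := s) (fun i s' => ∀ x < i, s'.arr a x = 0)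
    (s.num 0 + s.num 1 + 2) boundExpr_eval (by simp) (by
      intro i hi s' hF hI x hx
      have e0 : s'.num 0 = s.num 0 := hF.num 0 rfl
      have e1 : s'.num 1 = s.num 1 := hF.num 1 rfl
      rw [guardedSet_arr (by simp [e0, e1]; omega)]
      by_cases hxi : x = i
      · simp [hxi]
      · simp [hxi, hI x (by omega)])
  rcases lt_or_ge i (s.num 0 + s.num 1 + 2) with h | h
  · exact key i h
  · obtain ⟨h1, h2, h3⟩ := keepsBounded_clearProg (a := a) δ s hs
    exact h1 a ha ha' i (by rw [h2, h3]; exact h)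

/-- Forget the previous assignment. -/
def prepareProg : Prog :=
  clearProg 12 ;; clearProg 13 ;; clearProg 14 ;; clearProg 15 ;;
  .setNum 10 (.lit 0) ;; .setNum 20 (.lit 0) ;; .setNum 21 (.lit 0) ;; .setNum 22 (.lit 0) ;;
  .setNum 25 (.lit 0) ;; .setNum 26 (.lit 0) ;; .setNum 27 (.lit 0) ;; .setNum 29 (.lit 0) ;;
  .setNum 30 (.lit 0) ;; .setNum 31 (.lit 0)

/-- Write the set that belongs to the assignment, and note whether it is feasible. -/
def outProg : Prog :=
  .loop 10 (.var 0) (.ite (.conj (.neg (.eq (.get 11 (.var 10)) (.lit 0)))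
      (.eq (.get 12 (.get 11 (.var 10))) (.add (.get 0 (.var 10)) (.lit 1))))
    (.setArr 3 (.var 10) (.lit 1)) (.setArr 3 (.var 10) (.lit 0))) ;;
  .ite (.eq (.var 20) (.var 2)) (.setNum 9 (.lit 1)) .skip

theorem keepsBounded_prepareProg : KeepsBounded prepareProg := by
  unfold prepareProg
  repeat' first
    | with_reducible exact keepsBounded_clearProg
    | with_reducible exact keepsBounded_setNum (by decide)
    | with_reducible refine keepsBounded_seq ?_ ?_

theorem keepsBounded_outProg : KeepsBounded outProg := by
  unfold outProg
  repeat' first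
    | with_reducible exact keepsBounded_skip
    | with_reducible exact keepsBounded_setNum (by decide)
    | with_reducible exact keepsBounded_setArr (by decide)
    | with_reducible refine keepsBounded_seq ?_ ?_
    | with_reducible refine keepsBounded_ite ?_ ?_
    | with_reducible refine keepsBounded_loop (by decide) ?_

theorem outProg_run {δ : ℕ → ℕ → ℝ} {s : Store} :
    (∀ v < s.num 0, (outProg.run δ s).arr 3 v ≠ 0 ↔
      s.arr 11 v ≠ 0 ∧ s.arr 12 (s.arr 11 v) = s.arr 0 v + 1) ∧
    (outProg.run δ s).num 9 = if s.num 20 = s.num 2 then 1 else s.num 9 := by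
  have key := Prog.run_loop (δ := δ) (x := 10) (e := .var 0)
    (p := .ite (.conj (.neg (.eq (.get 11 (.var 10)) (.lit 0)))
      (.eq (.get 12 (.get 11 (.var 10))) (.add (.get 0 (.var 10)) (.lit 1))))
    (.setArr 3 (.var 10) (.lit 1)) (.setArr 3 (.var 10) (.lit 0))) (s := s)
    (fun i s' => ∀ v < i, s'.arr 3 v ≠ 0 ↔
      s.arr 11 v ≠ 0 ∧ s.arr 12 (s.arr 11 v) = s.arr 0 v + 1)
    (s.num 0) rfl (by simp) (by
      intro i hi s' hF hI v hv
      have ea0 : s'.arr 0 = s.arr 0 := hF.arr 0 rfl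
      have ea11 : s'.arr 11 = s.arr 11 := hF.arr 11 rfl
      have ea12 : s'.arr 12 = s.arr 12 := hF.arr 12 rfl
      by_cases hc : s.arr 11 i ≠ 0 ∧ s.arr 12 (s.arr 11 i) = s.arr 0 i + 1
      · rw [Prog.run_ite_pos _ _ _ _ (by simpa [ea0, ea11, ea12] using hc)]
        by_cases hvi : v = i
        · simpa [hvi] using hc
        · simpa [hvi] using hI v (by omega)
      · rw [Prog.run_ite_neg _ _ _ _ (by simpa [ea0, ea11, ea12] using hc)]
        by_cases hvi : v = i
        · simpa [hvi] using hc
        · simpa [hvi] using hI v (by omega))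
  unfold outProg
  rw [Prog.run_seq]
  have hF := Prog.frame δ (.loop 10 (.var 0) (.ite (.conj (.neg (.eq (.get 11 (.var 10)) (.lit 0)))
      (.eq (.get 12 (.get 11 (.var 10))) (.add (.get 0 (.var 10)) (.lit 1))))
    (.setArr 3 (.var 10) (.lit 1)) (.setArr 3 (.var 10) (.lit 0)))) s
  generalize Prog.run δ (.loop 10 (.var 0) _) s = s1 at key hF ⊢
  have e2 : s1.num 2 = s.num 2 := hF.num 2 rfl
  have e9 : s1.num 9 = s.num 9 := hF.num 9 rfl
  have e20 : s1.num 20 = s.num 20 := hF.num 20 rfl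
  by_cases hc : s.num 20 = s.num 2
  · rw [Prog.run_ite_pos _ _ _ _ (by simpa [e2, e20] using hc), if_pos hc]
    exact ⟨key, by simp⟩
  · rw [Prog.run_ite_neg _ _ _ _ (by simpa [e2, e20] using hc), if_neg hc]
    exact ⟨key, e9⟩

/-- The store from which the assignment is computed when the clusters are given by `cl`. -/
noncomputable def coreStore {V : Type u} [Fintype V] {m : ℕ} (I : Problem V m)
    (e : V ≃ Fin (Fintype.card V)) (cl : ℕ → ℕ) : Store :=
  { inputStore I e 0 0 0 0 with arr := Function.update (inputStore I e 0 0 0 0).arr 11 cl }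

/-- The variables that the assignment step reads. -/
def coreNums : List ℕ := [0, 1, 2, 10, 20, 21, 22, 25, 26, 27, 29, 30, 31]

/-- The arrays that the assignment step reads. -/
def coreArrs : List ℕ := [0, 1, 2, 11, 12, 13, 14, 15]

/-- The comparison store is built from the input and the cluster array only. Together with
`Prog.run_agree`, this makes the assignment a function of the clusters. -/
theorem agree_prepareProg {V : Type u} [Fintype V] {m : ℕ} {I : Problem V m}
    {e : V ≃ Fin (Fintype.card V)} {δ : ℕ → ℕ → ℝ} {s : Store} (hs : WorkBounded s)
    (hnum : ∀ x ≤ 2, s.num x = (inputStore I e 0 0 0 0).num x)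
    (harr : ∀ a ≤ 2, s.arr a = (inputStore I e 0 0 0 0).arr a) :
    Agree (fun x => coreNums.contains x) (fun a => coreArrs.contains a) (prepareProg.run δ s)
      (coreStore I e (s.arr 11)) := by
  obtain ⟨b1, -, -⟩ := keepsBounded_clearProg (a := 12) δ s hs
  obtain ⟨b2, -, -⟩ := keepsBounded_clearProg (a := 13) δ _ b1
  obtain ⟨b3, -, -⟩ := keepsBounded_clearProg (a := 14) δ _ b2
  have c12 := clearProg_run (δ := δ) (a := 12) (by decide) (by decide) hs
  have c13 := clearProg_run (δ := δ) (a := 13) (by decide) (by decide) b1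
  have c14 := clearProg_run (δ := δ) (a := 14) (by decide) (by decide) b2
  have c15 := clearProg_run (δ := δ) (a := 15) (by decide) (by decide) b3
  have f1 := Prog.frame δ (clearProg 12) s
  unfold prepareProg
  rw [Prog.run_seq, Prog.run_seq, Prog.run_seq, Prog.run_seq]
  generalize (clearProg 12).run δ s = s1 at c12 c13 c14 c15 f1 ⊢
  have f2 := Prog.frame δ (clearProg 13) s1
  generalize (clearProg 13).run δ s1 = s2 at c13 c14 c15 f2 ⊢
  have f3 := Prog.frame δ (clearProg 14) s2
  generalize (clearProg 14).run δ s2 = s3 at c14 c15 f3 ⊢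
  have f4 := Prog.frame δ (clearProg 15) s3
  generalize (clearProg 15).run δ s3 = s4 at c15 f4 ⊢
  have n0 := (f4.num 0 rfl).trans ((f3.num 0 rfl).trans ((f2.num 0 rfl).trans (f1.num 0 rfl)))
  have n1 := (f4.num 1 rfl).trans ((f3.num 1 rfl).trans ((f2.num 1 rfl).trans (f1.num 1 rfl)))
  have n2 := (f4.num 2 rfl).trans ((f3.num 2 rfl).trans ((f2.num 2 rfl).trans (f1.num 2 rfl)))
  have r0 := (f4.arr 0 rfl).trans ((f3.arr 0 rfl).trans ((f2.arr 0 rfl).trans (f1.arr 0 rfl)))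
  have r1 := (f4.arr 1 rfl).trans ((f3.arr 1 rfl).trans ((f2.arr 1 rfl).trans (f1.arr 1 rfl)))
  have r2 := (f4.arr 2 rfl).trans ((f3.arr 2 rfl).trans ((f2.arr 2 rfl).trans (f1.arr 2 rfl)))
  have r11 := (f4.arr 11 rfl).trans
    ((f3.arr 11 rfl).trans ((f2.arr 11 rfl).trans (f1.arr 11 rfl)))
  have r12 := (f4.arr 12 rfl).trans ((f3.arr 12 rfl).trans (f2.arr 12 rfl))
  have r13 := (f4.arr 13 rfl).trans (f3.arr 13 rfl)
  have r14 := f4.arr 14 rfl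
  have hnum0 := hnum 0 (by decide)
  have hnum1 := hnum 1 (by decide)
  have hnum2 := hnum 2 (by decide)
  have harr0 := harr 0 (by decide)
  have harr1 := harr 1 (by decide)
  have harr2 := harr 2 (by decide)
  constructor
  · intro x hx
    simp only [coreNums, List.contains_cons, List.contains_nil, Bool.or_false, Bool.or_eq_true,
      beq_iff_eq] at hx
    rcases hx with rfl | rfl | rfl | rfl | rfl | rfl | rfl | rfl | rfl | rfl | rfl | rfl | rfl <;>
      simp [n0, n1, n2, hnum0, hnum1, hnum2, coreStore, inputStore]
  · intro a ha
    simp only [coreArrs, List.contains_cons, List.contains_nil, Bool.or_false, Bool.or_eq_true,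
      beq_iff_eq] at ha
    rcases ha with rfl | rfl | rfl | rfl | rfl | rfl | rfl | rfl <;>
      simp [r0, r1, r2, r11, r12, r13, r14, harr0, harr1, harr2, coreStore]
    all_goals funext i; simp [inputStore, c12, c13, c14, c15]


/-! ### The rule that the program follows -/

/-- Flow values are at most N. A rule has to answer for every family of sets, also for those that no
array of clusters represents. -/
theorem exists_isMaxFlow {V : Type u} {m N : ℕ} (I : Problem V m) (D : Fin N → Finset V) :
    ∃ f, IsMaxFlow I D f := by
  classical
  let P : ℕ → Prop := fun v => ∃ f, IsFlow I D f ∧ f.value = v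
  have h0 : P 0 := ⟨⟨0, 0, 0, 0, 0⟩, ⟨fun _ => Nat.zero_le _, fun _ _ => Nat.zero_le _,
    fun _ => Nat.zero_le _, fun _ => Nat.zero_le _, Nat.zero_le _, by simp, by simp, by simp⟩,
    by simp [EdgeFlow.value]⟩
  obtain ⟨f, hf, hv⟩ := Nat.findGreatest_spec (P := P) (Nat.zero_le N) h0
  refine ⟨f, hf, fun g hg => ?_⟩
  rw [hv]
  refine Nat.le_findGreatest ?_ ⟨g, hg, rfl⟩
  rw [EdgeFlow.value]
  exact (Finset.sum_le_sum fun i _ => hg.fromSource_le i).trans (by simp)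

/-- The assignment of the clusters given by `cl`. -/
noncomputable def coreAssign {V : Type u} [Fintype V] {m : ℕ} (δ : ℕ → ℕ → ℝ) (I : Problem V m)
    (e : V ≃ Fin (Fintype.card V)) (cl : ℕ → ℕ) : ℕ → ℕ :=
  (coreProg.run δ (coreStore I e cl)).arr 12

section Rule

variable {V : Type u} [Fintype V] {m N : ℕ} {I : Problem V m} {e : V ≃ Fin (Fintype.card V)}
  {D : Fin N → Finset V} {cl cl' : ℕ → ℕ} (δ : ℕ → ℕ → ℝ)

/-- Hence an answer computed from the array is well defined as a function of the family `D`. -/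
theorem Represents.unique {col : ℕ → ℕ} (h : Represents I e D col cl)
    (h' : Represents I e D col cl') (h0 : ∀ v, Fintype.card V ≤ v → cl v = 0)
    (h0' : ∀ v, Fintype.card V ≤ v → cl' v = 0) : cl = cl' := by
  funext v
  by_cases hv : v < Fintype.card V
  · obtain ⟨w, rfl⟩ : ∃ w, v = (e w : ℕ) := ⟨e.symm ⟨v, hv⟩, by simp⟩
    have key : ∀ t, cl (e w) = t + 1 ↔ cl' (e w) = t + 1 := fun t =>
      (h.cluster w t).trans (h'.cluster w t).symm
    rcases Nat.eq_zero_or_pos (cl (e w)) with h1 | h1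
    · rcases Nat.eq_zero_or_pos (cl' (e w)) with h2 | h2
      · omega
      · have := (key (cl' (e w) - 1)).2 (by omega)
        omega
    · have := (key (cl (e w) - 1)).1 (by omega)
      omega
  · rw [h0 v (by omega), h0' v (by omega)]

theorem isMaxFlow_coreAssign (hlu : ∀ i, I.lower i ≤ I.upper i)
    (hR : Represents I e D ((inputStore I e 0 0 0 0).arr 0) cl) (hN : N ≤ Fintype.card V) :
    IsMaxFlow I D (flowOf I N (coreAssign δ I e cl)) ∧
      (flowOf I N (coreAssign δ I e cl)).value = (coreProg.run δ (coreStore I e cl)).num 20 := by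
  have e0 : (coreStore I e cl).num 0 = Fintype.card V := rfl
  have e1 : (coreStore I e cl).num 1 = m := rfl
  have e2 : (coreStore I e cl).num 2 = I.k := rfl
  have e20 : (coreStore I e cl).num 20 = 0 := rfl
  have ea0 : (coreStore I e cl).arr 0 = (inputStore I e 0 0 0 0).arr 0 := by simp [coreStore]
  have ea1 : ∀ j : Fin m, (coreStore I e cl).arr 1 j = I.lower j := by
    simp [coreStore, inputStore]
  have ea2 : ∀ j : Fin m, (coreStore I e cl).arr 2 j = I.upper j := by
    simp [coreStore, inputStore]
  have ea11 : (coreStore I e cl).arr 11 = cl := by simp [coreStore]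
  have hcore := coreProg_run (δ := δ) (s := coreStore I e cl)
    (by rw [e0, e1, ea0]; exact hR.col_lt)
    (by rw [e0, ea11]; exact fun v hv => (hR.cl_le v hv).trans hN)
    (by rw [e1]; exact fun j hj => by rw [ea1 ⟨j, hj⟩, ea2 ⟨j, hj⟩]; exact hlu _)
    (by intro i; simp [coreStore, inputStore]) (by intro i; simp [coreStore, inputStore]) e20
  rw [e0, e1, e2, ea0, ea11] at hcore
  obtain ⟨hM, a₁, cnt₁, count₁, hM₁, hS₁, hcnt, hcount, hS⟩ := hcore
  have hsum : ∑ j ∈ Finset.range m, (coreStore I e cl).arr 1 j = ∑ j, I.lower j := by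
    rw [Finset.sum_range]
    exact Finset.sum_congr rfl fun j _ => ea1 j
  rw [hsum] at hcount hS
  exact isMaxFlow_flowOf hlu hM hR hN hM₁ ea1 ea2 hS₁ hcnt hcount hS

variable (I e) in
open Classical in
theorem exists_assignRule [Nonempty V] (hlu : ∀ i, I.lower i ≤ I.upper i) :
    ∃ A : AssignRule I, ∀ (N : ℕ) (D : Fin N → Finset V) (cl : ℕ → ℕ), N ≤ Fintype.card V →
      Represents I e D ((inputStore I e 0 0 0 0).arr 0) cl →
      (∀ v, Fintype.card V ≤ v → cl v = 0) → A.solve D = flowOf I N (coreAssign δ I e cl) := by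
  have hmax : ∀ {N : ℕ} (D : Fin N → Finset V), ∃ f : EdgeFlow N m, IsMaxFlow I D f ∧
      ∀ cl : ℕ → ℕ, N ≤ Fintype.card V → Represents I e D ((inputStore I e 0 0 0 0).arr 0) cl →
      (∀ v, Fintype.card V ≤ v → cl v = 0) → f = flowOf I N (coreAssign δ I e cl) := by
    intro N D
    by_cases h : ∃ cl : ℕ → ℕ, N ≤ Fintype.card V ∧
        Represents I e D ((inputStore I e 0 0 0 0).arr 0) cl ∧
        ∀ v, Fintype.card V ≤ v → cl v = 0
    · obtain ⟨cl, hN, hR, h0⟩ := h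
      refine ⟨_, (isMaxFlow_coreAssign δ hlu hR hN).1, fun cl' _ hR' h0' => ?_⟩
      rw [hR.unique hR' h0 h0']
    · obtain ⟨f, hf⟩ := exists_isMaxFlow I D
      exact ⟨f, hf, fun cl hN hR h0 => absurd ⟨cl, hN, hR, h0⟩ h⟩
  refine ⟨⟨fun D => (hmax D).choose, fun D => (hmax D).choose_spec.1,
    fun A => if hA : A.Nonempty then hA.choose else Classical.arbitrary V, fun A hA => ?_⟩,
    fun N D cl => (hmax D).choose_spec.2 cl⟩
  rw [dif_pos hA]
  exact hA.choose_spec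

end Rule

/-- Compute an assignment of colors to the clusters, and its set of points. -/
def assignProg : Prog := prepareProg ;; coreProg ;; outProg

theorem coreProg_readsIn :
    coreProg.readsIn (fun x => coreNums.contains x) (fun a => coreArrs.contains a) = true := by
  decide

open Classical in
-- By `hone` a cluster has at most one point of each color, so the rule has no freedom in its
-- representatives. Writing out all points whose color is assigned to their cluster gives the
-- extracted set.
theorem assignProg_run {V : Type u} [Fintype V] {m N : ℕ} {I : Problem V m}
    {e : V ≃ Fin (Fintype.card V)} {D : Fin N → Finset V} {δ : ℕ → ℕ → ℝ} {A : AssignRule I}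
    (hk : ∑ i, I.lower i ≤ I.k) (hlu : ∀ i, I.lower i ≤ I.upper i)
    (hA : ∀ (N : ℕ) (D : Fin N → Finset V) (cl : ℕ → ℕ), N ≤ Fintype.card V →
      Represents I e D ((inputStore I e 0 0 0 0).arr 0) cl →
      (∀ v, Fintype.card V ≤ v → cl v = 0) → A.solve D = flowOf I N (coreAssign δ I e cl))
    (hN : N ≤ Fintype.card V)
    (hone : ∀ i, ∀ u ∈ D i, ∀ v ∈ D i, I.color u = I.color v → u = v)
    (hdisj : ∀ i j v, v ∈ D i → v ∈ D j → i = j) {s : Store} (hs : WorkBounded s)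
    (hnum : ∀ x ≤ 2, s.num x = (inputStore I e 0 0 0 0).num x)
    (harr : ∀ a ≤ 2, s.arr a = (inputStore I e 0 0 0 0).arr a)
    (hR : Represents I e D ((inputStore I e 0 0 0 0).arr 0) (s.arr 11))
    (h0 : ∀ v, Fintype.card V ≤ v → s.arr 11 v = 0) :
    WorkBounded (assignProg.run δ s) ∧ outputSet e (assignProg.run δ s) = extract I A D ∧
      (assignProg.run δ s).num 9 = if I.Feasible (extract I A D) then 1 else s.num 9 := by
  obtain ⟨b1, -, -⟩ := keepsBounded_prepareProg δ s hs
  obtain ⟨b2, -, -⟩ := keepsBounded_coreProg δ _ b1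
  obtain ⟨b3, -, -⟩ := keepsBounded_outProg δ _ b2
  have hagree := Prog.run_agree δ coreProg coreProg_readsIn
    (agree_prepareProg (I := I) (e := e) (δ := δ) hs hnum harr)
  have f1 := Prog.frame δ prepareProg s
  have hsolve := hA N D (s.arr 11) hN hR h0
  have hval := (isMaxFlow_coreAssign δ hlu hR hN).2
  unfold assignProg
  rw [Prog.run_seq, Prog.run_seq]
  generalize prepareProg.run δ s = s1 at f1 b3 hagree ⊢
  have f2 := Prog.frame δ coreProg s1
  generalize coreProg.run δ s1 = s2 at f2 b3 hagree ⊢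
  have h12 : s2.arr 12 = coreAssign δ I e (s.arr 11) := hagree.arr 12 rfl
  have h20 := hagree.num 20 rfl
  have n0 : s2.num 0 = Fintype.card V :=
    (f2.num 0 rfl).trans ((f1.num 0 rfl).trans (hnum 0 (by decide)))
  have n2 : s2.num 2 = I.k := (f2.num 2 rfl).trans ((f1.num 2 rfl).trans (hnum 2 (by decide)))
  have n9 : s2.num 9 = s.num 9 := (f2.num 9 rfl).trans (f1.num 9 rfl)
  have a0 : s2.arr 0 = (inputStore I e 0 0 0 0).arr 0 :=
    (f2.arr 0 rfl).trans ((f1.arr 0 rfl).trans (harr 0 (by decide)))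
  have a11 : s2.arr 11 = s.arr 11 := (f2.arr 11 rfl).trans (f1.arr 11 rfl)
  obtain ⟨hout, hdone⟩ := outProg_run (δ := δ) (s := s2)
  refine ⟨b3, ?_, ?_⟩
  · ext v
    rw [outputSet, Finset.mem_filter, hout _ (by rw [n0]; exact (e v).2), a11, h12, a0,
      hR.color, mem_extract, hsolve]
    constructor
    · rintro ⟨-, hcl, ha⟩
      obtain ⟨t, ht⟩ := Nat.exists_eq_succ_of_ne_zero hcl
      obtain ⟨hlt, hv⟩ := (hR.cluster v t).1 ht
      have hpos : 0 < (flowOf I N (coreAssign δ I e (s.arr 11))).assign ⟨t, hlt⟩ (I.color v) := by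
        rw [ht] at ha
        simp [flowOf, ha]
      refine ⟨⟨t, hlt⟩, I.color v, hpos, ?_⟩
      rw [← hsolve] at hpos
      have := A.rep_mem_of_assign hpos
      exact hone _ _ this.1 _ hv this.2
    · rintro ⟨i, j, hpos, rfl⟩
      rw [← hsolve] at hpos
      have hrep := A.rep_mem_of_assign hpos
      rw [hsolve] at hpos
      have hcl := (hR.cluster _ i).2 ⟨i.2, hrep.1⟩
      have ha : coreAssign δ I e (s.arr 11) (i + 1) = j + 1 := by
        by_contra hne
        simp [flowOf, hne] at hpos
      rw [hcl, hrep.2]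
      exact ⟨Finset.mem_univ _, by omega, ha⟩
  · rw [hdone, n2, n9, h20]
    refine if_congr ?_ rfl rfl
    rw [feasible_extract_iff A hdisj hk hlu, hsolve, hval]


/-! ### One repetition -/

section Repetition

variable {V : Type u} [Fintype V] [MetricSpace V] {m : ℕ} {I : Problem V m}
  {e : V ≃ Fin (Fintype.card V)} {U : Finset V} {γ : ℝ} {T : ℕ} {ε : Fin U.card ≃ U}

variable (I e U γ T ε) in
/-- The store holds the input, the pruned set and the radii. -/
structure Ready (s : Store) : Prop where
  num : ∀ x ≤ 2, s.num x = (inputStore I e 0 0 0 0).num x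
  arr : ∀ a ≤ 2, s.arr a = (inputStore I e 0 0 0 0).arr a
  num_four : s.num 4 = T
  card : s.num 6 = U.card
  lower_radius : s.num 7 = Δ₁ m
  upper_radius : s.num 8 = Δ₂ m
  threshold : s.real 3 = γ * alpha m
  selected : ∀ v, s.arr 5 (e v) ≠ 0 ↔ v ∈ U
  list : ∀ t : Fin U.card, s.arr 6 t = e (ε t)
  outside : ∀ v, Fintype.card V ≤ v → s.arr 11 v = 0
  bounded : WorkBounded s

theorem isDistFrom_edist {c : V} {E : ℕ → ℕ∞} {r : ℝ}
    (hE : ∀ v, E (e v) = (nearGraph U r).edist c v) :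
    IsDistFrom (Fintype.card V)
      (fun v w => ∃ x y : V, v = e x ∧ w = e y ∧ x ∈ U ∧ y ∈ U ∧ dist x y < r) (e c) E := by
  have hlift : ∀ v < Fintype.card V, ∃ x, v = (e x : ℕ) := fun v hv => ⟨e.symm ⟨v, hv⟩, by simp⟩
  refine ⟨(e c).2, fun w hw => ?_, fun v hv w hw => ?_, fun w hw d hd => ?_⟩
  · obtain ⟨y, rfl⟩ := hlift w hw
    rw [hE, SimpleGraph.edist_eq_zero_iff, Fin.val_inj, e.injective.eq_iff, eq_comm]
  · rintro ⟨x, y, rfl, rfl, hx, hy, hxy⟩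
    rw [hE, hE]
    -- The program's adjacency test also holds for equal points, unlike that of the graph; such
    -- loops do not change distances.
    by_cases h : x = y
    · rw [h]; exact le_self_add
    · refine SimpleGraph.edist_triangle.trans (add_le_add_right ?_ _)
      exact (SimpleGraph.edist_eq_one_iff_adj.2
        (show (nearGraph U r).Adj x y from ⟨h, hx, hy, hxy⟩)).le
  · obtain ⟨y, rfl⟩ := hlift w hw
    rw [hE] at hd
    obtain ⟨x, hadj, hx⟩ := exists_adj_edist_eq hd
    exact ⟨e x, (e x).2, ⟨x, y, rfl, rfl, hadj.2.1, hadj.2.2.1, hadj.2.2.2⟩, by rw [hE, hx]⟩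

/-- The enumeration in use is the drawn permutation of positions followed by the fixed list `ε` of
the pruned set. Separation of the colors bounds the balls by m points, as the search requires. -/
theorem represents_decomposeProg (hγ : 0 < γ)
    (hU : ∀ u ∈ U, ∀ v ∈ U, I.color u = I.color v → u ≠ v → γ ≤ dist u v) {s : Store}
    (hs : Ready I e U γ T ε s) {σ : Equiv.Perm (Fin U.card)}
    (hσ : ∀ t : Fin U.card, s.arr 7 t = σ t) (hR : s.num 14 ≤ Δ₂ m) :
    Represents I e (cluster U (nearGraph U (γ * alpha m)) (σ.trans ε) (s.num 14))
      ((inputStore I e 0 0 0 0).arr 0) ((decomposeProg.run (distByIndex e) s).arr 11) ∧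
    ∀ v, Fintype.card V ≤ v → (decomposeProg.run (distByIndex e) s).arr 11 v = 0 := by
  have n0 : s.num 0 = Fintype.card V := hs.num 0 (by decide)
  have n1 : s.num 1 = m := hs.num 1 (by decide)
  let E : ℕ → ℕ → ℕ∞ := fun t v => if h : t < U.card ∧ v < Fintype.card V then
    (nearGraph U (γ * alpha m)).edist (ε (σ ⟨t, h.1⟩) : V) (e.symm ⟨v, h.2⟩) else ⊤
  have hE : ∀ (t : Fin U.card) (v : V),
      E t (e v) = (nearGraph U (γ * alpha m)).edist (ε (σ t) : V) v := fun t v => by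
    simp [E]
  have hcenter : ∀ t : Fin U.card, s.arr 6 (s.arr 7 t) = e (ε (σ t)) := fun t => by
    rw [hσ, hs.list]
  have hball : ∀ (t : Fin U.card) (v : V),
      v ∈ ball U (nearGraph U (γ * alpha m)) (ε (σ t)) (s.num 14) ↔ E t (e v) ≤ s.num 14 :=
    fun t v => by
      rw [mem_ball, hE, and_iff_right_iff_imp]
      exact fun h => nearGraph_mem_of_edist (ε (σ t)).2
        (ne_top_of_le_ne_top (ENat.natCast_ne_top _) h)
  have hrun := decomposeProg_run (δ := distByIndex e) (s := s) (E := E)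
    (A := fun v w => ∃ x y : V, v = e x ∧ w = e y ∧ x ∈ U ∧ y ∈ U ∧ dist x y < γ * alpha m)
    (by rw [n0, hs.card]; exact Finset.card_le_univ _)
    (fun j hj => by
      rw [hs.card] at hj
      rw [n0, hcenter ⟨j, hj⟩]
      exact isDistFrom_edist (hE ⟨j, hj⟩))
    (fun v hv w hw => by
      rw [n0] at hv hw
      obtain ⟨x, rfl⟩ : ∃ x, v = (e x : ℕ) := ⟨e.symm ⟨v, hv⟩, by simp⟩
      obtain ⟨y, rfl⟩ : ∃ y, w = (e y : ℕ) := ⟨e.symm ⟨w, hw⟩, by simp⟩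
      rw [hs.selected, hs.selected, hs.threshold, distByIndex_apply]
      constructor
      · rintro ⟨x', y', hx, hy, h⟩
        rw [Fin.val_inj, e.injective.eq_iff] at hx hy
        rwa [hx, hy]
      · exact fun h => ⟨x, y, rfl, rfl, h⟩)
    (fun j hj => by
      rw [hs.card] at hj
      rw [hcenter ⟨j, hj⟩, hs.selected]
      exact (ε (σ ⟨j, hj⟩)).2)
    (fun j hj => by
      classical
      rw [hs.card] at hj
      rw [n0, n1]
      refine le_trans ?_ (card_ball_le (I := I) hγ hU hR (ε (σ ⟨j, hj⟩) : V))
      refine le_trans (Finset.card_le_card (t := (ball U (nearGraph U (γ * alpha m))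
        (ε (σ ⟨j, hj⟩)) (s.num 14)).image fun v => (e v : ℕ)) fun w hw => ?_)
        Finset.card_image_le
      rw [Finset.mem_filter, Finset.mem_range] at hw
      exact Finset.mem_image.2 ⟨e.symm ⟨w, hw.1⟩, (hball ⟨j, hj⟩ _).2 (by simpa using hw.2),
        by simp⟩)
    (by rw [n0]; exact hs.outside)
  rw [n0, hs.card] at hrun
  refine ⟨⟨fun v => by simp [inputStore], fun v t => ?_⟩, hrun.2⟩
  rw [hrun.1 (e v) (e v).2 t]
  constructor
  · rintro ⟨ht, hlt, hmin⟩
    refine ⟨ht, mem_cluster.2 ⟨⟨(hball ⟨t, ht⟩ v).2 hlt.le, fun i hi h => ?_⟩, ?_⟩⟩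
    · exact hmin i hi ((hball i v).1 h)
    · rw [hE ⟨t, ht⟩ v] at hlt
      exact hlt
  · rintro ⟨ht, hv⟩
    rw [mem_cluster] at hv
    refine ⟨ht, ?_, fun t' ht' h => ?_⟩
    · rw [hE ⟨t, ht⟩ v]
      exact hv.2
    · exact hv.1.2 ⟨t', ht'.trans ht⟩ ht' ((hball ⟨t', ht'.trans ht⟩ v).2 h)

/-- The part of a repetition that draws no random numbers. -/
def computeProg : Prog := decomposeProg ;; assignProg

/-- A repetition of the two steps. -/
def repetitionProg : Prog :=
  .ite (.lt (.var 6) (.add (.var 0) (.lit 1))) (.shuffle 7 (.var 6)) .skip ;;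
  .rand 14 (.sub (.var 8) (.var 7)) ;; .setNum 14 (.add (.var 14) (.var 7)) ;; computeProg

open Classical in
theorem computeProg_run {A : AssignRule I}
    (hk : ∑ i, I.lower i ≤ I.k) (hlu : ∀ i, I.lower i ≤ I.upper i)
    (hA : ∀ (N : ℕ) (D : Fin N → Finset V) (cl : ℕ → ℕ), N ≤ Fintype.card V →
      Represents I e D ((inputStore I e 0 0 0 0).arr 0) cl →
      (∀ v, Fintype.card V ≤ v → cl v = 0) →
      A.solve D = flowOf I N (coreAssign (distByIndex e) I e cl)) (hγ : 0 < γ)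
    (hU : ∀ u ∈ U, ∀ v ∈ U, I.color u = I.color v → u ≠ v → γ ≤ dist u v) {s : Store}
    (hs : Ready I e U γ T ε s) {σ : Equiv.Perm (Fin U.card)}
    (hσ : ∀ t : Fin U.card, s.arr 7 t = σ t) (hR : s.num 14 ≤ Δ₂ m) :
    Ready I e U γ T ε (computeProg.run (distByIndex e) s) ∧
    outputSet e (computeProg.run (distByIndex e) s) =
      extract I A (cluster U (nearGraph U (γ * alpha m)) (σ.trans ε) (s.num 14)) ∧
    (computeProg.run (distByIndex e) s).num 9 =
      if I.Feasible (extract I A (cluster U (nearGraph U (γ * alpha m)) (σ.trans ε) (s.num 14)))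
      then 1 else s.num 9 := by
  obtain ⟨hrep, h0⟩ := represents_decomposeProg hγ hU hs hσ hR
  have f := Prog.frame (distByIndex e) computeProg s
  have f1 := Prog.frame (distByIndex e) decomposeProg s
  unfold computeProg at f ⊢
  rw [Prog.run_seq] at f ⊢
  generalize decomposeProg.run (distByIndex e) s = s1 at f f1 hrep h0 ⊢
  have hnum : ∀ x ≤ 2, s1.num x = (inputStore I e 0 0 0 0).num x := fun x hx => by
    rw [← hs.num x hx]
    interval_cases x <;> exact f1.num _ rfl
  have harr : ∀ a ≤ 2, s1.arr a = (inputStore I e 0 0 0 0).arr a := fun a ha => by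
    rw [← hs.arr a ha]
    interval_cases a <;> exact f1.arr _ rfl
  have hb : WorkBounded s1 := fun a ha ha' i hi => by
    rw [f1.num 0 rfl, f1.num 1 rfl] at hi
    have := hs.bounded a ha ha' i hi
    interval_cases a <;> rwa [f1.arr _ rfl]
  obtain ⟨hb2, hout, hdone⟩ := assignProg_run hk hlu hA (Finset.card_le_univ U)
    (fun i u hu v hv => eq_of_mem_ball_of_color (I := I) hγ hU hR (cluster_subset_ball hu)
      (cluster_subset_ball hv))
    (fun i j v => cluster_disjoint) hb hnum harr hrep h0
  have f2 := Prog.frame (distByIndex e) assignProg s1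
  generalize assignProg.run (distByIndex e) s1 = s2 at f f2 hb2 hout hdone ⊢
  refine ⟨⟨fun x hx => ?_, fun a ha => ?_, (f.num 4 rfl).trans hs.num_four,
    (f.num 6 rfl).trans hs.card, (f.num 7 rfl).trans hs.lower_radius,
    (f.num 8 rfl).trans hs.upper_radius, (f.real 3 rfl).trans hs.threshold, fun v => ?_,
    fun t => ?_, fun v hv => ?_, hb2⟩, hout, ?_⟩
  · rw [← hs.num x hx]
    interval_cases x <;> exact f.num _ rfl
  · rw [← hs.arr a ha]
    interval_cases a <;> exact f.arr _ rfl
  · rw [f.arr 5 rfl, hs.selected]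
  · rw [f.arr 6 rfl, hs.list]
  · rw [f2.arr 11 rfl, h0 v hv]
  · rw [hdone, f1.num 9 rfl]

end Repetition


/-! ### The law of the result of a repetition -/

/-- Used to turn a uniform permutation of positions into a uniform enumeration of the pruned set. -/
theorem uniformOfFintype_map_equiv {α β : Type*} [Fintype α] [Fintype β] [Nonempty α] [Nonempty β]
    (f : α ≃ β) : (PMF.uniformOfFintype α).map f = PMF.uniformOfFintype β := by
  classical
  ext b
  rw [PMF.map_apply, tsum_eq_single (f.symm b)]
  · simp [Fintype.card_congr f]
  · intro a ha
    rw [if_neg fun h => ha (by rw [h, Equiv.symm_apply_apply])]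

theorem uniformOfFintype_map_add {a b : ℕ} (h : a ≤ b) :
    (PMF.uniformOfFintype (Fin (b - a + 1))).map (fun v : Fin (b - a + 1) => (v : ℕ) + a) =
      PMF.uniformOfFinset (Finset.Icc a b) (Finset.nonempty_Icc.2 h) := by
  classical
  ext R
  rw [PMF.map_apply, PMF.uniformOfFinset_apply]
  by_cases hR : R ∈ Finset.Icc a b
  · rw [if_pos hR]
    rw [Finset.mem_Icc] at hR
    rw [tsum_eq_single (⟨R - a, by omega⟩ : Fin (b - a + 1))]
    · rw [if_pos (by dsimp only; omega), PMF.uniformOfFintype_apply, Fintype.card_fin, Nat.card_Icc,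
        show b - a + 1 = b + 1 - a by omega]
    · intro v hv
      rw [if_neg fun h => hv (Fin.ext (by dsimp only; omega))]
  · rw [if_neg hR, ENNReal.tsum_eq_zero]
    intro v
    rw [Finset.mem_Icc] at hR
    exact if_neg fun h => hR (by omega)

theorem PMF_bind_congr {α β : Type*} {p : PMF α} {f g : α → PMF β}
    (h : ∀ a ∈ p.support, f a = g a) : p.bind f = p.bind g := by
  ext b
  rw [PMF.bind_apply, PMF.bind_apply]
  refine tsum_congr fun a => ?_
  by_cases ha : p a = 0
  · rw [ha, zero_mul, zero_mul]
  · rw [h a ((PMF.mem_support_iff _ _).2 ha)]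

theorem Prog.exec_shuffle {δ : ℕ → ℕ → ℝ} {a : ℕ} {e : NatExpr} {s : Store} {N : ℕ}
    (h : e.eval s = N) : (shuffle a e).exec δ s =
      (PMF.uniformOfFintype (Equiv.Perm (Fin N))).map fun σ =>
        Store.tick { s with
          arr := Function.update s.arr a fun i =>
            if h : i < N then (σ ⟨i, h⟩ : ℕ) else s.arr a i } (e.cost + N + 1) := by
  subst h; rfl

theorem Prog.exec_rand {δ : ℕ → ℕ → ℝ} {x : ℕ} {e : NatExpr} {s : Store} {N : ℕ}
    (h : e.eval s = N) : (rand x e).exec δ s =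
      (PMF.uniformOfFintype (Fin (N + 1))).map fun v : Fin (N + 1) =>
        (s.setNum x v).tick (e.cost + 1) := by
  subst h
  exact PMF.map_comp (f := fun v : Fin (e.eval s + 1) => (v : ℕ))
    (p := PMF.uniformOfFintype _) (fun v => (s.setNum x v).tick (e.cost + 1))

theorem Prog.exec_seq {δ : ℕ → ℕ → ℝ} {p q : Prog} {s : Store} :
    (seq p q).exec δ s = (p.exec δ s).bind (q.exec δ) := rfl

/-- The result of the algorithm at the present moment, and whether it is final. -/
def Store.result {V : Type u} [Fintype V] (e : V ≃ Fin (Fintype.card V)) (s : Store) :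
    Finset V × Bool := (outputSet e s, decide (s.num 9 ≠ 0))

section Repetition

variable {V : Type u} [Fintype V] {m : ℕ} {I : Problem V m}
  {e : V ≃ Fin (Fintype.card V)} {U : Finset V} {γ : ℝ} {T : ℕ} {ε : Fin U.card ≃ U}

/-- Only the array `7` and the variable `14` differ. -/
theorem Ready.of_eq {s s' : Store} (hs : Ready I e U γ T ε s)
    (hnum : ∀ x ≤ 8, s'.num x = s.num x) (harr : ∀ a, a ≠ 7 → s'.arr a = s.arr a)
    (hreal : s'.real = s.real) : Ready I e U γ T ε s' := by
  refine ⟨fun x hx => ?_, fun a ha => ?_, ?_, ?_, ?_, ?_, ?_, ?_, ?_, ?_, ?_⟩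
  · rw [hnum x (by omega), hs.num x hx]
  · rw [harr a (by omega), hs.arr a ha]
  · rw [hnum 4 (by decide), hs.num_four]
  · rw [hnum 6 (by decide), hs.card]
  · rw [hnum 7 (by decide), hs.lower_radius]
  · rw [hnum 8 (by decide), hs.upper_radius]
  · rw [hreal, hs.threshold]
  · rw [harr 5 (by decide)]; exact hs.selected
  · rw [harr 6 (by decide)]; exact hs.list
  · rw [harr 11 (by decide)]; exact hs.outside
  · intro a ha ha' i hi
    rw [hnum 0 (by decide), hnum 1 (by decide)] at hi
    rw [harr a (by omega)]
    exact hs.bounded a ha ha' i hi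

variable [MetricSpace V]

theorem computeProg_det : computeProg.det = true := by decide

theorem repetitionProg_exec {s : Store} (hs : Ready I e U γ T ε s) :
    ∃ st : Equiv.Perm (Fin U.card) → Fin (Δ₂ m - Δ₁ m + 1) → Store,
      repetitionProg.exec (distByIndex e) s =
        (PMF.uniformOfFintype (Equiv.Perm (Fin U.card))).bind (fun σ =>
          (PMF.uniformOfFintype (Fin (Δ₂ m - Δ₁ m + 1))).map fun v =>
            computeProg.run (distByIndex e) (st σ v)) ∧
      ∀ σ v, Ready I e U γ T ε (st σ v) ∧ (∀ t : Fin U.card, (st σ v).arr 7 t = σ t) ∧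
        (st σ v).num 14 = v + Δ₁ m ∧ (st σ v).num 9 = s.num 9 := by
  -- The numbers of steps, 6 and |U| + 2 here and 4 below, are the exact costs of the guard, the
  -- shuffle and the draw of the radius.
  let s₁ : Equiv.Perm (Fin U.card) → Store := fun σ => Store.tick
    { s.tick 6 with
      arr := Function.update s.arr 7 fun i =>
        if h : i < U.card then (σ ⟨i, h⟩ : ℕ) else s.arr 7 i } (1 + U.card + 1)
  have hs₁ : ∀ σ, Ready I e U γ T ε (s₁ σ) := fun σ =>
    hs.of_eq (fun _ _ => rfl) (fun a ha => Function.update_of_ne ha _ _) rfl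
  let s₂ : Equiv.Perm (Fin U.card) → Fin (Δ₂ m - Δ₁ m + 1) → Store := fun σ v =>
    ((s₁ σ).setNum 14 v).tick 4
  have hs₂ : ∀ σ v, Ready I e U γ T ε (s₂ σ v) := fun σ v =>
    (hs₁ σ).of_eq (fun x hx => by
      have : x ≠ 14 := by omega
      simp [s₂, this]) (fun a ha => rfl) rfl
  refine ⟨fun σ v => (Prog.setNum 14 (.add (.var 14) (.var 7))).run (distByIndex e) (s₂ σ v),
    ?_, fun σ v => ⟨?_, fun t => ?_, ?_, ?_⟩⟩
  · have hcard : ∀ t, (NatExpr.var 6).eval (s.tick t) = U.card := fun _ => hs.card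
    unfold repetitionProg
    rw [Prog.exec_seq, Prog.exec_ite_pos _ _ _ _ (by
      have h := hs.num 0 (by decide)
      have h' := hs.card
      have := Finset.card_le_univ U
      change s.num 6 < s.num 0 + 1
      rw [h, h']
      exact Nat.lt_succ_of_le this), Prog.exec_shuffle (hcard _), PMF.bind_map]
    refine congrArg _ (funext fun σ => ?_)
    change (Prog.seq _ _).exec _ (s₁ σ) = _
    rw [Prog.exec_seq, Prog.exec_rand (N := Δ₂ m - Δ₁ m) (by
      rw [NatExpr.eval, NatExpr.eval, NatExpr.eval, (hs₁ σ).upper_radius, (hs₁ σ).lower_radius]),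
      PMF.bind_map, PMF.map]
    refine congrArg _ (funext fun v => ?_)
    change (Prog.seq _ _).exec _ (s₂ σ v) = _
    rw [Prog.exec_seq, Prog.exec_eq_pure _ _ rfl, PMF.pure_bind,
      Prog.exec_eq_pure _ _ computeProg_det]
    rfl
  · exact (hs₂ σ v).of_eq (fun x hx => by
      have : x ≠ 14 := by omega
      simp [this]) (fun a ha => rfl) rfl
  · simp [s₂, s₁]
  · have := (hs₁ σ).lower_radius
    simp [s₂, this]
  · simp [s₂, s₁]

open Classical in
/-- One repetition of the main algorithm, unless the result is final. -/
noncomputable def repeatStep (I : Problem V m) (A : AssignRule I) (U : Finset V) (γ : ℝ) :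
    Finset V × Bool → PMF (Finset V × Bool) := fun x =>
  if x.2 then PMF.pure x
  else (decompose m U γ).map fun D => (extract I A D, decide (I.Feasible (extract I A D)))

open Classical in
-- For each outcome of the two draws, `computeProg_run` identifies the resulting store. The laws
-- match because σ ↦ `σ.trans ε` and v ↦ v + Δ₁ carry uniform laws to uniform laws.
theorem repetitionProg_law {A : AssignRule I}
    (hk : ∑ i, I.lower i ≤ I.k) (hlu : ∀ i, I.lower i ≤ I.upper i)
    (hA : ∀ (N : ℕ) (D : Fin N → Finset V) (cl : ℕ → ℕ), N ≤ Fintype.card V →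
      Represents I e D ((inputStore I e 0 0 0 0).arr 0) cl →
      (∀ v, Fintype.card V ≤ v → cl v = 0) →
      A.solve D = flowOf I N (coreAssign (distByIndex e) I e cl)) (hγ : 0 < γ)
    (hU : ∀ u ∈ U, ∀ v ∈ U, I.color u = I.color v → u ≠ v → γ ≤ dist u v) {s : Store}
    (hs : Ready I e U γ T ε s) (h9 : s.num 9 = 0) :
    (repetitionProg.exec (distByIndex e) s).map (Store.result e) =
      repeatStep I A U γ (s.result e) ∧
    ∀ s' ∈ (repetitionProg.exec (distByIndex e) s).support, Ready I e U γ T ε s' := by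
  obtain ⟨st, hexec, hst⟩ := repetitionProg_exec hs
  have hrun : ∀ σ (v : Fin (Δ₂ m - Δ₁ m + 1)), _ := fun σ v =>
    computeProg_run hk hlu hA hγ hU (hst σ v).1 (hst σ v).2.1 (by
      have := Δ₁_le_Δ₂ m
      rw [(hst σ v).2.2.1]
      omega)
  rw [hexec]
  constructor
  · have hmap : ∀ σ (v : Fin (Δ₂ m - Δ₁ m + 1)),
        Store.result e (computeProg.run (distByIndex e) (st σ v)) =
        (fun D => (extract I A D, decide (I.Feasible (extract I A D))))
          (cluster U (nearGraph U (γ * alpha m)) (σ.trans ε) (v + Δ₁ m)) := fun σ v => by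
      obtain ⟨-, h1, h2⟩ := hrun σ v
      rw [(hst σ v).2.2.2, h9, (hst σ v).2.2.1] at h2
      rw [(hst σ v).2.2.1] at h1
      rw [Store.result, h1, h2]
      refine Prod.ext rfl ?_
      split_ifs with h <;> simp [h]
    have : Nonempty (Fin U.card ≃ U) := ⟨ε⟩
    rw [repeatStep, if_neg (by simp [Store.result, h9]), decompose, PMF.map_bind, PMF.map_bind,
      ← uniformOfFintype_map_equiv (Equiv.equivCongr (Equiv.refl (Fin U.card)) ε), PMF.bind_map]
    refine congrArg _ (funext fun σ => ?_)
    rw [PMF.map_comp, Function.comp_apply, ← uniformOfFintype_map_add (Δ₁_le_Δ₂ m), PMF.map_comp,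
      PMF.map_comp]
    refine congrArg (fun f => PMF.map f _) (funext fun v => ?_)
    exact hmap σ v
  · intro s' hs'
    rw [PMF.mem_support_bind_iff] at hs'
    obtain ⟨σ, -, hs'⟩ := hs'
    rw [PMF.mem_support_map_iff] at hs'
    obtain ⟨v, -, rfl⟩ := hs'
    exact (hrun σ v).1

end Repetition


/-! ### The main program -/

/-- Run a random step `N` times. -/
noncomputable def kernelPow {β : Type*} (f : β → PMF β) : ℕ → β → PMF β
  | 0, x => PMF.pure x
  | N + 1, x => (kernelPow f N x).bind f

section KernelPow

variable {β : Type*} {f : β → PMF β}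

theorem kernelPow_add (N : ℕ) : ∀ (M : ℕ) (x : β),
    kernelPow f (N + M) x = (kernelPow f N x).bind (kernelPow f M)
  | 0, x => (PMF.bind_pure _).symm
  | M + 1, x => by
    rw [← add_assoc, kernelPow, kernelPow_add N M, PMF.bind_bind]
    rfl

theorem kernelPow_succ_left (N : ℕ) (x : β) :
    kernelPow f (N + 1) x = (f x).bind (kernelPow f N) := by
  rw [add_comm, kernelPow_add]
  refine congrArg (fun p => PMF.bind p _) ?_
  exact PMF.pure_bind _ _

/-- The machine does not multiply, so the T·m repetitions are run as two nested loops. -/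
theorem kernelPow_mul (m : ℕ) : ∀ (T : ℕ) (x : β),
    kernelPow (kernelPow f m) T x = kernelPow f (T * m) x
  | 0, x => by rw [zero_mul]; rfl
  | T + 1, x => by
    rw [add_mul, one_mul, kernelPow_add (f := f), ← kernelPow_mul m T]
    rfl

/-- A loop whose body acts on the image of the store as `f` does. -/
theorem iterRounds_law {Good : Store → Prop} {res : Store → β} {x : ℕ} {body : Store → PMF Store}
    (hset : ∀ s i, Good s → Good ((s.setNum x i).tick 1))
    (hres : ∀ s i, res ((s.setNum x i).tick 1) = res s)
    (hbody : ∀ s, Good s → (body s).map res = f (res s) ∧ ∀ s' ∈ (body s).support, Good s') :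
    ∀ (N : ℕ) (s : Store), Good s →
      (iterRounds x body N s).map res = kernelPow f N (res s) ∧
      ∀ s' ∈ (iterRounds x body N s).support, Good s'
  | 0, s, hs => by
    refine ⟨PMF.pure_map _ _, fun s' hs' => ?_⟩
    rw [iterRounds, PMF.support_pure, Set.mem_singleton_iff] at hs'
    rwa [hs']
  | N + 1, s, hs => by
    obtain ⟨ih1, ih2⟩ := iterRounds_law hset hres hbody N s hs
    constructor
    · rw [iterRounds, PMF.map_bind, kernelPow, ← ih1, PMF.bind_map]
      refine PMF_bind_congr fun s' hs' => ?_
      rw [(hbody _ (hset s' N (ih2 s' hs'))).1, hres]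
      rfl
    · intro s' hs'
      rw [iterRounds, PMF.mem_support_bind_iff] at hs'
      obtain ⟨s₁, h₁, h₂⟩ := hs'
      exact (hbody _ (hset s₁ N (ih2 s₁ h₁))).2 s' h₂

end KernelPow

/-- The main algorithm, for a budget that is never exhausted. -/
def mainProg : Prog :=
  pruneProg ;; radiiProg ;;
  .loop 12 (.var 4) (.loop 13 (.var 1) (.ite (.eq (.var 9) (.lit 0)) repetitionProg .skip))

/-! ### Early exit as an absorbing state -/

section RepeatStep

variable {V : Type u} [MetricSpace V] {m : ℕ} {I : Problem V m} {U : Finset V} {γ : ℝ}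

theorem kernelPow_repeatStep_final {A : AssignRule I} (S : Finset V) :
    ∀ N, kernelPow (repeatStep I A U γ) N (S, true) = PMF.pure (S, true)
  | 0 => rfl
  | N + 1 => by
    rw [kernelPow, kernelPow_repeatStep_final S N, PMF.pure_bind, repeatStep]
    rfl

open Classical in
-- The program cannot leave its loops; a flag freezes the set once it is feasible. Further rounds
-- then change nothing, which has the same effect as stopping.
theorem kernelPow_repeatStep {A : AssignRule I} : ∀ (N : ℕ) (S : Finset V),
    (kernelPow (repeatStep I A U γ) N (S, false)).map Prod.fst =
      repeatLoop I (fun _ => A) U γ N S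
  | 0, S => PMF.pure_map _ _
  | N + 1, S => by
    rw [kernelPow_succ_left, PMF.map_bind, repeatLoop, repeatStep, if_neg (by simp), PMF.bind_map]
    refine congrArg _ (funext fun D => ?_)
    dsimp only [Function.comp_apply]
    by_cases h : I.Feasible (extract I A D)
    · rw [if_pos h, decide_eq_true h, kernelPow_repeatStep_final, PMF.pure_map]
    · rw [if_neg h, decide_eq_false h, kernelPow_repeatStep]

end RepeatStep

section Main

variable {V : Type u} [Fintype V] [MetricSpace V] {m : ℕ} {I : Problem V m}
  {e : V ≃ Fin (Fintype.card V)} {U : Finset V} {γ : ℝ} {T : ℕ} {ε : Fin U.card ≃ U}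

theorem repeatLoop_law [Nonempty V] {A : AssignRule I}
    (hk : ∑ i, I.lower i ≤ I.k) (hlu : ∀ i, I.lower i ≤ I.upper i)
    (hA : ∀ (N : ℕ) (D : Fin N → Finset V) (cl : ℕ → ℕ), N ≤ Fintype.card V →
      Represents I e D ((inputStore I e 0 0 0 0).arr 0) cl →
      (∀ v, Fintype.card V ≤ v → cl v = 0) →
      A.solve D = flowOf I N (coreAssign (distByIndex e) I e cl)) (hγ : 0 < γ)
    (hU : ∀ u ∈ U, ∀ v ∈ U, I.color u = I.color v → u ≠ v → γ ≤ dist u v) {s : Store}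
    (hs : Ready I e U γ T ε s) :
    ((Prog.loop 12 (.var 4) (.loop 13 (.var 1)
        (.ite (.eq (.var 9) (.lit 0)) repetitionProg .skip))).exec (distByIndex e) s).map
      (Store.result e) = kernelPow (repeatStep I A U γ) (T * m) (s.result e) := by
  have hset : ∀ (x : ℕ), 12 ≤ x → ∀ (s : Store) (i : ℕ), Ready I e U γ T ε s →
      Ready I e U γ T ε ((s.setNum x i).tick 1) := fun x hx s i h =>
    h.of_eq (fun y hy => by
      have : y ≠ x := by omega
      simp [this]) (fun _ _ => rfl) rfl
  have htick : ∀ (t : ℕ) (s : Store), Ready I e U γ T ε s → Ready I e U γ T ε (s.tick t) :=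
    fun t s h => h.of_eq (fun _ _ => rfl) (fun _ _ => rfl) rfl
  have hres : ∀ (x : ℕ), 12 ≤ x → ∀ (s : Store) (i : ℕ),
      Store.result e ((s.setNum x i).tick 1) = s.result e := fun x hx s i => by
    have : 9 ≠ x := by omega
    refine Prod.ext rfl ?_
    simp [Store.result, this]
  have hbody : ∀ s, Ready I e U γ T ε s →
      ((Prog.ite (.eq (.var 9) (.lit 0)) repetitionProg .skip).exec (distByIndex e) s).map
        (Store.result e) = repeatStep I A U γ (s.result e) ∧
      ∀ s' ∈ ((Prog.ite (.eq (.var 9) (.lit 0)) repetitionProg .skip).exec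
        (distByIndex e) s).support, Ready I e U γ T ε s' := by
    intro s hs
    by_cases h9 : s.num 9 = 0
    · rw [Prog.exec_ite_pos _ _ _ _ (show Test.Holds _ s (.eq (.var 9) (.lit 0)) from h9)]
      exact repetitionProg_law hk hlu hA hγ hU (htick _ s hs) h9
    · rw [Prog.exec_ite_neg _ _ _ _ (show ¬ Test.Holds _ s (.eq (.var 9) (.lit 0)) from h9)]
      constructor
      · rw [repeatStep, if_pos (by simpa [Store.result] using h9), Prog.exec, PMF.pure_map]
        rfl
      · intro s' hs'
        rw [Prog.exec, PMF.support_pure, Set.mem_singleton_iff] at hs'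
        rw [hs']
        exact htick _ _ (htick _ _ hs)
  have hinner : ∀ s, Ready I e U γ T ε s →
      ((Prog.loop 13 (.var 1) (.ite (.eq (.var 9) (.lit 0)) repetitionProg .skip)).exec
        (distByIndex e) s).map (Store.result e) =
        kernelPow (repeatStep I A U γ) m (s.result e) ∧
      ∀ s' ∈ ((Prog.loop 13 (.var 1) (.ite (.eq (.var 9) (.lit 0)) repetitionProg .skip)).exec
        (distByIndex e) s).support, Ready I e U γ T ε s' := by
    intro s hs
    have h1 : s.num 1 = m := hs.num 1 (by decide)
    have := iterRounds_law (f := repeatStep I A U γ) (hset 13 (by decide)) (hres 13 (by decide))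
      hbody m (s.tick 2) (htick _ s hs)
    change (PMF.map _ (iterRounds 13 _ (s.num 1) (s.tick 2))) = _ ∧
      ∀ s' ∈ (iterRounds 13 _ (s.num 1) (s.tick 2)).support, _
    rw [h1]
    exact this
  rw [← kernelPow_mul]
  change (PMF.map _ (iterRounds 12 _ (s.num 4) (s.tick 2))) = _
  rw [hs.num_four]
  exact (iterRounds_law (hset 12 (by decide)) (hres 12 (by decide)) hinner T (s.tick 2)
    (htick _ s hs)).1

variable (I e) in
theorem ready_of_prune [Nonempty V] (hγ : 0 < γ) {pick : Finset V → V}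
    (hpick : ∀ A : Finset V, A.Nonempty → pick A ∈ A)
    (hmin : ∀ A : Finset V, ∀ v ∈ A, (e (pick A) : ℕ) ≤ e v) (b : ℕ) :
    ∃ ε : Fin (prune I pick γ (Fintype.card V)).card ≃ prune I pick γ (Fintype.card V),
      Ready I e (prune I pick γ (Fintype.card V)) γ T ε
        ((pruneProg ;; radiiProg).run (distByIndex e) (inputStore I e γ γ b T)) := by
  have hP := pruneProg_run (δ := distByIndex e) (s := inputStore I e γ γ b T) (fun _ => rfl)
    (fun _ => rfl) rfl
  have hF := Prog.frame (distByIndex e) pruneProg (inputStore I e γ γ b T)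
  rw [Prog.run_seq]
  generalize pruneProg.run (distByIndex e) (inputStore I e γ γ b T) = s₁ at hP hF ⊢
  have hr := radiiProg_run (δ := distByIndex e) (s := s₁)
  have hF' := Prog.frame (distByIndex e) radiiProg s₁
  generalize radiiProg.run (distByIndex e) s₁ = s₂ at hr hF' ⊢
  have hnum : ∀ x ≤ 4, s₂.num x = (inputStore I e γ γ b T).num x := fun x hx => by
    interval_cases x <;> exact (hF'.num _ rfl).trans (hF.num _ rfl)
  have harr : ∀ a, a ≤ 3 ∨ 7 ≤ a → a ≤ 15 → s₂.arr a = (inputStore I e γ γ b T).arr a :=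
    fun a ha ha' => by
      interval_cases a <;> first | omega | exact (hF'.arr _ rfl).trans (hF.arr _ rfl)
  change PruneInv _ γ (Fintype.card V) _ (Fintype.card V) s₁ at hP
  set U := prune I pick γ (Fintype.card V) with hUdef
  have hsel : ∀ v, v ∈ U ↔ s₁.arr 5 (e v) ≠ 0 := fun v => by
    refine mem_prune_iff I e hγ hpick hmin (sel := s₁.arr 5) (fun v => ?_) v
    rw [hP.chosen (e v) (e v).2, not_iff_not]
    constructor
    · rintro ⟨w, hw, h1, h2, h3⟩
      obtain ⟨y, rfl⟩ : ∃ y, w = (e y : ℕ) := ⟨e.symm ⟨w, hw.trans (e v).2⟩, by simp⟩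
      rw [distByIndex_apply] at h3
      simp only [inputStore, Fin.is_lt, ↓reduceDIte, Fin.eta, Equiv.symm_apply_apply] at h2
      exact ⟨y, hw, h1, Fin.ext h2, h3⟩
    · rintro ⟨y, hw, h1, h2, h3⟩
      refine ⟨e y, hw, h1, ?_, by rwa [distByIndex_apply]⟩
      simp [inputStore, h2]
  let f : Fin (s₁.num 6) → U := fun t => ⟨e.symm ⟨s₁.arr 6 t, (hP.list_mem t t.2).1⟩, by
    rw [hsel, Equiv.apply_symm_apply]
    exact (hP.list_mem t t.2).2⟩
  have hf : ∀ t, (e (f t) : ℕ) = s₁.arr 6 t := fun t => by simp [f]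
  have hbij : Function.Bijective f := by
    constructor
    · intro t t' h
      refine Fin.ext (hP.list_inj t t.2 t' t'.2 ?_)
      rw [← hf, ← hf, h]
    · intro u
      obtain ⟨t, ht, h⟩ := hP.list_surj (e u) (e u).2 ((hsel u).1 u.2)
      refine ⟨⟨t, ht⟩, Subtype.ext (e.injective (Fin.ext ?_))⟩
      rw [hf, h]
  have hcard : s₁.num 6 = U.card := by
    have := Fintype.card_of_bijective hbij
    rwa [Fintype.card_fin, Fintype.card_coe] at this
  have hreal : s₁.real 1 = γ := hF.real 1 rfl
  have h1 : s₁.num 1 = m := hF.num 1 rfl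
  rw [h1, hreal] at hr
  refine ⟨(finCongr hcard.symm).trans (Equiv.ofBijective f hbij), fun x hx => ?_, fun a ha => ?_,
    hnum 4 (by decide), (hF'.num 6 rfl).trans hcard, hr.1, hr.2.1, hr.2.2, fun v => ?_,
    fun t => ?_, fun v _ => ?_, fun a ha ha' i _ => ?_⟩
  · rw [hnum x (by omega)]
    interval_cases x <;> rfl
  · rw [harr a (by omega) (by omega)]
    interval_cases a <;> rfl
  · rw [hF'.arr 5 rfl, hsel]
  · rw [hF'.arr 6 rfl]
    exact (hf (finCongr hcard.symm t)).symm
  · rw [harr 11 (by omega) (by omega)]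
    rfl
  · rw [harr a (by omega) (by omega)]
    interval_cases a <;> rfl

variable (I e) in
-- The choices realized are: pick the unmarked point of least number, and use the same assignment
-- rule in every repetition.
theorem mainProg_law [Nonempty V] (hγ : 0 < γ) (hk : ∑ i, I.lower i ≤ I.k)
    (hlu : ∀ i, I.lower i ≤ I.upper i) : ∃ χ : Choices I,
      (mainProg.exec (distByIndex e) (inputStore I e γ γ (Fintype.card V) T)).map (outputSet e) =
        fmmd I χ γ γ (Fintype.card V) T := by
  obtain ⟨pick, hpick, hmin⟩ := exists_pick_min e
  obtain ⟨A, hA⟩ := exists_assignRule I e (distByIndex e) hlu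
  refine ⟨⟨pick, hpick, fun _ => A⟩, ?_⟩
  obtain ⟨ε, hready⟩ := ready_of_prune (T := T) I e hγ hpick hmin (Fintype.card V)
  obtain ⟨hsep, -⟩ := prune_spec I hpick (P := fun _ _ => True) (fun _ _ _ => trivial) hγ
  have hlaw := repeatLoop_law hk hlu hA hγ hsep hready
  have hF := Prog.frame (distByIndex e) (pruneProg ;; radiiProg)
    (inputStore I e γ γ (Fintype.card V) T)
  have hexec : mainProg.exec (distByIndex e) (inputStore I e γ γ (Fintype.card V) T) =
      (Prog.loop 12 (.var 4) (.loop 13 (.var 1)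
        (.ite (.eq (.var 9) (.lit 0)) repetitionProg .skip))).exec (distByIndex e)
        ((pruneProg ;; radiiProg).run (distByIndex e)
          (inputStore I e γ γ (Fintype.card V) T)) := by
    unfold mainProg
    rw [Prog.exec_seq, Prog.exec_eq_pure _ pruneProg (by decide), PMF.pure_bind, Prog.exec_seq,
      Prog.exec_eq_pure _ radiiProg (by decide), PMF.pure_bind]
    rfl
  rw [hexec]
  generalize (pruneProg ;; radiiProg).run (distByIndex e)
    (inputStore I e γ γ (Fintype.card V) T) = s at hlaw hF ⊢
  have hres : s.result e = (∅, false) := by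
    rw [Store.result, outputSet, hF.arr 3 rfl, hF.num 9 rfl]
    simp [inputStore]
  rw [hres] at hlaw
  rw [fmmd, ← kernelPow_repeatStep, ← hlaw, PMF.map_comp]
  rfl

end Main


/-! ### The running time -/

section Takes

variable {a b c : ℕ}

theorem takes_guardedSet {x : ℕ} {i e : NatExpr} : Takes (guardedSet x i e) a b c :=
  takes_ite takes_setArr takes_skip

theorem takes_clearProg {x : ℕ} : Takes (clearProg x) (a + 1) (b + 1) c :=
  -- The factor 4 comes from n + m + 2 ≤ 4nm for n, m ≥ 1.
  takes_loop (c := c) (c' := 0) (by decide) 4 (fun s hn hm _ => by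
    rw [boundExpr_eval, pow_one, pow_one, pow_zero, mul_one]
    nlinarith [Nat.mul_le_mul hn hm]) takes_guardedSet

theorem takes_pruneProg : Takes pruneProg 2 2 1 := by
  unfold pruneProg
  repeat' first
    | with_reducible exact takes_skip
    | with_reducible exact takes_setArr
    | with_reducible exact takes_setNum (by decide)
    | with_reducible refine takes_seq ?_ ?_
    | with_reducible refine takes_ite ?_ ?_
    | with_reducible refine takes_loop_n (by decide) ?_

theorem takes_radiiProg : Takes radiiProg 2 2 1 := by
  unfold radiiProg floorProg
  repeat' first
    | with_reducible exact takes_skip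
    | with_reducible exact takes_setReal
    | with_reducible exact takes_setNum (by decide)
    | with_reducible refine takes_seq ?_ ?_
    | with_reducible refine takes_ite ?_ ?_
    | with_reducible refine takes_loop_m (by decide) ?_

/-- The deepest nesting is over n centers, m queue entries and n scanned points. -/
theorem takes_decomposeProg : Takes decomposeProg 2 1 0 := by
  unfold decomposeProg centerProg bfsProg scanProg claimProg
  repeat' first
    | with_reducible exact takes_skip
    | with_reducible exact takes_setArr
    | with_reducible exact takes_setNum (by decide)
    | with_reducible refine takes_seq ?_ ?_
    | with_reducible refine takes_ite ?_ ?_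
    | with_reducible refine takes_loop_n (by decide) ?_
    | with_reducible refine takes_loop_m (by decide) ?_

/-- The deepest nesting is over n + 1 rounds, m sweeps and n points. -/
theorem takes_phaseProg (cap : ℕ) : Takes (phaseProg cap) 2 1 0 := by
  unfold phaseProg roundProg searchProg sweepProg targetProg flipProg
  repeat' first
    | with_reducible exact takes_skip
    | with_reducible exact takes_guardedSet
    | with_reducible exact takes_setNum (by decide)
    | with_reducible refine takes_seq ?_ ?_
    | with_reducible refine takes_ite ?_ ?_
    | with_reducible refine takes_loop_n (by decide) ?_
    | with_reducible refine takes_loop_succ_n (by decide) ?_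
    | with_reducible refine takes_loop_m (by decide) ?_

theorem takes_assignProg : Takes assignProg 2 1 0 := by
  unfold assignProg prepareProg coreProg outProg
  repeat' first
    | with_reducible exact takes_skip
    | with_reducible exact takes_phaseProg _
    | with_reducible exact takes_clearProg
    | with_reducible exact takes_setArr
    | with_reducible exact takes_setNum (by decide)
    | with_reducible refine takes_seq ?_ ?_
    | with_reducible refine takes_ite ?_ ?_
    | with_reducible refine takes_loop_n (by decide) ?_
    | with_reducible refine takes_loop_m (by decide) ?_

/-- One repetition costs O(mn²), and the two outer loops contribute the factor Tm. Pruning and radii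
are cheaper but are stated with the same exponents so that the costs can be added. -/
theorem takes_mainProg : Takes mainProg 2 2 1 := by
  refine takes_seq takes_pruneProg (takes_seq takes_radiiProg
    (takes_loop_T (by decide) (takes_loop_m (by decide) (takes_ite ?_ takes_skip))))
  exact takes_seq takes_shuffle (takes_seq (takes_rand (by decide))
    (takes_seq (takes_setNum (by decide)) (takes_seq takes_decomposeProg takes_assignProg)))

end Takes

theorem exists_program : ∃ (C : ℕ) (p : Prog),
    ∀ (V : Type u) [Fintype V] [MetricSpace V] [Nonempty V] (m : ℕ) (I : Problem V m)
      (τ : ℝ) (T : ℕ), 0 < τ → 1 ≤ T → I.k ≤ m →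
      (∀ i, I.lower i ≤ I.upper i) → ∑ i, I.lower i ≤ I.k →
      ∀ e : V ≃ Fin (Fintype.card V),
        Implements p I e (τ / 3) (τ / 3) (Fintype.card V) T
          (C * (T * m ^ 2 * Fintype.card V ^ 2)) := by
  obtain ⟨C, hC⟩ := takes_mainProg
  refine ⟨C, mainProg, fun V _ _ _ m I τ T hτ hT _ hlu hk e =>
    ⟨mainProg_law I e (by positivity) hk hlu, fun s hs => ?_⟩⟩
  refine (hC _ _ ?_ ?_ ?_ s hs).2.trans_eq ?_
  · exact Fintype.card_pos
  · exact (I.color (Classical.arbitrary V)).pos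
  · exact hT
  · change 0 + C * (Fintype.card V ^ 2 * m ^ 2 * T ^ 1) = _
    ring

end FairDiv
theorem proposition6 :
    -- the guarantee, for every way of making the choices that the algorithm leaves open
    (∃ c : ℝ, 0 < c ∧
      ∀ (V : Type u) [Fintype V] [MetricSpace V] [Nonempty V] (m : ℕ) (I : FairDiv.Problem V m)
        (τ : ℝ) (T : ℕ), 0 < τ → I.k ≤ m →
        (∃ O : Finset V, I.Feasible O ∧ ENNReal.ofReal τ ≤ FairDiv.diversity O) →
        ∀ χ : FairDiv.Choices I,
          ENNReal.ofReal (1 - (2 : ℝ) ^ (-(c * (T : ℝ)))) ≤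
            (FairDiv.fmmd I χ (τ / 3) (τ / 3) (Fintype.card V) T).toOuterMeasure
              {S | I.Feasible S ∧
                ENNReal.ofReal (Real.sqrt (Real.log m) * τ / (3 * m)) ≤ FairDiv.diversity S}) ∧
    -- the running time
    (∃ (C : ℕ) (p : FairDiv.Prog),
      ∀ (V : Type u) [Fintype V] [MetricSpace V] [Nonempty V] (m : ℕ) (I : FairDiv.Problem V m)
        (τ : ℝ) (T : ℕ), 0 < τ → 1 ≤ T → I.k ≤ m →
        (∀ i, I.lower i ≤ I.upper i) → ∑ i, I.lower i ≤ I.k →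
        ∀ e : V ≃ Fin (Fintype.card V),
          FairDiv.Implements p I e (τ / 3) (τ / 3) (Fintype.card V) T
            (C * (T * m ^ 2 * Fintype.card V ^ 2))) := by
  exact ⟨FairDiv.approximation_guarantee, FairDiv.exists_program⟩
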